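/- Let $n\ge 1$, $\gamma>1$ and $b>1$ be given. There is a constant $C=C_{n,\gamma,b}>0$ with the following property. Let $\overline X$ be a smooth $(n+1)$-dimensional manifold with boundary (not necessarily compact, and with no restriction on its boundary), let $X$ be its interior, and let $g_+$ be a complete Poincaré–Einstein metric on $X$: it is complete, $\mathrm{Ric}_{g_+}=-n\,g_+$, and for some smooth boundary defining function $x$ the metric $x^2g_+$ extends to a $C^2$ Riemannian metric on $\overline X$. (A boundary defining function is a function $x$ on $\overline X$ with $x>0$ in $X$, and $x=0$, $dx\ne 0$ on $\partial X$.) Put $s=\frac n2+\gamma$ and let $\rho\in C^1(\overline X)$ be an adapted boundary defining function with parameter $s$, that is, a boundary defining function such that in $X$ - if $s\neq n$, $\rho=v^{1/(n-s)}$ for a positive $C^2$ function $v$ with $-\Delta_{g_+}v-s(n-s)v=0$; - if $s=n$, $\rho=e^{w}$ for a $C^2$ function $w$ with $-\Delta_{g_+}w=n$. Here $\Delta_{g_+}$ is the divergence of the gradient. Let $g=\rho^2g_+$ on $X$, and assume that its scalar curvature $R$ is nonnegative on $X$. Then for every real $p$ and every $f\in C_c^\infty(X)$ (so the support of $f$ is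 a compact subset of the interior $X$), $$\int_{\{\rho\le p\}}\Big(\rho^{1-2b}|\nabla\rho|^2f^2+\rho^{3-2b}R f^2\Big)\,dV+\oint_{\{\rho=p\}}\rho^{2-2b}|\nabla\rho|f^2\,dA\;\le\; C\int_{\{\rho\le p\}}\rho^{3-2b}|\nabla f|^2\,dV,$$ and the right-hand side is finite. Gradients, norms, the volume $dV$ and the $n$-dimensional area $dA$ on the level set $\{\rho=p\}\subset X$ are those of $g$; critical points of $\rho$ on the level set contribute nothing to the boundary integral because of the factor $|\nabla\rho|$. -/

import Mathlib

open Set Filter MeasureTheory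
open scoped Manifold ContDiff Topology ENNReal Bundle

noncomputable section

namespace PoincareEinstein

/-! ### Tensor calculus in coordinates

`G : ℝᵈ → Matrix` is the matrix of components of a Riemannian metric in local coordinates. -/

section Coordinates

variable {d : ℕ}

/-- The partial derivative `∂ᵢ u` at `y`. -/
def pd (i : Fin d) (u : EuclideanSpace ℝ (Fin d) → ℝ) (y : EuclideanSpace ℝ (Fin d)) : ℝ :=
  fderiv ℝ u y (EuclideanSpace.single i (1 : ℝ))

/-- The Christoffel symbol `Γᵏᵢⱼ = ½ Gᵏˡ (∂ᵢ Gⱼₗ + ∂ⱼ Gᵢₗ - ∂ₗ Gᵢⱼ)`. -/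
def christoffel (G : EuclideanSpace ℝ (Fin d) → Matrix (Fin d) (Fin d) ℝ)
    (k i j : Fin d) (y : EuclideanSpace ℝ (Fin d)) : ℝ :=
  (1 / 2) * ∑ l, (G y)⁻¹ k l *
    (pd i (fun z => G z j l) y + pd j (fun z => G z i l) y - pd l (fun z => G z i j) y)

/-- The Ricci tensor
`Ricᵢⱼ = ∂ₖ Γᵏᵢⱼ - ∂ᵢ Γᵏₖⱼ + Γᵏₖₗ Γˡᵢⱼ - Γᵏᵢₗ Γˡₖⱼ` (positive on round spheres). -/
def ricci (G : EuclideanSpace ℝ (Fin d) → Matrix (Fin d) (Fin d) ℝ)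
    (i j : Fin d) (y : EuclideanSpace ℝ (Fin d)) : ℝ :=
  (∑ k, pd k (christoffel G k i j) y) - (∑ k, pd i (christoffel G k k j) y)
    + (∑ k, ∑ l, christoffel G k k l y * christoffel G l i j y)
    - ∑ k, ∑ l, christoffel G k i l y * christoffel G l k j y

/-- The scalar curvature `Gⁱʲ Ricᵢⱼ`. -/
def scalar (G : EuclideanSpace ℝ (Fin d) → Matrix (Fin d) (Fin d) ℝ)
    (y : EuclideanSpace ℝ (Fin d)) : ℝ :=
  ∑ i, ∑ j, (G y)⁻¹ i j * ricci G i j y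

/-- The Laplace–Beltrami operator (divergence of the gradient)
`Δ u = (det G)^(-1/2) ∂ᵢ ((det G)^(1/2) Gⁱʲ ∂ⱼ u)`. -/
def laplacian (G : EuclideanSpace ℝ (Fin d) → Matrix (Fin d) (Fin d) ℝ)
    (u : EuclideanSpace ℝ (Fin d) → ℝ) (y : EuclideanSpace ℝ (Fin d)) : ℝ :=
  (√(G y).det)⁻¹ *
    ∑ i, pd i (fun z => √(G z).det * ∑ j, (G z)⁻¹ i j * pd j u z) y

end Coordinates

/-! ### Riemannian metrics on a manifold without boundary -/

section Manifold

variable {d : ℕ} {X : Type*} [TopologicalSpace X] [ChartedSpace (EuclideanSpace ℝ (Fin d)) X]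

/-- A field of bilinear forms on the tangent spaces of the `d`-dimensional manifold `X`. -/
abbrev MetricField (d : ℕ) (X : Type*) [TopologicalSpace X]
    [ChartedSpace (EuclideanSpace ℝ (Fin d)) X] :=
  ∀ x : X, TangentSpace (𝓡 d) x →L[ℝ] TangentSpace (𝓡 d) x →L[ℝ] ℝ

/-- A Riemannian metric of class `C²` on `X`. -/
abbrev C2Metric (d : ℕ) (X : Type*) [TopologicalSpace X]
    [ChartedSpace (EuclideanSpace ℝ (Fin d)) X] [IsManifold (𝓡 d) ∞ X] :=
  Bundle.ContMDiffRiemannianMetric (𝓡 d) 2 (EuclideanSpace ℝ (Fin d))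
    (fun x : X => TangentSpace (𝓡 d) x)

/-- The conformal metric `u² g`. -/
def conformal (u : X → ℝ) (g : MetricField d X) : MetricField d X := fun x => (u x) ^ 2 • g x

/-- The components of the pull-back `ψ^* g` of `g` by a map `ψ` from `ℝᵏ` to `X`. -/
def pullbackGram (g : MetricField d X) {k : ℕ} (ψ : EuclideanSpace ℝ (Fin k) → X)
    (y : EuclideanSpace ℝ (Fin k)) : Matrix (Fin k) (Fin k) ℝ :=
  Matrix.of fun i j =>
    g (ψ y) (mfderiv (𝓡 k) (𝓡 d) ψ y (EuclideanSpace.single i (1 : ℝ)))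
      (mfderiv (𝓡 k) (𝓡 d) ψ y (EuclideanSpace.single j (1 : ℝ)))

/-- The components of `g` in the chart with centre `c`, as functions of the coordinates. -/
def chartMetric (g : MetricField d X) (c : X) :
    EuclideanSpace ℝ (Fin d) → Matrix (Fin d) (Fin d) ℝ :=
  pullbackGram g (extChartAt (𝓡 d) c).symm

/-- The scalar curvature of `g` at `x`, computed in the chart with centre `x` (its value does not
depend on the chart). -/
def scalarCurvature (g : MetricField d X) (x : X) : ℝ :=
  scalar (chartMetric g x) (extChartAt (𝓡 d) x x)

/-- The Einstein equation `Ric g = lam • g`, in local coordinates. -/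
def IsEinstein (g : MetricField d X) (lam : ℝ) : Prop :=
  ∀ c : X, ∀ y ∈ (extChartAt (𝓡 d) c).target, ∀ i j : Fin d,
    ricci (chartMetric g c) i j y = lam * chartMetric g c y i j

/-- `Δ u = h` on `X`, in local coordinates; `Δ` is the Laplace–Beltrami operator of `g`. -/
def LaplacianEq (g : MetricField d X) (u h : X → ℝ) : Prop :=
  ∀ c : X, ∀ y ∈ (extChartAt (𝓡 d) c).target,
    laplacian (chartMetric g c) (u ∘ (extChartAt (𝓡 d) c).symm) y
      = h ((extChartAt (𝓡 d) c).symm y)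

/-- The matrix of `g x` in the standard basis of `T_x X`. -/
def gramAt (g : MetricField d X) (x : X) : Matrix (Fin d) (Fin d) ℝ :=
  Matrix.of fun i j =>
    g x (EuclideanSpace.single i (1 : ℝ) : EuclideanSpace ℝ (Fin d))
      (EuclideanSpace.single j (1 : ℝ) : EuclideanSpace ℝ (Fin d))

/-- The value `du(eᵢ)` of the differential of `u` at `x` on the standard basis of `T_x X`. -/
def partialAt (u : X → ℝ) (x : X) (i : Fin d) : ℝ :=
  mfderiv (𝓡 d) 𝓘(ℝ, ℝ) u x (EuclideanSpace.single i (1 : ℝ) : EuclideanSpace ℝ (Fin d))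

/-- The squared norm `|∇ u|²` of the gradient with respect to `g`, that is
`gⁱʲ du(eᵢ) du(eⱼ)` in any basis `e` of `T_x X`. -/
def gradSq (g : MetricField d X) (u : X → ℝ) (x : X) : ℝ :=
  ∑ i, ∑ j, (gramAt g x)⁻¹ i j * partialAt u x i * partialAt u x j

/-- The norm `|∇ u|` of the gradient with respect to `g`. -/
def gradNorm (g : MetricField d X) (u : X → ℝ) (x : X) : ℝ := √(gradSq g u x)

/-- Completeness: every Cauchy sequence of the Riemannian distance converges. -/
def IsCompleteMetric [IsManifold (𝓡 d) ∞ X] (g : C2Metric d X) : Prop :=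
  letI : Bundle.RiemannianBundle (fun x : X => TangentSpace (𝓡 d) x) := ⟨g.toRiemannianMetric⟩
  ∀ u : ℕ → X,
    (∀ ε : ℝ≥0∞, 0 < ε → ∃ N, ∀ i ≥ N, ∀ j ≥ N, Manifold.riemannianEDist (𝓡 d) (u i) (u j) < ε) →
    ∃ x, Tendsto u atTop (𝓝 x)

/-! ### Volume and area -/

/-- An injective `C¹` parametrization `ψ : U → S` of a piece of `S` by an open set `U ⊆ ℝᵏ`. -/
structure IsPatch (d : ℕ) {X : Type*} [TopologicalSpace X]
    [ChartedSpace (EuclideanSpace ℝ (Fin d)) X] {k : ℕ} (S : Set X)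
    (ψ : EuclideanSpace ℝ (Fin k) → X) (U : Set (EuclideanSpace ℝ (Fin k))) : Prop where
  isOpen : IsOpen U
  contMDiffOn : ContMDiffOn (𝓡 k) (𝓡 d) 1 ψ U
  injOn : InjOn ψ U
  mapsTo : MapsTo ψ U S

/-- The `k`-dimensional area of a parametrized piece: the image under `ψ` of the measure
`√det(ψ^* g) dy` on `U`. -/
def patchMeasure [MeasurableSpace X] (g : MetricField d X) {k : ℕ}
    (ψ : EuclideanSpace ℝ (Fin k) → X) (U : Set (EuclideanSpace ℝ (Fin k))) : Measure X :=
  (((volume : Measure (EuclideanSpace ℝ (Fin k))).restrict U).withDensity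
    (fun y => ENNReal.ofReal √(pullbackGram g ψ y).det)).map ψ

/-- The `k`-dimensional Riemannian area measure of a `k`-dimensional submanifold `S` of `(X, g)`,
as a measure on `X` concentrated on `S`: the least measure that is at least the area of each
parametrized piece of `S`. Areas of two pieces agree on their overlap, so on every parametrized
piece of `S` this measure is `√det(ψ^* g) dy`. -/
def areaMeasure [MeasurableSpace X] (g : MetricField d X) (k : ℕ) (S : Set X) : Measure X :=
  ⨆ (ψ : EuclideanSpace ℝ (Fin k) → X) (U : Set (EuclideanSpace ℝ (Fin k)))
    (_ : IsPatch d S ψ U), patchMeasure g ψ U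

/-- The Riemannian volume measure of `(X, g)`. -/
def volumeMeasure [MeasurableSpace X] (g : MetricField d X) : Measure X :=
  areaMeasure g d univ

end Manifold

/-! ### Poincaré–Einstein manifolds and adapted boundary defining functions -/

section Compactification

variable {n : ℕ} {X : Type*} [TopologicalSpace X] [ChartedSpace (EuclideanSpace ℝ (Fin (n + 1))) X]
  {Xbar : Type*} [TopologicalSpace Xbar] [ChartedSpace (EuclideanHalfSpace (n + 1)) Xbar]

/-- `ι` is a diffeomorphism of `X` onto the interior of the manifold with boundary `Xbar`. -/
structure IsInteriorOf (n : ℕ) {X : Type*} [TopologicalSpace X]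
    [ChartedSpace (EuclideanSpace ℝ (Fin (n + 1))) X]
    {Xbar : Type*} [TopologicalSpace Xbar] [ChartedSpace (EuclideanHalfSpace (n + 1)) Xbar]
    (ι : X → Xbar) : Prop where
  isOpenEmbedding : Topology.IsOpenEmbedding ι
  range_eq : range ι = (𝓡∂ (n + 1)).interior Xbar
  contMDiff : ContMDiff (𝓡 (n + 1)) (𝓡∂ (n + 1)) ∞ ι
  injective_mfderiv : ∀ x, Function.Injective (mfderiv (𝓡 (n + 1)) (𝓡∂ (n + 1)) ι x)

/-- `x` is a boundary defining function of class `Cᵏ` on `Xbar`. -/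
structure IsBoundaryDefining (n : ℕ) {Xbar : Type*} [TopologicalSpace Xbar]
    [ChartedSpace (EuclideanHalfSpace (n + 1)) Xbar] (k : ℕ∞ω) (x : Xbar → ℝ) : Prop where
  contMDiff : ContMDiff (𝓡∂ (n + 1)) 𝓘(ℝ, ℝ) k x
  pos : ∀ q ∈ (𝓡∂ (n + 1)).interior Xbar, 0 < x q
  eq_zero : ∀ q ∈ (𝓡∂ (n + 1)).boundary Xbar, x q = 0
  mfderiv_ne_zero : ∀ q ∈ (𝓡∂ (n + 1)).boundary Xbar,
    mfderiv (𝓡∂ (n + 1)) 𝓘(ℝ, ℝ) x q ≠ 0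

/-- `g` is a (complete) Poincaré–Einstein metric on the interior `X` of `Xbar`: it is complete,
`Ric g = -n g`, and for some smooth boundary defining function `x` the metric `x² g` extends to a
`C²` Riemannian metric on `Xbar`. -/
structure IsPoincareEinstein [IsManifold (𝓡 (n + 1)) ∞ X] [IsManifold (𝓡∂ (n + 1)) ∞ Xbar]
    (ι : X → Xbar) (g : C2Metric (n + 1) X) : Prop where
  complete : IsCompleteMetric g
  einstein : IsEinstein g.inner (-(n : ℝ))
  compactification : ∃ x : Xbar → ℝ, IsBoundaryDefining n ∞ x ∧
    ∃ gbar : Bundle.ContMDiffRiemannianMetric (𝓡∂ (n + 1)) 2 (EuclideanSpace ℝ (Fin (n + 1)))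
        (fun q : Xbar => TangentSpace (𝓡∂ (n + 1)) q),
      ∀ (q : X) (v w : TangentSpace (𝓡 (n + 1)) q),
        gbar.inner (ι q) (mfderiv (𝓡 (n + 1)) (𝓡∂ (n + 1)) ι q v)
          (mfderiv (𝓡 (n + 1)) (𝓡∂ (n + 1)) ι q w) = x (ι q) ^ 2 * g.inner q v w

/-- `ρ` is an adapted boundary defining function with parameter `s` for `g`: a `C¹` boundary
defining function which in the interior is `v ^ (1 / (n - s))` with `-Δ v - s (n - s) v = 0`
if `s ≠ n`, and `exp w` with `-Δ w = n` if `s = n`. -/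
structure IsAdapted [IsManifold (𝓡 (n + 1)) ∞ X]
    (ι : X → Xbar) (g : C2Metric (n + 1) X) (s : ℝ) (ρ : Xbar → ℝ) : Prop where
  boundaryDefining : IsBoundaryDefining n 1 ρ
  equation_of_ne : s ≠ n → ∃ v : X → ℝ, ContMDiff (𝓡 (n + 1)) 𝓘(ℝ, ℝ) 2 v ∧ (∀ q, 0 < v q) ∧
    (∀ q, ρ (ι q) = v q ^ (1 / ((n : ℝ) - s))) ∧
    LaplacianEq g.inner v (fun q => -(s * ((n : ℝ) - s) * v q))
  equation_of_eq : s = n → ∃ w : X → ℝ, ContMDiff (𝓡 (n + 1)) 𝓘(ℝ, ℝ) 2 w ∧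
    (∀ q, ρ (ι q) = Real.exp (w q)) ∧
    LaplacianEq g.inner w (fun _ => -(n : ℝ))

end Compactification

end PoincareEinstein

end

open PoincareEinstein

/-! Put `w = log ρ` and `s = n/2 + γ`, with all norms those of `g = ρ² g₊`. Both cases in the
definition of an adapted function say the same thing about `w`, namely `Δ_{g₊} w + (n - s)|∇ρ|² =
-s`, because `|dw|²` for `g₊` is `|∇ρ|²` for `g` (`IsAdapted.interior`).

This equation is used twice. Inserted in the conformal change of scalar curvature
(`scalar_conformal`), with Einstein constant `-n`, it gives `R = n(2γ-1) ρ⁻² (1 - |∇ρ|²)`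
(`scalarCurvature_adapted`). Rewritten for the metric `g`, it becomes `-Δ_g ρ = s(1 - |∇ρ|²)/ρ`,
which is used in weak form (`weak_equation`). Together, `Δ_g ρ = -c ρ R` with `c = s/(n(2γ-1)) > 0`.

The divergence of `ρ^(2-2b) f² ∇ρ` is therefore `-2(b-1) ρ^(1-2b)|∇ρ|² f² + 2 ρ^(2-2b) f⟨∇f, ∇ρ⟩ - c
ρ^(3-2b) R f²`. Young's inequality absorbs the cross term in half of the first term, at the price of
`(b-1)⁻¹ ρ^(3-2b)|∇f|²` (`divergence_le`). Integrating over `{ρ ≤ p}` yields the boundary integral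
on one side and the two good terms, with coefficients `b-1` and `c`, on the other. Hence `C =
1/((b-1) min(1, b-1, c))`.

The level `p` may be critical, so the divergence theorem is not applied to `{ρ ≤ p}` itself. The
weak equation is tested with a smooth cutoff in `ρ` times `φ = ρ^(2-2b) f²`. The derivative of the
cutoff concentrates at `ρ = p`, and only a lower bound for its limit is needed. That bound follows
from Fatou's lemma in coordinates where `ρ` is a coordinate (`lintegral_levelSet_le_liminf`,
`lintegral_levelSet_le_setIntegral`). Critical points carry the weight `|∇ρ| = 0`. The support of
`f` is compact in `X`, so nothing is lost at the boundary of the compactification and all integrals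
over `{ρ ≤ p}` are finite. -/

noncomputable section

namespace PoincareEinstein

/-! ### The algebra of the conformal change of the Ricci tensor -/

section ConformalAlgebra

variable {d : ℕ}

/-- The difference `δᵏᵢ wⱼ + δᵏⱼ wᵢ - Gᵢⱼ wᵏ` of the Christoffel symbols of two conformal
metrics. -/
def conformalDiff (G : Matrix (Fin d) (Fin d) ℝ) (w v : Fin d → ℝ) (k i j : Fin d) : ℝ :=
  (if k = i then w j else 0) + (if k = j then w i else 0) - G i j * v k

/-- The second and third terms of `conformalDiff` contribute `w j` and `-w j`, leaving the trace of
the identity. -/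
lemma sum_conformalDiff_diag (G : Matrix (Fin d) (Fin d) ℝ) (w v : Fin d → ℝ)
    (hG : G.IsSymm) (hv : ∀ j, ∑ k, G j k * v k = w j) (j : Fin d) :
    ∑ k, conformalDiff G w v k k j = d * w j := by
  have : ∀ k, G k j = G j k := fun k => hG.apply j k
  simp [conformalDiff, Finset.sum_add_distrib, Finset.sum_sub_distrib, this, hv]

lemma conformalDiff_symm (G : Matrix (Fin d) (Fin d) ℝ) (w v : Fin d → ℝ)
    (hG : G.IsSymm) (k i j : Fin d) : conformalDiff G w v k i j = conformalDiff G w v k j i := by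
  simp only [conformalDiff, hG.apply i j]; ring

lemma trace_conformalDiff (G H : Matrix (Fin d) (Fin d) ℝ) (w v : Fin d → ℝ)
    (hH : H.IsSymm) (htr : ∑ i, ∑ j, H i j * G i j = d) (hHw : ∀ k, ∑ j, H k j * w j = v k)
    (k : Fin d) : ∑ i, ∑ j, H i j * conformalDiff G w v k i j = (2 - d) * v k := by
  have h1 : ∑ i, ∑ j, H i j * (G i j * v k) = d * v k := by
    rw [← htr, Finset.sum_mul]; simp only [Finset.sum_mul, mul_assoc]
  have h2 : ∑ i, H i k * w i = v k := by
    rw [← hHw]; exact Finset.sum_congr rfl fun i _ => by rw [hH.apply k i]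
  simp only [conformalDiff, mul_add, mul_sub, Finset.sum_add_distrib, Finset.sum_sub_distrib, h1,
    mul_ite, mul_zero, Finset.sum_ite_eq, Finset.mem_univ, if_true, h2]
  have h3 : ∑ i, ∑ j, (if k = i then H i j * w j else 0) = v k := by
    rw [Finset.sum_comm]; simp [hHw]
  rw [h3]; ring

/-- The first and last terms of `conformalDiff` both contract to `Bᵏᵢₖ vⁱ` (the last by `H G = 1`
and the symmetry of `B`) and cancel, so only the middle term survives. -/
lemma trace_mul_conformalDiff (G H : Matrix (Fin d) (Fin d) ℝ) (w v : Fin d → ℝ)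
    (B : Fin d → Fin d → Fin d → ℝ) (hB : ∀ k i j, B k i j = B k j i)
    (hHG : H * G = 1) (hHw : ∀ k, ∑ j, H k j * w j = v k) (hG : G.IsSymm) :
    ∑ i, ∑ j, H i j * ∑ k, ∑ l, B k i l * conformalDiff G w v l k j
      = ∑ k, (∑ i, ∑ j, H i j * B k i j) * w k := by
  have hHG' : ∀ i k, ∑ j, H i j * G k j = if i = k then 1 else 0 := fun i k => by
    have := congrFun (congrFun hHG i) k
    rw [Matrix.mul_apply, Matrix.one_apply] at this
    rw [← this]; exact Finset.sum_congr rfl fun j _ => by rw [hG.apply j k]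
  have e1 : ∑ i, ∑ j, H i j * ∑ k, ∑ l, B k i l * (if l = k then w j else 0)
      = ∑ i, (∑ k, B k i k) * v i := by
    refine Finset.sum_congr rfl fun i _ => ?_
    rw [← hHw, Finset.mul_sum]
    refine Finset.sum_congr rfl fun j _ => ?_
    simp only [mul_ite, mul_zero, Finset.sum_ite_eq', Finset.mem_univ, if_true]
    rw [← Finset.sum_mul]; ring
  have e2 : ∑ i, ∑ j, H i j * ∑ k, ∑ l, B k i l * (if l = j then w k else 0)
      = ∑ k, (∑ i, ∑ j, H i j * B k i j) * w k := by
    simp only [mul_ite, mul_zero, Finset.sum_ite_eq', Finset.mem_univ, if_true, Finset.mul_sum,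
      Finset.sum_mul]
    rw [Finset.sum_comm' (t' := Finset.univ) (s' := fun _ => Finset.univ) (by simp)]
    rw [Finset.sum_comm]
    conv_rhs => rw [Finset.sum_comm]
    refine Finset.sum_congr rfl fun i _ => ?_
    rw [Finset.sum_comm]
    exact Finset.sum_congr rfl fun k _ => Finset.sum_congr rfl fun j _ => by ring
  have e3 : ∑ i, ∑ j, H i j * ∑ k, ∑ l, B k i l * (G k j * v l)
      = ∑ i, (∑ k, B k i k) * v i := by
    have : ∀ i, ∑ j, H i j * ∑ k, ∑ l, B k i l * (G k j * v l) = ∑ l, B i i l * v l := by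
      intro i
      calc ∑ j, H i j * ∑ k, ∑ l, B k i l * (G k j * v l)
          = ∑ j, ∑ k, (H i j * G k j) * ∑ l, B k i l * v l := by
            refine Finset.sum_congr rfl fun j _ => ?_
            rw [Finset.mul_sum]
            refine Finset.sum_congr rfl fun k _ => ?_
            rw [Finset.mul_sum, Finset.mul_sum]
            exact Finset.sum_congr rfl fun l _ => by ring
        _ = ∑ k, (∑ j, H i j * G k j) * ∑ l, B k i l * v l := by
            rw [Finset.sum_comm]; simp only [Finset.sum_mul]
        _ = _ := by simp [hHG']
    simp only [this]
    rw [Finset.sum_comm]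
    refine Finset.sum_congr rfl fun i _ => ?_
    rw [Finset.sum_mul]
    exact Finset.sum_congr rfl fun k _ => by rw [hB k i k]
  simp only [conformalDiff, mul_add, mul_sub, Finset.sum_add_distrib, Finset.sum_sub_distrib]
  rw [e1, e2, e3]; ring

/-- The trace of the difference of the Ricci tensors of two conformal metrics. Here `Γ` are the
Christoffel symbols, `dG`, `ww`, `P` the derivatives of `G`, of the covector `w` and of the
vector `v`. -/
lemma trace_ricci_conformal (G H : Matrix (Fin d) (Fin d) ℝ) (w v : Fin d → ℝ)
    (Γ : Fin d → Fin d → Fin d → ℝ) (hΓ : ∀ k i j, Γ k i j = Γ k j i)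
    (dG : Fin d → Fin d → Fin d → ℝ) (ww P : Fin d → Fin d → ℝ)
    (hG : G.IsSymm) (hH : H.IsSymm) (hHG : H * G = 1)
    (hHw : ∀ k, ∑ j, H k j * w j = v k)
    (hdG : ∀ k, ∑ i, ∑ j, H i j * dG k i j = 2 * ∑ l, Γ l l k) :
    ∑ i, ∑ j, H i j * ((∑ k, ((if k = i then ww k j else 0) + (if k = j then ww k i else 0)
          - (dG k i j * v k + G i j * P k k)))
        - d * ww i j
        + ((∑ k, ∑ l, (Γ k k l + conformalDiff G w v k k l) * (Γ l i j + conformalDiff G w v l i j))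
          - ∑ k, ∑ l, Γ k k l * Γ l i j)
        - ((∑ k, ∑ l, (Γ k i l + conformalDiff G w v k i l) * (Γ l k j + conformalDiff G w v l k j))
          - ∑ k, ∑ l, Γ k i l * Γ l k j))
      = (2 - d) * (∑ i, ∑ j, H i j * ww i j - ∑ k, (∑ i, ∑ j, H i j * Γ k i j) * w k)
        - d * ∑ k, (P k k + (∑ l, Γ l l k) * v k)
        + (d - 1) * (2 - d) * ∑ k, v k * w k := by
  set A := conformalDiff G w v with hA
  have hGH : G * H = 1 := mul_eq_one_comm.mp hHG
  have htr : ∑ i, ∑ j, H i j * G i j = d := by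
    have := congrArg Matrix.trace hHG
    simp only [Matrix.trace, Matrix.diag, Matrix.mul_apply, Matrix.one_apply_eq] at this
    simp only [Finset.sum_const, Finset.card_univ, Fintype.card_fin, nsmul_eq_mul, mul_one] at this
    rw [← this]
    exact Finset.sum_congr rfl fun i _ => Finset.sum_congr rfl fun j _ => by rw [hG.apply i j]
  have hGv : ∀ j, ∑ k, G j k * v k = w j := by
    have hv : v = H.mulVec w := funext fun k => (hHw k).symm
    intro j
    have : G.mulVec v = w := by rw [hv, Matrix.mulVec_mulVec, hGH, Matrix.one_mulVec]
    exact congrFun this j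
  have hAs : ∀ k i j, A k i j = A k j i := conformalDiff_symm G w v hG
  have hAd : ∀ j, ∑ k, A k k j = d * w j := sum_conformalDiff_diag G w v hG hGv
  have hAt : ∀ k, ∑ i, ∑ j, H i j * A k i j = (2 - d) * v k :=
    trace_conformalDiff G H w v hH htr hHw
  have comm : ∀ (c : Fin d → ℝ) (B : Fin d → Fin d → Fin d → ℝ),
      ∑ i, ∑ j, H i j * ∑ l, c l * B l i j = ∑ l, c l * ∑ i, ∑ j, H i j * B l i j := by
    intro c B
    simp only [Finset.mul_sum]
    rw [Finset.sum_comm' (t' := Finset.univ) (s' := fun _ => Finset.univ) (by simp)]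
    rw [Finset.sum_comm]
    conv_rhs => rw [Finset.sum_comm]
    refine Finset.sum_congr rfl fun i _ => ?_
    rw [Finset.sum_comm]
    exact Finset.sum_congr rfl fun k _ => Finset.sum_congr rfl fun j _ => by ring
  have t1 : ∑ i, ∑ j, H i j * (∑ k, ((if k = i then ww k j else 0) + (if k = j then ww k i else 0)
          - (dG k i j * v k + G i j * P k k)))
      = 2 * ∑ i, ∑ j, H i j * ww i j - 2 * ∑ k, (∑ l, Γ l l k) * v k - d * ∑ k, P k k := by
    -- Symmetry of `H` replaces symmetry of the second derivatives `ww`, which is not assumed.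
    have a1 : ∑ i, ∑ j, H i j * ww j i = ∑ i, ∑ j, H i j * ww i j := by
      rw [Finset.sum_comm]
      exact Finset.sum_congr rfl fun i _ => Finset.sum_congr rfl fun j _ => by rw [hH.apply i j]
    have a2 : ∑ i, ∑ j, H i j * ∑ k, dG k i j * v k = 2 * ∑ k, (∑ l, Γ l l k) * v k := by
      calc ∑ i, ∑ j, H i j * ∑ k, dG k i j * v k
          = ∑ i, ∑ j, H i j * ∑ k, v k * dG k i j := by simp only [mul_comm]
        _ = ∑ k, v k * ∑ i, ∑ j, H i j * dG k i j := comm v dG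
        _ = _ := by
          rw [Finset.mul_sum]
          exact Finset.sum_congr rfl fun k _ => by rw [hdG]; ring
    have a3 : ∑ i, ∑ j, H i j * ∑ k, G i j * P k k = d * ∑ k, P k k := by
      rw [← htr, Finset.sum_mul]
      refine Finset.sum_congr rfl fun i _ => ?_
      rw [Finset.sum_mul]
      exact Finset.sum_congr rfl fun j _ => by rw [← Finset.mul_sum, mul_assoc]
    simp only [Finset.sum_add_distrib, Finset.sum_sub_distrib, mul_add, mul_sub,
      Finset.sum_ite_eq', Finset.mem_univ, if_true, a1, a2, a3]
    ring
  have t2 : ∑ i, ∑ j, H i j * (d * ww i j) = d * ∑ i, ∑ j, H i j * ww i j := by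
    simp only [Finset.mul_sum]
    exact Finset.sum_congr rfl fun i _ => Finset.sum_congr rfl fun j _ => by ring
  have t3 : ∑ i, ∑ j, H i j *
        ((∑ k, ∑ l, (Γ k k l + A k k l) * (Γ l i j + A l i j)) - ∑ k, ∑ l, Γ k k l * Γ l i j)
      = (2 - d) * ∑ k, (∑ l, Γ l l k) * v k + d * ∑ k, (∑ i, ∑ j, H i j * Γ k i j) * w k
        + d * (2 - d) * ∑ k, v k * w k := by
    -- Every contraction over the first two indices of the difference tensor is `d * w l`, so the
    -- quadratic expression becomes linear in each factor.
    have b1 : ∀ i j,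
        (∑ k, ∑ l, (Γ k k l + A k k l) * (Γ l i j + A l i j)) - ∑ k, ∑ l, Γ k k l * Γ l i j
        = ∑ l, (∑ k, Γ k k l) * A l i j + ∑ l, (d * w l) * Γ l i j + ∑ l, (d * w l) * A l i j := by
      intro i j
      rw [Finset.sum_comm, Finset.sum_comm (f := fun k l => Γ k k l * Γ l i j)]
      rw [← Finset.sum_sub_distrib, ← Finset.sum_add_distrib, ← Finset.sum_add_distrib]
      refine Finset.sum_congr rfl fun l _ => ?_
      rw [← hAd l, ← Finset.sum_mul, ← Finset.sum_mul, Finset.sum_add_distrib]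
      ring
    simp only [b1]
    simp only [mul_add, Finset.sum_add_distrib, comm, hAt]
    simp only [Finset.mul_sum]
    congr 1
    · congr 1
      · exact Finset.sum_congr rfl fun l _ => by ring
      · refine Finset.sum_congr rfl fun l _ => ?_
        simp only [← Finset.mul_sum]; ring
    · exact Finset.sum_congr rfl fun l _ => by ring
  have t4 : ∑ i, ∑ j, H i j *
        ((∑ k, ∑ l, (Γ k i l + A k i l) * (Γ l k j + A l k j)) - ∑ k, ∑ l, Γ k i l * Γ l k j)
      = 2 * ∑ k, (∑ i, ∑ j, H i j * Γ k i j) * w k + (2 - d) * ∑ k, v k * w k := by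
    -- Both mixed terms `Γ A` and `A Γ` have the same trace: exchange `i` with `j` and `k` with `l`.
    have c1 : ∑ i, ∑ j, H i j * ∑ k, ∑ l, Γ k i l * A l k j
        = ∑ k, (∑ i, ∑ j, H i j * Γ k i j) * w k :=
      trace_mul_conformalDiff G H w v Γ hΓ hHG hHw hG
    have c2 : ∑ i, ∑ j, H i j * ∑ k, ∑ l, A k i l * A l k j
        = (2 - d) * ∑ k, v k * w k := by
      rw [trace_mul_conformalDiff G H w v A hAs hHG hHw hG, Finset.mul_sum]
      simp only [hAt, mul_assoc]
    have c3 : ∑ i, ∑ j, H i j * ∑ k, ∑ l, A k i l * Γ l k j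
        = ∑ k, (∑ i, ∑ j, H i j * Γ k i j) * w k := by
      rw [← c1, Finset.sum_comm]
      refine Finset.sum_congr rfl fun i _ => Finset.sum_congr rfl fun j _ => ?_
      rw [hH.apply i j, Finset.sum_comm]
      congr 1
      exact Finset.sum_congr rfl fun k _ => Finset.sum_congr rfl fun l _ => by
        rw [hAs l j k, hΓ k l i]; ring
    have c4 : ∀ i j, ((∑ k, ∑ l, (Γ k i l + A k i l) * (Γ l k j + A l k j))
          - ∑ k, ∑ l, Γ k i l * Γ l k j)
        = (∑ k, ∑ l, Γ k i l * A l k j) + (∑ k, ∑ l, A k i l * Γ l k j)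
          + ∑ k, ∑ l, A k i l * A l k j := by
      intro i j
      simp only [add_mul, mul_add, Finset.sum_add_distrib]; ring
    simp only [c4]
    simp only [mul_add, Finset.sum_add_distrib, c1, c2, c3]
    ring
  simp only [mul_add, mul_sub, Finset.sum_add_distrib, Finset.sum_sub_distrib] at t1 t2 t3 t4 ⊢
  linear_combination t1 - t2 + t3 - t4

end ConformalAlgebra

/-! ### Partial derivatives -/

section PartialDerivatives

variable {d : ℕ} {u v : EuclideanSpace ℝ (Fin d) → ℝ} {y : EuclideanSpace ℝ (Fin d)}

lemma pd_congr (i : Fin d) (h : u =ᶠ[𝓝 y] v) : pd i u y = pd i v y := by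
  rw [pd, pd, h.fderiv_eq]

lemma pd_add (i : Fin d) (hu : DifferentiableAt ℝ u y) (hv : DifferentiableAt ℝ v y) :
    pd i (fun z => u z + v z) y = pd i u y + pd i v y := by
  simp [pd, fderiv_fun_add hu hv]

lemma pd_sub (i : Fin d) (hu : DifferentiableAt ℝ u y) (hv : DifferentiableAt ℝ v y) :
    pd i (fun z => u z - v z) y = pd i u y - pd i v y := by
  simp [pd, fderiv_fun_sub hu hv]

lemma pd_mul (i : Fin d) (hu : DifferentiableAt ℝ u y) (hv : DifferentiableAt ℝ v y) :
    pd i (fun z => u z * v z) y = pd i u y * v y + u y * pd i v y := by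
  simp [pd, fderiv_fun_mul hu hv]; ring

lemma pd_const (i : Fin d) (c : ℝ) : pd i (fun _ => c) y = 0 := by
  simp [pd]

lemma pd_const_mul (i : Fin d) (c : ℝ) (hu : DifferentiableAt ℝ u y) :
    pd i (fun z => c * u z) y = c * pd i u y := by
  simp [pd, fderiv_const_mul hu]

lemma pd_sum {ι : Type*} (s : Finset ι) (f : ι → EuclideanSpace ℝ (Fin d) → ℝ) (i : Fin d)
    (hf : ∀ a ∈ s, DifferentiableAt ℝ (f a) y) :
    pd i (fun z => ∑ a ∈ s, f a z) y = ∑ a ∈ s, pd i (f a) y := by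
  simp [pd, fderiv_fun_sum hf]

lemma pd_comp (i : Fin d) {F : ℝ → ℝ} {F' : ℝ} (hF : HasDerivAt F F' (u y))
    (hu : DifferentiableAt ℝ u y) : pd i (fun z => F (u z)) y = F' * pd i u y := by
  have := (hF.comp_hasFDerivAt y hu.hasFDerivAt).fderiv
  simp only [pd]
  rw [show (fun z => F (u z)) = F ∘ u from rfl, this]; simp

lemma contDiffAt_pd (i : Fin d) {m k : ℕ∞ω} (hu : ContDiffAt ℝ m u y) (h : k + 1 ≤ m) :
    ContDiffAt ℝ k (pd i u) y :=
  (hu.fderiv_right h).clm_apply contDiffAt_const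

end PartialDerivatives

/-! ### Regular metrics in coordinates -/

section CoordinateMetric

variable {d : ℕ} {G : EuclideanSpace ℝ (Fin d) → Matrix (Fin d) (Fin d) ℝ}
  {y : EuclideanSpace ℝ (Fin d)}

lemma contDiffAt_det {E : Type*} [NormedAddCommGroup E] [NormedSpace ℝ E] {ι : Type*} [Fintype ι]
    [DecidableEq ι] {A : E → Matrix ι ι ℝ} {x : E} {m : ℕ∞ω}
    (hA : ∀ i j, ContDiffAt ℝ m (fun z => A z i j) x) :
    ContDiffAt ℝ m (fun z => (A z).det) x := by
  simp only [Matrix.det_apply]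
  exact ContDiffAt.sum fun σ _ => ContDiffAt.const_smul _ (contDiffAt_prod fun i _ => hA _ _)

/-- By Cramer's rule an entry of the inverse is a cofactor divided by the determinant. -/
lemma contDiffAt_inv_entry {E : Type*} [NormedAddCommGroup E] [NormedSpace ℝ E] {ι : Type*}
    [Fintype ι] [DecidableEq ι] {A : E → Matrix ι ι ℝ} {x : E} {m : ℕ∞ω}
    (hA : ∀ i j, ContDiffAt ℝ m (fun z => A z i j) x) (h0 : (A x).det ≠ 0) (i j : ι) :
    ContDiffAt ℝ m (fun z => (A z)⁻¹ i j) x := by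
  simp only [Matrix.inv_def, Matrix.smul_apply, smul_eq_mul, Ring.inverse_eq_inv',
    Matrix.adjugate_apply]
  refine ((contDiffAt_det hA).inv h0).mul (contDiffAt_det fun a b => ?_)
  by_cases h : a = j
  · subst h; simp only [Matrix.updateRow_self]; exact contDiffAt_const
  · simp only [Matrix.updateRow_ne h]; exact hA a b

/-- `G` is a metric of class `C²` near `y`. -/
structure IsRegularMetricAt (G : EuclideanSpace ℝ (Fin d) → Matrix (Fin d) (Fin d) ℝ)
    (y : EuclideanSpace ℝ (Fin d)) : Prop where
  contDiffAt : ∀ i j, ContDiffAt ℝ 2 (fun z => G z i j) y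
  isSymm : ∀ᶠ z in 𝓝 y, (G z).IsSymm
  det_pos : 0 < (G y).det

namespace IsRegularMetricAt

lemma eventually (h : IsRegularMetricAt G y) : ∀ᶠ z in 𝓝 y, IsRegularMetricAt G z := by
  have h1 : ∀ᶠ z in 𝓝 y, ∀ i j, ContDiffAt ℝ 2 (fun z => G z i j) z := by
    simp only [eventually_all]
    exact fun i j => (h.contDiffAt i j).eventually (by simp)
  have h3 : ∀ᶠ z in 𝓝 y, 0 < (G z).det :=
    (contDiffAt_det h.contDiffAt).continuousAt.eventually (lt_mem_nhds h.det_pos)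
  filter_upwards [h1, h.isSymm.eventually_nhds, h3] with z a b c using ⟨a, b, c⟩

lemma det_ne (h : IsRegularMetricAt G y) : (G y).det ≠ 0 := h.det_pos.ne'

lemma symm_self (h : IsRegularMetricAt G y) : (G y).IsSymm := h.isSymm.self_of_nhds

lemma inv_isSymm (h : IsRegularMetricAt G y) : ((G y)⁻¹).IsSymm := by
  rw [Matrix.IsSymm, Matrix.transpose_nonsing_inv, h.symm_self]

lemma inv_mul (h : IsRegularMetricAt G y) : (G y)⁻¹ * G y = 1 :=
  Matrix.nonsing_inv_mul _ (isUnit_iff_ne_zero.mpr h.det_ne)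

lemma mul_inv (h : IsRegularMetricAt G y) : G y * (G y)⁻¹ = 1 :=
  Matrix.mul_nonsing_inv _ (isUnit_iff_ne_zero.mpr h.det_ne)

lemma contDiffAt_inv (h : IsRegularMetricAt G y) (i j : Fin d) :
    ContDiffAt ℝ 2 (fun z => (G z)⁻¹ i j) y :=
  contDiffAt_inv_entry h.contDiffAt h.det_ne i j

lemma contDiffAt_sqrt_det (h : IsRegularMetricAt G y) :
    ContDiffAt ℝ 2 (fun z => √(G z).det) y :=
  (contDiffAt_det h.contDiffAt).sqrt h.det_ne

lemma pd_symm (h : IsRegularMetricAt G y) (k i j : Fin d) :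
    pd k (fun z => G z i j) y = pd k (fun z => G z j i) y :=
  pd_congr k (h.isSymm.mono fun _ hz => hz.apply j i)

lemma christoffel_symm (h : IsRegularMetricAt G y) (k i j : Fin d) :
    christoffel G k i j y = christoffel G k j i y := by
  simp only [christoffel]
  congr 1
  refine Finset.sum_congr rfl fun l _ => ?_
  rw [h.pd_symm l i j]; ring

lemma contDiffAt_christoffel (h : IsRegularMetricAt G y) (k i j : Fin d) :
    ContDiffAt ℝ 1 (christoffel G k i j) y := by
  have hp : ∀ a b c : Fin d, ContDiffAt ℝ 1 (pd a (fun z => G z b c)) y := fun a b c =>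
    contDiffAt_pd a (h.contDiffAt b c) (by norm_num)
  refine contDiffAt_const.mul (ContDiffAt.sum fun l _ => ?_)
  exact ((h.contDiffAt_inv k l).of_le (by norm_num)).mul (((hp _ _ _).add (hp _ _ _)).sub (hp _ _ _))

/-- The contraction `2 Γˡₗₖ = Gⁱʲ ∂ₖ Gᵢⱼ`. -/
lemma trace_pd (h : IsRegularMetricAt G y) (k : Fin d) :
    ∑ i, ∑ j, (G y)⁻¹ i j * pd k (fun z => G z i j) y = 2 * ∑ l, christoffel G l l k y := by
  have hs : ∀ i j, (G y)⁻¹ i j = (G y)⁻¹ j i := fun i j => h.inv_isSymm.apply j i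
  have e : ∑ i, ∑ j, (G y)⁻¹ i j * pd i (fun z => G z k j) y
      = ∑ i, ∑ j, (G y)⁻¹ i j * pd j (fun z => G z i k) y := by
    rw [Finset.sum_comm]
    exact Finset.sum_congr rfl fun i _ => Finset.sum_congr rfl fun j _ => by
      rw [hs j i, h.pd_symm j k i]
  simp only [christoffel, ← Finset.mul_sum, mul_add, mul_sub, Finset.sum_add_distrib,
    Finset.sum_sub_distrib]
  rw [e]; ring

/-- The derivative of the inverse matrix. -/
lemma pd_inv (h : IsRegularMetricAt G y) (k a b : Fin d) :
    pd k (fun z => (G z)⁻¹ a b) y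
      = - ∑ i, ∑ j, (G y)⁻¹ a i * pd k (fun z => G z i j) y * (G y)⁻¹ j b := by
  have hH : ∀ i j, DifferentiableAt ℝ (fun z => (G z)⁻¹ i j) y := fun i j =>
    (h.contDiffAt_inv i j).differentiableAt (by norm_num)
  have hGd : ∀ i j, DifferentiableAt ℝ (fun z => G z i j) y := fun i j =>
    (h.contDiffAt i j).differentiableAt (by norm_num)
  -- Differentiate `G⁻¹ G = 1`, which holds near `y`; the derivative of the inverse is then isolated
  -- by multiplying by `G⁻¹` on the right.
  have key : ∀ c, ∑ i, (pd k (fun z => (G z)⁻¹ a i) y * G y i c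
      + (G y)⁻¹ a i * pd k (fun z => G z i c) y) = 0 := by
    intro c
    have h1 : (fun z => ∑ i, (G z)⁻¹ a i * G z i c) =ᶠ[𝓝 y] fun _ => (1 : Matrix _ _ ℝ) a c := by
      filter_upwards [h.eventually] with z hz
      rw [← hz.inv_mul, Matrix.mul_apply]
    have h2 := pd_congr k h1
    rw [pd_const, pd_sum _ _ _ fun i _ => (hH a i).fun_mul (hGd i c)] at h2
    rw [← h2]
    exact Finset.sum_congr rfl fun i _ => (pd_mul k (hH a i) (hGd i c)).symm
  have e1 : ∑ c, (∑ i, (pd k (fun z => (G z)⁻¹ a i) y * G y i c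
      + (G y)⁻¹ a i * pd k (fun z => G z i c) y)) * (G y)⁻¹ c b = 0 := by simp [key]
  simp only [Finset.sum_add_distrib, add_mul] at e1
  have e2 : ∑ c, (∑ i, pd k (fun z => (G z)⁻¹ a i) y * G y i c) * (G y)⁻¹ c b
      = pd k (fun z => (G z)⁻¹ a b) y := by
    simp only [Finset.sum_mul]
    rw [Finset.sum_comm]
    have : ∀ i, ∑ c, pd k (fun z => (G z)⁻¹ a i) y * G y i c * (G y)⁻¹ c b
        = pd k (fun z => (G z)⁻¹ a i) y * (1 : Matrix _ _ ℝ) i b := fun i => by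
      rw [← h.mul_inv, Matrix.mul_apply, Finset.mul_sum]; simp only [mul_assoc]
    simp [this, Matrix.one_apply]
  have e3 : ∑ c, (∑ i, (G y)⁻¹ a i * pd k (fun z => G z i c) y) * (G y)⁻¹ c b
      = ∑ i, ∑ j, (G y)⁻¹ a i * pd k (fun z => G z i j) y * (G y)⁻¹ j b := by
    simp only [Finset.sum_mul]
    rw [Finset.sum_comm]
  rw [e2, e3] at e1
  linarith

/-- Jacobi's formula. -/
lemma pd_det (h : IsRegularMetricAt G y) (k : Fin d) :
    pd k (fun z => (G z).det) y
      = (G y).det * ∑ i, ∑ j, (G y)⁻¹ i j * pd k (fun z => G z i j) y := by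
  -- The determinant is multilinear in the rows, so its derivative is the sum of the determinants
  -- with one row differentiated. Expanding along that row produces cofactors, that is, entries of
  -- `det G • G⁻¹`.
  let D := (Matrix.detRowAlternating : (Fin d → ℝ) [⋀^Fin d]→ₗ[ℝ] ℝ).toMultilinearMap
  let D' : ContinuousMultilinearMap ℝ (fun _ : Fin d => Fin d → ℝ) ℝ :=
    ⟨D, by
      change Continuous fun A : Fin d → Fin d → ℝ => (Matrix.of A).det
      exact Continuous.matrix_det continuous_id⟩
  have hA : HasFDerivAt (fun z => (fun i j => G z i j : Fin d → Fin d → ℝ))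
      (ContinuousLinearMap.pi fun i => ContinuousLinearMap.pi fun j =>
        fderiv ℝ (fun z => G z i j) y) y :=
    hasFDerivAt_pi.mpr fun i => hasFDerivAt_pi.mpr fun j =>
      ((h.contDiffAt i j).differentiableAt (by norm_num)).hasFDerivAt
  have hD := (D'.hasFDerivAt (fun i j => G y i j)).comp y hA
  have hpd : pd k (fun z => (G z).det) y
      = ∑ i, (Matrix.updateRow (G y) i fun j => pd k (fun z => G z i j) y).det := by
    have : (fun z => (G z).det) = D' ∘ (fun z => (fun i j => G z i j : Fin d → Fin d → ℝ)) := rfl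
    rw [pd, this, hD.fderiv, ContinuousLinearMap.comp_apply,
      ContinuousMultilinearMap.linearDeriv_apply]
    rfl
  have hadj : ∀ i j, (G y).det * (G y)⁻¹ i j = (G y).adjugate i j := fun i j => by
    rw [Matrix.inv_def, Matrix.smul_apply, Ring.inverse_eq_inv', smul_eq_mul,
      mul_inv_cancel_left₀ h.det_ne]
  rw [hpd, Finset.mul_sum]
  refine Finset.sum_congr rfl fun i _ => ?_
  rw [Matrix.det_eq_sum_mul_adjugate_row _ i, Finset.mul_sum]
  refine Finset.sum_congr rfl fun j _ => ?_
  rw [← mul_assoc, h.inv_isSymm.apply j i, hadj, Matrix.updateRow_self, Matrix.adjugate_apply,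
    Matrix.updateRow_idem, Matrix.adjugate_apply, mul_comm]

/-- Jacobi's formula and the contraction `trace_pd`; the factor 2 there cancels the ½ of the square
root. -/
lemma pd_sqrt_det (h : IsRegularMetricAt G y) (k : Fin d) :
    pd k (fun z => √(G z).det) y = √(G y).det * ∑ l, christoffel G l l k y := by
  rw [pd_comp k (Real.hasDerivAt_sqrt h.det_ne)
    ((contDiffAt_det h.contDiffAt).differentiableAt (by norm_num)), h.pd_det, h.trace_pd]
  have h0 : √(G y).det ≠ 0 := (Real.sqrt_pos.mpr h.det_pos).ne'
  field_simp
  rw [Real.sq_sqrt h.det_pos.le]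

/-- The components of the gradient of `u` are of class `C¹` if `u` is of class `C²`. -/
lemma contDiffAt_grad (h : IsRegularMetricAt G y) {u : EuclideanSpace ℝ (Fin d) → ℝ}
    (hu : ContDiffAt ℝ 2 u y) (k : Fin d) :
    ContDiffAt ℝ 1 (fun z => ∑ j, (G z)⁻¹ k j * pd j u z) y :=
  ContDiffAt.sum fun j _ => ((h.contDiffAt_inv k j).of_le (by norm_num)).mul
    (contDiffAt_pd j hu (by norm_num))

lemma laplacian_eq (h : IsRegularMetricAt G y) {u : EuclideanSpace ℝ (Fin d) → ℝ}
    (hu : ContDiffAt ℝ 2 u y) :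
    laplacian G u y = ∑ k, (pd k (fun z => ∑ j, (G z)⁻¹ k j * pd j u z) y
      + (∑ l, christoffel G l l k y) * ∑ j, (G y)⁻¹ k j * pd j u y) := by
  have h0 : √(G y).det ≠ 0 := (Real.sqrt_pos.mpr h.det_pos).ne'
  rw [laplacian, Finset.mul_sum]
  refine Finset.sum_congr rfl fun k _ => ?_
  rw [pd_mul k (h.contDiffAt_sqrt_det.differentiableAt (by norm_num))
    ((h.contDiffAt_grad hu k).differentiableAt (by norm_num)), h.pd_sqrt_det]
  field_simp
  ring

/-- Expanding the divergence form differentiates `G⁻¹`, and those terms combine with `Γˡₗₖ` into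
`-Gⁱʲ Γᵏᵢⱼ`. Tracing the conformal Ricci tensor produces the Laplacian in this form as well as in
divergence form, so both are needed. -/
lemma laplacian_eq_trace (h : IsRegularMetricAt G y) {u : EuclideanSpace ℝ (Fin d) → ℝ}
    (hu : ContDiffAt ℝ 2 u y) :
    laplacian G u y = ∑ i, ∑ j, (G y)⁻¹ i j * pd i (pd j u) y
      - ∑ k, (∑ i, ∑ j, (G y)⁻¹ i j * christoffel G k i j y) * pd k u y := by
  rw [h.laplacian_eq hu]
  have hs : ∀ i j, (G y)⁻¹ i j = (G y)⁻¹ j i := fun i j => h.inv_isSymm.apply j i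
  have e1 : ∀ k, pd k (fun z => ∑ j, (G z)⁻¹ k j * pd j u z) y
      = ∑ j, (G y)⁻¹ k j * pd k (pd j u) y
        - ∑ j, (∑ a, ∑ b, (G y)⁻¹ k a * pd k (fun z => G z a b) y * (G y)⁻¹ b j) * pd j u y := by
    intro k
    rw [pd_sum _ _ _ fun j _ => ((h.contDiffAt_inv k j).differentiableAt (by norm_num)).fun_mul
      ((contDiffAt_pd j hu (k := 1) (by norm_num)).differentiableAt (by norm_num)),
      ← Finset.sum_sub_distrib]
    refine Finset.sum_congr rfl fun j _ => ?_
    rw [pd_mul k ((h.contDiffAt_inv k j).differentiableAt (by norm_num))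
      ((contDiffAt_pd j hu (k := 1) (by norm_num)).differentiableAt (by norm_num)), h.pd_inv]
    ring
  -- The first two terms of the Christoffel symbol agree after contraction with the symmetric `G⁻¹`;
  -- the third is a trace, given by `trace_pd`.
  have e2 : ∀ m, ∑ i, ∑ j, (G y)⁻¹ i j * christoffel G m i j y
      = (∑ k, ∑ a, ∑ b, (G y)⁻¹ k a * pd k (fun z => G z a b) y * (G y)⁻¹ b m)
        - ∑ k, (∑ l, christoffel G l l k y) * (G y)⁻¹ k m := by
    intro m
    have c1 : ∀ l, ∑ i, ∑ j, (G y)⁻¹ i j * (pd i (fun z => G z j l) y + pd j (fun z => G z i l) y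
        - pd l (fun z => G z i j) y)
        = 2 * (∑ i, ∑ j, (G y)⁻¹ i j * pd i (fun z => G z j l) y)
          - 2 * ∑ a, christoffel G a a l y := by
      intro l
      rw [← h.trace_pd]
      have : ∑ i, ∑ j, (G y)⁻¹ i j * pd j (fun z => G z i l) y
          = ∑ i, ∑ j, (G y)⁻¹ i j * pd i (fun z => G z j l) y := by
        rw [Finset.sum_comm]
        exact Finset.sum_congr rfl fun i _ => Finset.sum_congr rfl fun j _ => by rw [hs j i]
      simp only [mul_add, mul_sub, Finset.sum_add_distrib, Finset.sum_sub_distrib, this]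
      ring
    calc ∑ i, ∑ j, (G y)⁻¹ i j * christoffel G m i j y
        = ∑ l, (1 / 2) * (G y)⁻¹ m l * ∑ i, ∑ j, (G y)⁻¹ i j * (pd i (fun z => G z j l) y
          + pd j (fun z => G z i l) y - pd l (fun z => G z i j) y) := by
          simp only [christoffel, Finset.mul_sum]
          rw [Finset.sum_comm' (t' := Finset.univ) (s' := fun _ => Finset.univ) (by simp)]
          rw [Finset.sum_comm]
          conv_rhs => rw [Finset.sum_comm]
          refine Finset.sum_congr rfl fun i _ => ?_
          rw [Finset.sum_comm]
          exact Finset.sum_congr rfl fun k _ => Finset.sum_congr rfl fun j _ => by ring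
      _ = ∑ l, ((∑ i, ∑ j, (G y)⁻¹ i j * pd i (fun z => G z j l) y * (G y)⁻¹ l m)
          - (∑ a, christoffel G a a l y) * (G y)⁻¹ l m) := by
          refine Finset.sum_congr rfl fun l _ => ?_
          rw [c1, hs m l]
          simp only [← Finset.sum_mul]
          ring
      _ = _ := by
          rw [Finset.sum_sub_distrib, Finset.sum_comm]
          congr 1
          exact Finset.sum_congr rfl fun i _ => Finset.sum_comm
  simp only [e1, e2, sub_mul, Finset.sum_sub_distrib, Finset.sum_add_distrib]
  have e3 : ∑ k, ∑ j, (∑ a, ∑ b, (G y)⁻¹ k a * pd k (fun z => G z a b) y * (G y)⁻¹ b j) * pd j u y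
      = ∑ j, (∑ k, ∑ a, ∑ b, (G y)⁻¹ k a * pd k (fun z => G z a b) y * (G y)⁻¹ b j) * pd j u y := by
    rw [Finset.sum_comm]; simp only [Finset.sum_mul]
  have e4 : ∑ k, (∑ l, christoffel G l l k y) * ∑ j, (G y)⁻¹ k j * pd j u y
      = ∑ j, (∑ k, (∑ l, christoffel G l l k y) * (G y)⁻¹ k j) * pd j u y := by
    simp only [Finset.sum_mul (s := Finset.univ) (f := fun k => _ * _), Finset.mul_sum]
    rw [Finset.sum_comm]
    exact Finset.sum_congr rfl fun i _ => Finset.sum_congr rfl fun j _ => by ring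
  rw [e3, e4]; ring

end IsRegularMetricAt

end CoordinateMetric

/-! ### The scalar curvature of a conformal metric -/

section ConformalScalar

variable {d : ℕ} {G : EuclideanSpace ℝ (Fin d) → Matrix (Fin d) (Fin d) ℝ}
  {y : EuclideanSpace ℝ (Fin d)} {w : EuclideanSpace ℝ (Fin d) → ℝ}

/-- Differentiating `e^{2w} G` gives `e^{2w}(2 ∂w G + ∂G)`. The exponential cancels against the
inverse metric, and the three `∂w` terms are the difference tensor. -/
lemma christoffel_conformal (h : IsRegularMetricAt G y) (hw : DifferentiableAt ℝ w y)
    (k i j : Fin d) :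
    christoffel (fun z => Real.exp (2 * w z) • G z) k i j y = christoffel G k i j y
      + conformalDiff (G y) (fun a => pd a w y) (fun a => ∑ b, (G y)⁻¹ a b * pd b w y) k i j := by
  have hGd : ∀ i j, DifferentiableAt ℝ (fun z => G z i j) y := fun i j =>
    (h.contDiffAt i j).differentiableAt (by norm_num)
  have he : ∀ m, pd m (fun z => Real.exp (2 * w z)) y = 2 * pd m w y * Real.exp (2 * w y) := by
    intro m
    rw [pd_comp m (F := Real.exp) (Real.hasDerivAt_exp _) (hw.const_mul 2), pd_const_mul m 2 hw]
    ring
  have hed : DifferentiableAt ℝ (fun z => Real.exp (2 * w z)) y := (hw.const_mul 2).exp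
  have hp : ∀ m a b, pd m (fun z => (Real.exp (2 * w z) • G z) a b) y
      = Real.exp (2 * w y) * (2 * pd m w y * G y a b + pd m (fun z => G z a b) y) := by
    intro m a b
    simp only [Matrix.smul_apply, smul_eq_mul]
    rw [pd_mul m hed (hGd a b), he]; ring
  have hinv : (Real.exp (2 * w y) • G y)⁻¹ = (Real.exp (2 * w y))⁻¹ • (G y)⁻¹ := by
    have := Matrix.inv_smul' (A := G y) (Units.mk0 _ (Real.exp_ne_zero (2 * w y)))
      (isUnit_iff_ne_zero.mpr h.det_ne)
    simpa [Units.smul_def] using this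
  have e1 : ∀ a, ∑ l, (G y)⁻¹ k l * G y a l = if k = a then 1 else 0 := fun a => by
    have := congrFun (congrFun h.inv_mul k) a
    rw [Matrix.mul_apply, Matrix.one_apply] at this
    rw [← this]
    exact Finset.sum_congr rfl fun l _ => by rw [h.symm_self.apply a l]
  simp only [christoffel, hp]
  simp only [hinv, Matrix.smul_apply, smul_eq_mul, conformalDiff]
  have e2 : ∀ l, (Real.exp (2 * w y))⁻¹ * (G y)⁻¹ k l *
      (Real.exp (2 * w y) * (2 * pd i w y * G y j l + pd i (fun z => G z j l) y)
        + Real.exp (2 * w y) * (2 * pd j w y * G y i l + pd j (fun z => G z i l) y)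
        - Real.exp (2 * w y) * (2 * pd l w y * G y i j + pd l (fun z => G z i j) y))
      = (G y)⁻¹ k l * (pd i (fun z => G z j l) y + pd j (fun z => G z i l) y
          - pd l (fun z => G z i j) y)
        + (2 * pd i w y * ((G y)⁻¹ k l * G y j l) + 2 * pd j w y * ((G y)⁻¹ k l * G y i l)
          - 2 * G y i j * ((G y)⁻¹ k l * pd l w y)) := by
    intro l
    have := Real.exp_ne_zero (2 * w y)
    field_simp
    ring
  simp only [e2, Finset.sum_add_distrib, Finset.sum_sub_distrib, ← Finset.mul_sum, e1]
  split_ifs <;> ring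

/-- The scalar curvature of the conformal metric `e^{2w} G`. -/
theorem scalar_conformal (h : IsRegularMetricAt G y) (hw : ContDiffAt ℝ 2 w y) :
    scalar (fun z => Real.exp (2 * w z) • G z) y
      = (Real.exp (2 * w y))⁻¹ * (scalar G y - 2 * (d - 1) * laplacian G w y
        - (d - 1) * (d - 2) * ∑ i, ∑ j, (G y)⁻¹ i j * pd i w y * pd j w y) := by
  set Gt := fun z => Real.exp (2 * w z) • G z with hGt
  let wd : Fin d → EuclideanSpace ℝ (Fin d) → ℝ := fun a z => pd a w z
  let wu : Fin d → EuclideanSpace ℝ (Fin d) → ℝ := fun a z => ∑ b, (G z)⁻¹ a b * pd b w z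
  have hwe : ∀ᶠ z in 𝓝 y, ContDiffAt ℝ 2 w z := hw.eventually (by simp)
  have hΓ : ∀ k i j, christoffel Gt k i j =ᶠ[𝓝 y] fun z => christoffel G k i j z
      + conformalDiff (G z) (fun a => wd a z) (fun a => wu a z) k i j := by
    intro k i j
    filter_upwards [h.eventually, hwe] with z hz hwz
    exact christoffel_conformal hz (hwz.differentiableAt (by norm_num)) k i j
  have hGd : ∀ i j, DifferentiableAt ℝ (fun z => G z i j) y := fun i j =>
    (h.contDiffAt i j).differentiableAt (by norm_num)
  have hwd : ∀ a, DifferentiableAt ℝ (wd a) y := fun a =>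
    (contDiffAt_pd a hw (k := 1) (by norm_num)).differentiableAt (by norm_num)
  have hwu : ∀ a, DifferentiableAt ℝ (wu a) y := fun a =>
    (h.contDiffAt_grad hw a).differentiableAt (by norm_num)
  have hΓd : ∀ k i j, DifferentiableAt ℝ (christoffel G k i j) y := fun k i j =>
    (h.contDiffAt_christoffel k i j).differentiableAt (by norm_num)
  have hite : ∀ (p : Prop) [Decidable p] (a : Fin d),
      DifferentiableAt ℝ (fun z => if p then wd a z else 0) y := by
    intro p _ a; split_ifs
    · exact hwd a
    · exact differentiableAt_const _
  have hite' : ∀ (p : Prop) [Decidable p] (m a : Fin d),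
      pd m (fun z => if p then wd a z else 0) y = if p then pd m (pd a w) y else 0 := by
    intro p _ m a; split_ifs
    · rfl
    · exact pd_const m 0
  have hAd : ∀ k i j, DifferentiableAt ℝ (fun z =>
      conformalDiff (G z) (fun a => wd a z) (fun a => wu a z) k i j) y := fun k i j =>
    ((hite (k = i) j).fun_add (hite (k = j) i)).fun_sub ((hGd i j).fun_mul (hwu k))
  have hpA : ∀ m k i j, pd m (fun z =>
      conformalDiff (G z) (fun a => wd a z) (fun a => wu a z) k i j) y
      = (if k = i then pd m (pd j w) y else 0) + (if k = j then pd m (pd i w) y else 0)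
        - (pd m (fun z => G z i j) y * wu k y + G y i j * pd m (wu k) y) := by
    intro m k i j
    simp only [conformalDiff]
    rw [pd_sub m ((hite (k = i) j).fun_add (hite (k = j) i)) ((hGd i j).fun_mul (hwu k)),
      pd_add m (hite (k = i) j) (hite (k = j) i), pd_mul m (hGd i j) (hwu k), hite', hite']
  have hpΓ : ∀ m k i j, pd m (christoffel Gt k i j) y = pd m (christoffel G k i j) y
      + pd m (fun z => conformalDiff (G z) (fun a => wd a z) (fun a => wu a z) k i j) y := by
    intro m k i j
    rw [pd_congr m (hΓ k i j), pd_add m (hΓd k i j) (hAd k i j)]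
  -- The contracted identity `Aᵏₖⱼ = d wⱼ` holds near `y`, so it may be differentiated as a whole.
  have hdiag : ∀ i j, ∑ k, pd i (fun z =>
      conformalDiff (G z) (fun a => wd a z) (fun a => wu a z) k k j) y = d * pd i (pd j w) y := by
    intro i j
    rw [← pd_sum _ _ _ fun k _ => hAd k k j, ← pd_const_mul i (d : ℝ) (hwd j)]
    refine pd_congr i ?_
    filter_upwards [h.eventually] with z hz
    refine sum_conformalDiff_diag _ _ _ hz.symm_self (fun a => ?_) j
    have : (wu · z) = (G z)⁻¹.mulVec (wd · z) := rfl
    change (G z).mulVec (wu · z) a = _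
    rw [this, Matrix.mulVec_mulVec, hz.mul_inv, Matrix.one_mulVec]
  have hinv : (Gt y)⁻¹ = (Real.exp (2 * w y))⁻¹ • (G y)⁻¹ := by
    have := Matrix.inv_smul' (A := G y) (Units.mk0 _ (Real.exp_ne_zero (2 * w y)))
      (isUnit_iff_ne_zero.mpr h.det_ne)
    simpa [Units.smul_def, hGt] using this
  have key := trace_ricci_conformal (G y) (G y)⁻¹ (wd · y) (wu · y)
    (fun k i j => christoffel G k i j y) h.christoffel_symm
    (fun k i j => pd k (fun z => G z i j) y) (fun i j => pd i (pd j w) y)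
    (fun m k => pd m (wu k) y) h.symm_self h.inv_isSymm h.inv_mul (fun _ => rfl) h.trace_pd
  have hric : ∀ i j, ricci Gt i j y = ricci G i j y
      + ((∑ k, ((if k = i then pd k (pd j w) y else 0) + (if k = j then pd k (pd i w) y else 0)
          - (pd k (fun z => G z i j) y * wu k y + G y i j * pd k (wu k) y)))
        - d * pd i (pd j w) y
        + ((∑ k, ∑ l, (christoffel G k k l y + conformalDiff (G y) (wd · y) (wu · y) k k l)
              * (christoffel G l i j y + conformalDiff (G y) (wd · y) (wu · y) l i j))
          - ∑ k, ∑ l, christoffel G k k l y * christoffel G l i j y)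
        - ((∑ k, ∑ l, (christoffel G k i l y + conformalDiff (G y) (wd · y) (wu · y) k i l)
              * (christoffel G l k j y + conformalDiff (G y) (wd · y) (wu · y) l k j))
          - ∑ k, ∑ l, christoffel G k i l y * christoffel G l k j y)) := by
    intro i j
    have hΓ0 : ∀ k i j, christoffel Gt k i j y = christoffel G k i j y
        + conformalDiff (G y) (wd · y) (wu · y) k i j := fun k i j => (hΓ k i j).self_of_nhds
    have e1 : ∑ k, pd k (christoffel Gt k i j) y = ∑ k, pd k (christoffel G k i j) y
        + ∑ k, ((if k = i then pd k (pd j w) y else 0) + (if k = j then pd k (pd i w) y else 0)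
          - (pd k (fun z => G z i j) y * wu k y + G y i j * pd k (wu k) y)) := by
      simp only [hpΓ, Finset.sum_add_distrib, hpA]
    have e2 : ∑ k, pd i (christoffel Gt k k j) y = ∑ k, pd i (christoffel G k k j) y
        + d * pd i (pd j w) y := by
      simp only [hpΓ, Finset.sum_add_distrib, hdiag]
    simp only [ricci, hΓ0, e1, e2]
    ring
  have hq : ∑ i, ∑ j, (G y)⁻¹ i j * pd i w y * pd j w y = ∑ k, wu k y * wd k y := by
    refine Finset.sum_congr rfl fun i _ => ?_
    rw [Finset.sum_mul]
    exact Finset.sum_congr rfl fun j _ => by simp only [wd]; ring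
  have l1 := h.laplacian_eq hw
  have l2 := h.laplacian_eq_trace hw
  simp only [scalar, hinv, Matrix.smul_apply, smul_eq_mul, hric, hq]
  have e3 : ∀ X : Fin d → Fin d → ℝ, ∑ i, ∑ j, (Real.exp (2 * w y))⁻¹ * (G y)⁻¹ i j
      * (ricci G i j y + X i j) = (Real.exp (2 * w y))⁻¹ *
        (∑ i, ∑ j, (G y)⁻¹ i j * ricci G i j y + ∑ i, ∑ j, (G y)⁻¹ i j * X i j) := by
    intro X
    simp only [mul_add, Finset.sum_add_distrib, Finset.mul_sum, mul_assoc]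
  rw [e3]
  congr 1
  rw [key]
  rw [← l2]
  -- The two second-order groups in `key` are `Δw`, one in trace form and one in divergence form:
  -- the coefficients `2 - d` and `-d` add up to `-2(d - 1)`.
  change _ + ((2 - (d : ℝ)) * laplacian G w y - d * ∑ k, (pd k (fun z => ∑ j, (G z)⁻¹ k j
    * pd j w z) y + (∑ l, christoffel G l l k y) * ∑ j, (G y)⁻¹ k j * pd j w y) + _) = _
  rw [← l1]
  ring

/-- The Laplacian of `exp (a w)`. -/
lemma laplacian_exp (h : IsRegularMetricAt G y) (hw : ContDiffAt ℝ 2 w y) (a : ℝ) :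
    laplacian G (fun z => Real.exp (a * w z)) y = a * Real.exp (a * w y)
      * (laplacian G w y + a * ∑ i, ∑ j, (G y)⁻¹ i j * pd i w y * pd j w y) := by
  have hwe : ∀ᶠ z in 𝓝 y, ContDiffAt ℝ 2 w z := hw.eventually (by simp)
  have hp : ∀ z, ContDiffAt ℝ 2 w z → ∀ j,
      pd j (fun z => Real.exp (a * w z)) z = a * Real.exp (a * w z) * pd j w z := by
    intro z hz j
    have := hz.differentiableAt (by norm_num)
    rw [pd_comp j (F := Real.exp) (Real.hasDerivAt_exp _) (this.const_mul a),
      pd_const_mul j a this]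
    ring
  have hY : ∀ i, DifferentiableAt ℝ (fun z => √(G z).det * ∑ j, (G z)⁻¹ i j * pd j w z) y :=
    fun i => (h.contDiffAt_sqrt_det.differentiableAt (by norm_num)).fun_mul
      ((h.contDiffAt_grad hw i).differentiableAt (by norm_num))
  have hwy : DifferentiableAt ℝ w y := hw.differentiableAt (by norm_num)
  have hed : DifferentiableAt ℝ (fun z => a * Real.exp (a * w z)) y :=
    ((hwy.const_mul a).exp).const_mul a
  have hi : ∀ i, pd i (fun z => √(G z).det * ∑ j, (G z)⁻¹ i j
        * pd j (fun z => Real.exp (a * w z)) z) y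
      = a * Real.exp (a * w y) * (a * pd i w y * (√(G y).det * ∑ j, (G y)⁻¹ i j * pd j w y)
        + pd i (fun z => √(G z).det * ∑ j, (G z)⁻¹ i j * pd j w z) y) := by
    intro i
    have : (fun z => √(G z).det * ∑ j, (G z)⁻¹ i j * pd j (fun z => Real.exp (a * w z)) z)
        =ᶠ[𝓝 y] fun z => (a * Real.exp (a * w z))
          * (√(G z).det * ∑ j, (G z)⁻¹ i j * pd j w z) := by
      filter_upwards [hwe] with z hz
      simp only [hp z hz, Finset.mul_sum]
      exact Finset.sum_congr rfl fun j _ => by ring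
    rw [pd_congr i this, pd_mul i hed (hY i), pd_const_mul i a ((hwy.const_mul a).exp),
      hp y hw i]
    ring
  have h0 : √(G y).det ≠ 0 := (Real.sqrt_pos.mpr h.det_pos).ne'
  simp only [laplacian, hi, ← Finset.mul_sum, Finset.sum_add_distrib]
  have hq : ∑ i, a * pd i w y * (√(G y).det * ∑ j, (G y)⁻¹ i j * pd j w y)
      = √(G y).det * (a * ∑ i, ∑ j, (G y)⁻¹ i j * pd i w y * pd j w y) := by
    simp only [Finset.mul_sum]
    exact Finset.sum_congr rfl fun i _ => Finset.sum_congr rfl fun j _ => by ring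
  rw [hq]
  field_simp
  ring

end ConformalScalar

/-! ### Pull-backs of metrics -/

section Pullback

attribute [local instance] chartedSpaceSelf

variable {d k m : ℕ} {X : Type*} [TopologicalSpace X] [ChartedSpace (EuclideanSpace ℝ (Fin d)) X]

variable (d) in
/-- The derivative of `ψ : ℝᵏ → X`, with the tangent spaces of `X` identified with `ℝᵈ`. -/
def paramDeriv (ψ : EuclideanSpace ℝ (Fin k) → X) (y : EuclideanSpace ℝ (Fin k)) :
    EuclideanSpace ℝ (Fin k) →L[ℝ] EuclideanSpace ℝ (Fin d) :=
  mfderiv (𝓡 k) (𝓡 d) ψ y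

variable (d) in
/-- The matrix of the derivative of `ψ : ℝᵏ → X` in the standard bases. -/
def jacobian (ψ : EuclideanSpace ℝ (Fin k) → X) (y : EuclideanSpace ℝ (Fin k)) :
    Matrix (Fin d) (Fin k) ℝ :=
  Matrix.of fun a i => paramDeriv d ψ y (EuclideanSpace.single i (1 : ℝ)) a

/-- The matrix of the derivative of `φ : ℝᵏ → ℝᵐ` in the standard bases. -/
def coordJacobian (φ : EuclideanSpace ℝ (Fin k) → EuclideanSpace ℝ (Fin m))
    (y : EuclideanSpace ℝ (Fin k)) : Matrix (Fin m) (Fin k) ℝ :=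
  Matrix.of fun a i => fderiv ℝ φ y (EuclideanSpace.single i (1 : ℝ)) a

lemma euclidean_eq_sum_single (v : EuclideanSpace ℝ (Fin k)) :
    v = ∑ i, v i • (EuclideanSpace.single i (1 : ℝ) : EuclideanSpace ℝ (Fin k)) := by
  have := (EuclideanSpace.basisFun (Fin k) ℝ).sum_repr v
  simpa using this.symm

lemma bilin_eq_sum (B : EuclideanSpace ℝ (Fin d) →L[ℝ] EuclideanSpace ℝ (Fin d) →L[ℝ] ℝ)
    (v w : EuclideanSpace ℝ (Fin d)) :
    B v w = ∑ a, ∑ b, v a * w b *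
      B (EuclideanSpace.single a (1 : ℝ)) (EuclideanSpace.single b (1 : ℝ)) := by
  conv_lhs => rw [euclidean_eq_sum_single v, euclidean_eq_sum_single w]
  simp only [map_sum, map_smul, sum_apply, smul_apply,
    smul_eq_mul, Finset.mul_sum, mul_assoc]
  rw [Finset.sum_comm]
  exact Finset.sum_congr rfl fun a _ => Finset.sum_congr rfl fun b _ => by ring

/-- Everything about pull-backs is reduced to matrices: under reparametrization the Gram matrix
changes by a congruence, so its determinant changes by a squared Jacobian. -/
lemma pullbackGram_eq_jacobian (g : MetricField d X) (ψ : EuclideanSpace ℝ (Fin k) → X)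
    (y : EuclideanSpace ℝ (Fin k)) :
    pullbackGram g ψ y = (jacobian d ψ y).transpose * gramAt g (ψ y) * jacobian d ψ y := by
  ext i j
  have := bilin_eq_sum (g (ψ y)) (mfderiv (𝓡 k) (𝓡 d) ψ y (EuclideanSpace.single i (1 : ℝ)))
    (mfderiv (𝓡 k) (𝓡 d) ψ y (EuclideanSpace.single j (1 : ℝ)))
  refine this.trans ?_
  simp only [Matrix.mul_apply, Matrix.transpose_apply, Finset.sum_mul]
  rw [Finset.sum_comm]
  exact Finset.sum_congr rfl fun a _ => Finset.sum_congr rfl fun b _ => by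
    exact mul_right_comm _ _ _

lemma jacobian_mulVec (ψ : EuclideanSpace ℝ (Fin k) → X) (y v : EuclideanSpace ℝ (Fin k))
    (a : Fin d) :
    (jacobian d ψ y).mulVec v a = paramDeriv d ψ y v a := by
  conv_rhs => rw [euclidean_eq_sum_single v]
  simp [Matrix.mulVec, dotProduct, jacobian, mul_comm]

lemma det_coordJacobian (φ : EuclideanSpace ℝ (Fin k) → EuclideanSpace ℝ (Fin k))
    (y : EuclideanSpace ℝ (Fin k)) : (coordJacobian φ y).det = (fderiv ℝ φ y).det := by
  rw [ContinuousLinearMap.det, ← LinearMap.det_toMatrix (EuclideanSpace.basisFun (Fin k) ℝ).toBasis]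
  congr 1

lemma jacobian_comp {ψ : EuclideanSpace ℝ (Fin m) → X}
    {φ : EuclideanSpace ℝ (Fin k) → EuclideanSpace ℝ (Fin m)} {y : EuclideanSpace ℝ (Fin k)}
    (hψ : MDifferentiableAt (𝓡 m) (𝓡 d) ψ (φ y)) (hφ : DifferentiableAt ℝ φ y) :
    jacobian d (ψ ∘ φ) y = jacobian d ψ (φ y) * coordJacobian φ y := by
  ext a i
  have h1 := mfderiv_comp y hψ hφ.mdifferentiableAt
  have h2 : (jacobian d (ψ ∘ φ) y) a i = paramDeriv d ψ (φ y)
      (fderiv ℝ φ y (EuclideanSpace.single i (1 : ℝ))) a := by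
    simp only [jacobian, Matrix.of_apply, paramDeriv]
    rw [h1, mfderiv_eq_fderiv]
    rfl
  rw [h2, ← jacobian_mulVec]
  rfl

lemma pullbackGram_comp (g : MetricField d X) {ψ : EuclideanSpace ℝ (Fin m) → X}
    {φ : EuclideanSpace ℝ (Fin k) → EuclideanSpace ℝ (Fin m)} {y : EuclideanSpace ℝ (Fin k)}
    (hψ : MDifferentiableAt (𝓡 m) (𝓡 d) ψ (φ y)) (hφ : DifferentiableAt ℝ φ y) :
    pullbackGram g (ψ ∘ φ) y
      = (coordJacobian φ y).transpose * pullbackGram g ψ (φ y) * coordJacobian φ y := by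
  rw [pullbackGram_eq_jacobian, pullbackGram_eq_jacobian, jacobian_comp hψ hφ,
    Matrix.transpose_mul]
  simp only [Matrix.mul_assoc, Function.comp_apply]

lemma pullbackGram_congr (g : MetricField d X) {ψ ψ' : EuclideanSpace ℝ (Fin k) → X}
    {y : EuclideanSpace ℝ (Fin k)} (h : ψ =ᶠ[𝓝 y] ψ') :
    pullbackGram g ψ y = pullbackGram g ψ' y := by
  have h1 : jacobian d ψ y = jacobian d ψ' y := by
    ext a i
    simp only [jacobian, Matrix.of_apply, paramDeriv]
    rw [h.mfderiv_eq]
  rw [pullbackGram_eq_jacobian, pullbackGram_eq_jacobian, h1, h.self_of_nhds]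

/-- `g` is symmetric and positive definite at every point. -/
structure IsPosDefField (g : MetricField d X) : Prop where
  symm : ∀ (x : X) (v w : TangentSpace (𝓡 d) x), g x v w = g x w v
  pos : ∀ (x : X) (v : TangentSpace (𝓡 d) x), v ≠ 0 → 0 < g x v v

lemma IsPosDefField.conformal {g : MetricField d X} (hg : IsPosDefField g) {u : X → ℝ}
    (hu : ∀ x, u x ≠ 0) : IsPosDefField (conformal u g) where
  symm x v w := congrArg (u x ^ 2 * ·) (hg.symm x v w)
  pos x v hv := mul_pos (by have := hu x; positivity) (hg.pos x v hv)

lemma IsPosDefField.posDef_pullbackGram {g : MetricField d X} (hg : IsPosDefField g)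
    {ψ : EuclideanSpace ℝ (Fin k) → X} {y : EuclideanSpace ℝ (Fin k)}
    (hψ : Function.Injective (mfderiv (𝓡 k) (𝓡 d) ψ y)) : (pullbackGram g ψ y).PosDef := by
  refine Matrix.PosDef.of_dotProduct_mulVec_pos ?_ fun x hx => ?_
  · ext i j
    exact hg.symm _ _ _
  · let L : EuclideanSpace ℝ (Fin k) →L[ℝ] EuclideanSpace ℝ (Fin d) := mfderiv (𝓡 k) (𝓡 d) ψ y
    let v : EuclideanSpace ℝ (Fin k) := WithLp.toLp 2 x
    have hv : v ≠ 0 := fun h => hx (by simpa [v] using h)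
    have hL : L v ≠ 0 := fun h => hv (hψ (h.trans (map_zero L).symm))
    refine (hg.pos (ψ y) (L v) hL).trans_eq ?_
    let B : EuclideanSpace ℝ (Fin d) →L[ℝ] EuclideanSpace ℝ (Fin d) →L[ℝ] ℝ := g (ψ y)
    change ((B.comp L).flip.comp L) v v = _
    rw [bilin_eq_sum]
    simp only [dotProduct, Matrix.mulVec, Finset.mul_sum]
    refine Finset.sum_congr rfl fun a _ => Finset.sum_congr rfl fun b _ => ?_
    have : ((B.comp L).flip.comp L) (EuclideanSpace.single a 1) (EuclideanSpace.single b 1)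
      = pullbackGram g ψ y a b := hg.symm _ _ _
    rw [this]
    simp [v]; ring

lemma IsPosDefField.gramAt_posDef {g : MetricField d X} (hg : IsPosDefField g) (x : X) :
    (gramAt g x).PosDef := by
  refine Matrix.PosDef.of_dotProduct_mulVec_pos ?_ fun u hu => ?_
  · ext i j
    exact hg.symm _ _ _
  · let v : EuclideanSpace ℝ (Fin d) := WithLp.toLp 2 u
    have hv : v ≠ 0 := fun h => hu (by simpa [v] using h)
    refine (hg.pos x v hv).trans_eq ?_
    let B : EuclideanSpace ℝ (Fin d) →L[ℝ] EuclideanSpace ℝ (Fin d) →L[ℝ] ℝ := g x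
    change B v v = _
    rw [bilin_eq_sum]
    simp only [dotProduct, Matrix.mulVec, Finset.mul_sum]
    refine Finset.sum_congr rfl fun a _ => Finset.sum_congr rfl fun b _ => ?_
    change u a * u b * gramAt g x a b = u a * (gramAt g x a b * u b)
    ring

/-! ### Gradients -/

/-- The inner product `⟨∇ u, ∇ v⟩ = gⁱʲ du(eᵢ) dv(eⱼ)` of two gradients. -/
def gradInner (g : MetricField d X) (u v : X → ℝ) (x : X) : ℝ :=
  ∑ i, ∑ j, (gramAt g x)⁻¹ i j * partialAt u x i * partialAt v x j

lemma gradSq_eq_gradInner (g : MetricField d X) (u : X → ℝ) : gradSq g u = gradInner g u u := rfl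

lemma sum_eq_dotProduct (M : Matrix (Fin d) (Fin d) ℝ) (p q : Fin d → ℝ) :
    ∑ i, ∑ j, M i j * p i * q j = p ⬝ᵥ M.mulVec q := by
  simp only [dotProduct, Matrix.mulVec, Finset.mul_sum]
  exact Finset.sum_congr rfl fun i _ => Finset.sum_congr rfl fun j _ => by ring

lemma pd_comp_eq {ψ : EuclideanSpace ℝ (Fin k) → X} {y : EuclideanSpace ℝ (Fin k)} {u : X → ℝ}
    (hψ : MDifferentiableAt (𝓡 k) (𝓡 d) ψ y) (hu : MDifferentiableAt (𝓡 d) 𝓘(ℝ, ℝ) u (ψ y))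
    (i : Fin k) :
    pd i (u ∘ ψ) y = (jacobian d ψ y).transpose.mulVec (partialAt u (ψ y)) i := by
  have h1 : pd i (u ∘ ψ) y = (mfderiv (𝓡 d) 𝓘(ℝ, ℝ) u (ψ y))
      (mfderiv (𝓡 k) (𝓡 d) ψ y (EuclideanSpace.single i (1 : ℝ))) := by
    rw [pd, ← mfderiv_eq_fderiv, mfderiv_comp y hu hψ]
    rfl
  let p : EuclideanSpace ℝ (Fin d) →L[ℝ] ℝ := mfderiv (𝓡 d) 𝓘(ℝ, ℝ) u (ψ y)
  let v : EuclideanSpace ℝ (Fin d) := mfderiv (𝓡 k) (𝓡 d) ψ y (EuclideanSpace.single i (1 : ℝ))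
  rw [h1]
  change p v = _
  rw [euclidean_eq_sum_single v]
  simp only [map_sum, map_smul, smul_eq_mul, Matrix.mulVec, dotProduct, Matrix.transpose_apply]
  rfl

lemma isUnit_jacobian {ψ : EuclideanSpace ℝ (Fin d) → X} {y : EuclideanSpace ℝ (Fin d)}
    (hψ : Function.Injective (mfderiv (𝓡 d) (𝓡 d) ψ y)) : IsUnit (jacobian d ψ y) := by
  rw [← Matrix.mulVec_injective_iff_isUnit]
  intro u v huv
  have : WithLp.toLp 2 u = (WithLp.toLp 2 v : EuclideanSpace ℝ (Fin d)) := by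
    apply hψ
    refine PiLp.ext fun a => ?_
    exact (jacobian_mulVec ψ y (WithLp.toLp 2 u) a).symm.trans
      ((congrFun huv a).trans (jacobian_mulVec ψ y (WithLp.toLp 2 v) a))
  exact WithLp.toLp_injective 2 this

/-- The inner product of gradients in a local parametrization. -/
lemma gradInner_eq_pullback (g : MetricField d X) {ψ : EuclideanSpace ℝ (Fin d) → X}
    {y : EuclideanSpace ℝ (Fin d)} {u v : X → ℝ} (hψ : MDifferentiableAt (𝓡 d) (𝓡 d) ψ y)
    (hinj : Function.Injective (mfderiv (𝓡 d) (𝓡 d) ψ y))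
    (hu : MDifferentiableAt (𝓡 d) 𝓘(ℝ, ℝ) u (ψ y))
    (hv : MDifferentiableAt (𝓡 d) 𝓘(ℝ, ℝ) v (ψ y)) :
    gradInner g u v (ψ y)
      = ∑ i, ∑ j, (pullbackGram g ψ y)⁻¹ i j * pd i (u ∘ ψ) y * pd j (v ∘ ψ) y := by
  have hJ := isUnit_jacobian hinj
  set J : Matrix (Fin d) (Fin d) ℝ := jacobian d ψ y with hJd
  have hJd' : IsUnit J.det := (Matrix.isUnit_iff_isUnit_det J).mp hJ
  have hp : (fun i => pd i (u ∘ ψ) y) = J.transpose.mulVec (partialAt u (ψ y)) :=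
    funext fun i => pd_comp_eq hψ hu i
  have hq : (fun i => pd i (v ∘ ψ) y) = J.transpose.mulVec (partialAt v (ψ y)) :=
    funext fun i => pd_comp_eq hψ hv i
  have e := sum_eq_dotProduct (pullbackGram g ψ y)⁻¹ (fun i => pd i (u ∘ ψ) y)
    (fun i => pd i (v ∘ ψ) y)
  -- Differentials transform by `Jᵀ` and the inverse Gram matrix is `J⁻¹ G⁻¹ J⁻ᵀ`, so the Jacobians
  -- cancel.
  rw [e, gradInner, sum_eq_dotProduct, hp, hq, pullbackGram_eq_jacobian, ← hJd,
    Matrix.mul_inv_rev, Matrix.mul_inv_rev, Matrix.mulVec_mulVec, Matrix.mul_assoc,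
    Matrix.mul_assoc, Matrix.nonsing_inv_mul _ (by rwa [Matrix.det_transpose]), Matrix.mul_one,
    Matrix.mulVec_transpose, ← Matrix.dotProduct_mulVec, Matrix.mulVec_mulVec,
    Matrix.mul_nonsing_inv_cancel_left _ _ hJd']

end Pullback

/-! ### Charts -/

section Charts

attribute [local instance] chartedSpaceSelf

variable {d k : ℕ} {X : Type*} [TopologicalSpace X] [ChartedSpace (EuclideanSpace ℝ (Fin d)) X]

/-- Differentiate `pr ∘ ψ = id`: the derivative of `pr` is a left inverse of that of `ψ`. -/
lemma injective_mfderiv_of_leftInverse {ψ : EuclideanSpace ℝ (Fin k) → X}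
    {pr : X → EuclideanSpace ℝ (Fin k)} {y : EuclideanSpace ℝ (Fin k)}
    (hψ : MDifferentiableAt (𝓡 k) (𝓡 d) ψ y) (hpr : MDifferentiableAt (𝓡 d) (𝓡 k) pr (ψ y))
    (h : ∀ᶠ z in 𝓝 y, pr (ψ z) = z) : Function.Injective (mfderiv (𝓡 k) (𝓡 d) ψ y) := by
  have h1 : mfderiv (𝓡 k) (𝓡 k) (pr ∘ ψ) y = mfderiv (𝓡 k) (𝓡 k) id y :=
    Filter.EventuallyEq.mfderiv_eq h
  rw [mfderiv_comp y hpr hψ, mfderiv_id] at h1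
  intro v w hvw
  have h2 := DFunLike.congr_fun h1
  refine (h2 v).symm.trans (Eq.trans ?_ (h2 w))
  exact congrArg (mfderiv (𝓡 d) (𝓡 k) pr (ψ y)) hvw

variable [IsManifold (𝓡 d) ∞ X]

lemma contMDiffAt_chart_symm {c : X} {y : EuclideanSpace ℝ (Fin d)}
    (hy : y ∈ (extChartAt (𝓡 d) c).target) :
    ContMDiffAt (𝓡 d) (𝓡 d) ∞ (extChartAt (𝓡 d) c).symm y :=
  (contMDiffOn_extChartAt_symm c).contMDiffAt ((isOpen_extChartAt_target c).mem_nhds hy)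

lemma mdifferentiableAt_chart_symm {c : X} {y : EuclideanSpace ℝ (Fin d)}
    (hy : y ∈ (extChartAt (𝓡 d) c).target) :
    MDifferentiableAt (𝓡 d) (𝓡 d) (extChartAt (𝓡 d) c).symm y :=
  (contMDiffAt_chart_symm hy).mdifferentiableAt (by simp)

lemma contMDiffAt_chart {c x : X} (hx : x ∈ (extChartAt (𝓡 d) c).source) :
    ContMDiffAt (𝓡 d) (𝓡 d) ∞ (extChartAt (𝓡 d) c) x :=
  contMDiffAt_extChartAt' (by rwa [extChartAt_source] at hx)

lemma injective_mfderiv_chart_symm {c : X} {y : EuclideanSpace ℝ (Fin d)}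
    (hy : y ∈ (extChartAt (𝓡 d) c).target) :
    Function.Injective (mfderiv (𝓡 d) (𝓡 d) (extChartAt (𝓡 d) c).symm y) := by
  refine injective_mfderiv_of_leftInverse (pr := extChartAt (𝓡 d) c)
    (mdifferentiableAt_chart_symm hy)
    ((contMDiffAt_chart ((extChartAt (𝓡 d) c).map_target hy)).mdifferentiableAt (by simp)) ?_
  filter_upwards [(isOpen_extChartAt_target c).mem_nhds hy] with z hz
  exact (extChartAt (𝓡 d) c).right_inv hz

/-- The coordinate field is the image of a constant section under the tangent map of the inverse
chart. It is put in bundle form so that the regularity of the metric, itself stated in bundles, can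
be evaluated on it. -/
lemma contMDiffOn_chartVectorField (c : X) (i : Fin d) :
    ContMDiffOn (𝓡 d) ((𝓡 d).prod 𝓘(ℝ, EuclideanSpace ℝ (Fin d))) 2
      (fun y : EuclideanSpace ℝ (Fin d) => (⟨(extChartAt (𝓡 d) c).symm y,
        mfderiv (𝓡 d) (𝓡 d) (extChartAt (𝓡 d) c).symm y (EuclideanSpace.single i (1 : ℝ))⟩ :
          TangentBundle (𝓡 d) X)) (extChartAt (𝓡 d) c).target := by
  have h := (contMDiffOn_extChartAt_symm (I := 𝓡 d) (n := ∞) c).contMDiffOn_tangentMapWithin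
    (m := 2) (by norm_cast) (isOpen_extChartAt_target c).uniqueMDiffOn
  have h2 : ContMDiff (𝓡 d) ((𝓡 d).prod 𝓘(ℝ, EuclideanSpace ℝ (Fin d))) 2
      (fun y : EuclideanSpace ℝ (Fin d) =>
        (⟨y, EuclideanSpace.single i (1 : ℝ)⟩ :
          TangentBundle (𝓡 d) (EuclideanSpace ℝ (Fin d)))) := by
    intro y
    refine (Bundle.contMDiffAt_section y).mpr ?_
    simp only [trivializationAt_model_space_apply]
    exact contMDiffAt_const
  have h3 := h.comp (s := (extChartAt (𝓡 d) c).target)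
    (f := fun y : EuclideanSpace ℝ (Fin d) => (⟨y, EuclideanSpace.single i (1 : ℝ)⟩ :
          TangentBundle (𝓡 d) (EuclideanSpace ℝ (Fin d)))) h2.contMDiffOn (fun y hy => hy)
  refine h3.congr fun y hy => ?_
  simp only [Function.comp_apply, tangentMapWithin]
  rw [mfderivWithin_of_isOpen (isOpen_extChartAt_target c) hy]

lemma C2Metric.isPosDefField (g : C2Metric d X) : IsPosDefField g.inner where
  symm := g.symm
  pos := g.pos

lemma contDiffOn_chartMetric (g : C2Metric d X) (c : X) (i j : Fin d) :
    ContDiffOn ℝ 2 (fun y => chartMetric g.inner c y i j) (extChartAt (𝓡 d) c).target := by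
  rw [← contMDiffOn_iff_contDiffOn]
  have h0 : ContMDiffOn (𝓡 d) (𝓡 d) 2 (extChartAt (𝓡 d) c).symm (extChartAt (𝓡 d) c).target :=
    (contMDiffOn_extChartAt_symm c).of_le (by norm_cast)
  have h := ContMDiffOn.clm_bundle_apply₂ (F₁ := EuclideanSpace ℝ (Fin d))
    (F₂ := EuclideanSpace ℝ (Fin d)) (F₃ := ℝ) (E₃ := Bundle.Trivial X ℝ)
    (g.contMDiff.comp_contMDiffOn h0)
    (contMDiffOn_chartVectorField c i) (contMDiffOn_chartVectorField c j)
  intro y hy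
  have := h y hy
  rw [Bundle.contMDiffWithinAt_totalSpace] at this
  exact this.2

lemma isRegularMetricAt_chartMetric (g : C2Metric d X) {c : X} {y : EuclideanSpace ℝ (Fin d)}
    (hy : y ∈ (extChartAt (𝓡 d) c).target) : IsRegularMetricAt (chartMetric g.inner c) y where
  contDiffAt i j := (contDiffOn_chartMetric g c i j).contDiffAt
    ((isOpen_extChartAt_target c).mem_nhds hy)
  isSymm := Eventually.of_forall fun _ => Matrix.IsSymm.ext fun _ _ =>
    g.symm _ _ _
  det_pos := (g.isPosDefField.posDef_pullbackGram (injective_mfderiv_chart_symm hy)).det_pos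

lemma gradInner_chart (g : MetricField d X) {c : X} {y : EuclideanSpace ℝ (Fin d)}
    (hy : y ∈ (extChartAt (𝓡 d) c).target) {u v : X → ℝ}
    (hu : MDifferentiableAt (𝓡 d) 𝓘(ℝ, ℝ) u ((extChartAt (𝓡 d) c).symm y))
    (hv : MDifferentiableAt (𝓡 d) 𝓘(ℝ, ℝ) v ((extChartAt (𝓡 d) c).symm y)) :
    gradInner g u v ((extChartAt (𝓡 d) c).symm y)
      = ∑ i, ∑ j, (chartMetric g c y)⁻¹ i j * pd i (u ∘ (extChartAt (𝓡 d) c).symm) y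
        * pd j (v ∘ (extChartAt (𝓡 d) c).symm) y :=
  gradInner_eq_pullback g (mdifferentiableAt_chart_symm hy) (injective_mfderiv_chart_symm hy) hu hv

lemma contDiffAt_comp_chart_symm {c : X} {y : EuclideanSpace ℝ (Fin d)}
    (hy : y ∈ (extChartAt (𝓡 d) c).target) {u : X → ℝ} {m : ℕ∞ω} (hm : m ≤ (∞ : ℕ∞ω))
    (hu : ContMDiff (𝓡 d) 𝓘(ℝ, ℝ) m u) :
    ContDiffAt ℝ m (u ∘ (extChartAt (𝓡 d) c).symm) y := by
  rw [← contMDiffAt_iff_contDiffAt]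
  exact hu.contMDiffAt.comp y ((contMDiffAt_chart_symm hy).of_le hm)

/-- A metric field which is continuous in every chart. -/
def IsContinuousField (g : MetricField d X) : Prop :=
  ∀ (c : X) (i j : Fin d),
    ContinuousOn (fun y => chartMetric g c y i j) (extChartAt (𝓡 d) c).target

lemma C2Metric.isContinuousField (g : C2Metric d X) : IsContinuousField g.inner :=
  fun c i j => (contDiffOn_chartMetric g c i j).continuousOn

omit [IsManifold (𝓡 d) ∞ X] in
lemma IsContinuousField.conformal {g : MetricField d X} (hg : IsContinuousField g) {u : X → ℝ}
    (hu : Continuous u) : IsContinuousField (conformal u g) := fun c i j =>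
  ((hu.comp_continuousOn (continuousOn_extChartAt_symm c)).pow 2).mul (hg c i j)

lemma continuousAt_matrix_inv {E : Type*} [TopologicalSpace E] {ι : Type*} [Fintype ι]
    [DecidableEq ι] {A : E → Matrix ι ι ℝ} {x : E} (hA : ContinuousAt A x)
    (h0 : (A x).det ≠ 0) : ContinuousAt (fun z => (A z)⁻¹) x := by
  simp only [Matrix.inv_def, Ring.inverse_eq_inv']
  have hdet : ContinuousAt (fun z => (A z).det) x := continuous_id.matrix_det.continuousAt.comp hA
  exact (hdet.inv₀ h0).smul (continuous_id.matrix_adjugate.continuousAt.comp hA)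

/-- Inner products of gradients of `C¹` functions are continuous. -/
lemma continuous_gradInner {g : MetricField d X} (hg : IsContinuousField g)
    (hp : IsPosDefField g) {u v : X → ℝ} (hu : ContMDiff (𝓡 d) 𝓘(ℝ, ℝ) 1 u)
    (hv : ContMDiff (𝓡 d) 𝓘(ℝ, ℝ) 1 v) : Continuous (gradInner g u v) := by
  rw [continuous_iff_continuousAt]
  intro c
  have hs : (extChartAt (𝓡 d) c).source ∈ 𝓝 c := extChartAt_source_mem_nhds c
  have hy : extChartAt (𝓡 d) c c ∈ (extChartAt (𝓡 d) c).target := mem_extChartAt_target c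
  have heq : gradInner g u v =ᶠ[𝓝 c] (fun y => ∑ i, ∑ j, (chartMetric g c y)⁻¹ i j
        * pd i (u ∘ (extChartAt (𝓡 d) c).symm) y * pd j (v ∘ (extChartAt (𝓡 d) c).symm) y)
      ∘ extChartAt (𝓡 d) c := by
    filter_upwards [hs] with x hx
    have hx' := (extChartAt (𝓡 d) c).map_source hx
    have := gradInner_chart g hx' ((hu.mdifferentiable (by simp)) _)
      ((hv.mdifferentiable (by simp)) _)
    rw [(extChartAt (𝓡 d) c).left_inv hx] at this
    exact this
  refine ContinuousAt.congr (ContinuousAt.comp ?_ (continuousAt_extChartAt c)) heq.symm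
  have hN := (isOpen_extChartAt_target (I := 𝓡 d) c).mem_nhds hy
  have hA : ContinuousAt (chartMetric g c) (extChartAt (𝓡 d) c c) :=
    continuousAt_pi.mpr fun i => continuousAt_pi.mpr fun j => (hg c i j).continuousAt hN
  have hI := continuousAt_matrix_inv hA
    (hp.posDef_pullbackGram (injective_mfderiv_chart_symm hy)).det_pos.ne'
  have hpd : ∀ {w : X → ℝ}, ContMDiff (𝓡 d) 𝓘(ℝ, ℝ) 1 w → ∀ i,
      ContinuousAt (pd i (w ∘ (extChartAt (𝓡 d) c).symm)) (extChartAt (𝓡 d) c c) := fun hw i =>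
    (contDiffAt_pd (k := 0) i (contDiffAt_comp_chart_symm hy (by norm_cast) hw)
      (by norm_num)).continuousAt
  refine tendsto_finsetSum _ fun i _ => tendsto_finsetSum _ fun j _ => ?_
  exact ((continuousAt_pi.mp (continuousAt_pi.mp hI i) j).mul (hpd hu i)).mul (hpd hv j)

/-- The pull-back of a continuous metric by a `C¹` map is continuous. -/
lemma continuousOn_pullbackGram {g : MetricField d X} (hg : IsContinuousField g)
    {ψ : EuclideanSpace ℝ (Fin k) → X} {U : Set (EuclideanSpace ℝ (Fin k))} (hU : IsOpen U)
    (hψ : ContMDiffOn (𝓡 k) (𝓡 d) 1 ψ U) : ContinuousOn (pullbackGram g ψ) U := by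
  intro y hy
  refine ContinuousAt.continuousWithinAt ?_
  set c := ψ y with hc
  have hψy : ContMDiffAt (𝓡 k) (𝓡 d) 1 ψ y := hψ.contMDiffAt (hU.mem_nhds hy)
  let φ : EuclideanSpace ℝ (Fin k) → EuclideanSpace ℝ (Fin d) := extChartAt (𝓡 d) c ∘ ψ
  have hN : ∀ᶠ z in 𝓝 y, ψ z ∈ (extChartAt (𝓡 d) c).source ∧ ContDiffAt ℝ 1 φ z := by
    have h1 : ∀ᶠ z in 𝓝 y, ψ z ∈ (extChartAt (𝓡 d) c).source :=
      hψy.continuousAt (extChartAt_source_mem_nhds c)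
    filter_upwards [h1, hU.mem_nhds hy] with z hz hzU
    refine ⟨hz, ?_⟩
    rw [← contMDiffAt_iff_contDiffAt]
    exact ((contMDiffAt_chart hz).of_le (by norm_cast)).comp z (hψ.contMDiffAt (hU.mem_nhds hzU))
  -- Near `y` the map factors through the chart at `ψ y`, and the chart components are continuous by
  -- hypothesis.
  have heq : pullbackGram g ψ =ᶠ[𝓝 y] fun z =>
      (coordJacobian φ z).transpose * chartMetric g c (φ z) * coordJacobian φ z := by
    filter_upwards [hN.eventually_nhds] with z hz
    have hzz := hz.self_of_nhds
    have : ψ =ᶠ[𝓝 z] (extChartAt (𝓡 d) c).symm ∘ φ := by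
      filter_upwards [hz] with t ht
      exact ((extChartAt (𝓡 d) c).left_inv ht.1).symm
    rw [pullbackGram_congr g this]
    exact pullbackGram_comp g
      (mdifferentiableAt_chart_symm ((extChartAt (𝓡 d) c).map_source hzz.1))
      (hzz.2.differentiableAt (by simp))
  refine ContinuousAt.congr ?_ heq.symm
  have hφ := hN.self_of_nhds.2
  have hJ : ContinuousAt (coordJacobian φ) y := by
    refine continuousAt_pi.mpr fun a => continuousAt_pi.mpr fun i => ?_
    have h1 : ContinuousAt (fderiv ℝ φ) y := (hφ.fderiv_right (m := 0) (by norm_num)).continuousAt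
    have h2 : ContinuousAt (fun z => fderiv ℝ φ z (EuclideanSpace.single i (1 : ℝ))) y :=
      h1.clm_apply continuousAt_const
    exact (PiLp.continuous_apply 2 _ a).continuousAt.comp h2
  have hy' : φ y ∈ (extChartAt (𝓡 d) c).target :=
    (extChartAt (𝓡 d) c).map_source hN.self_of_nhds.1
  have hA : ContinuousAt (chartMetric g c) (φ y) :=
    continuousAt_pi.mpr fun i => continuousAt_pi.mpr fun j =>
      (hg c i j).continuousAt ((isOpen_extChartAt_target (I := 𝓡 d) c).mem_nhds hy')
  have hJt : ContinuousAt (fun z => (coordJacobian φ z).transpose) y :=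
    continuous_id.matrix_transpose.continuousAt.comp hJ
  have hAφ : ContinuousAt (fun z => chartMetric g c (φ z)) y := hA.comp hφ.continuousAt
  have hmul : ∀ {a b e : ℕ}, Continuous fun p : Matrix (Fin a) (Fin b) ℝ × Matrix (Fin b) (Fin e) ℝ
      => p.1 * p.2 := continuous_fst.matrix_mul continuous_snd
  exact hmul.continuousAt.comp ((hmul.continuousAt.comp (hJt.prodMk hAφ)).prodMk hJ)

end Charts

/-! ### Area measures in parametrizations -/

section Area

attribute [local instance] chartedSpaceSelf

variable {d k : ℕ} {X : Type*} [TopologicalSpace X] [ChartedSpace (EuclideanSpace ℝ (Fin d)) X]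

/-- `Γ` is a `C¹` parametrization of `S ∩ W` by the open set `V`, whose inverse is the restriction
of a `C¹` map `pr` on the open set `W`. -/
structure IsParametrization (d : ℕ) {X : Type*} [TopologicalSpace X]
    [ChartedSpace (EuclideanSpace ℝ (Fin d)) X] {k : ℕ} (S : Set X)
    (Γ : EuclideanSpace ℝ (Fin k) → X) (V : Set (EuclideanSpace ℝ (Fin k)))
    (pr : X → EuclideanSpace ℝ (Fin k)) (W : Set X) : Prop where
  isOpen_domain : IsOpen V
  isOpen_range : IsOpen W
  contMDiffOn : ContMDiffOn (𝓡 k) (𝓡 d) 1 Γ V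
  contMDiffOn_inv : ContMDiffOn (𝓡 d) (𝓡 k) 1 pr W
  mapsTo : MapsTo Γ V (S ∩ W)
  mapsTo_inv : MapsTo pr (S ∩ W) V
  left_inv : ∀ z ∈ V, pr (Γ z) = z
  right_inv : ∀ x ∈ S ∩ W, Γ (pr x) = x

lemma IsParametrization.isPatch {S W : Set X} {Γ : EuclideanSpace ℝ (Fin k) → X}
    {V : Set (EuclideanSpace ℝ (Fin k))} {pr : X → EuclideanSpace ℝ (Fin k)}
    (h : IsParametrization d S Γ V pr W) : IsPatch d S Γ V where
  isOpen := h.isOpen_domain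
  contMDiffOn := h.contMDiffOn
  injOn x hx y hy hxy := by rw [← h.left_inv x hx, ← h.left_inv y hy, hxy]
  mapsTo x hx := (h.mapsTo hx).1

lemma IsParametrization.injective_mfderiv {S W : Set X} {Γ : EuclideanSpace ℝ (Fin k) → X}
    {V : Set (EuclideanSpace ℝ (Fin k))} {pr : X → EuclideanSpace ℝ (Fin k)}
    (h : IsParametrization d S Γ V pr W) {z : EuclideanSpace ℝ (Fin k)} (hz : z ∈ V) :
    Function.Injective (mfderiv (𝓡 k) (𝓡 d) Γ z) := by
  refine injective_mfderiv_of_leftInverse (pr := pr)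
    ((h.contMDiffOn.contMDiffAt (h.isOpen_domain.mem_nhds hz)).mdifferentiableAt (by simp))
    ((h.contMDiffOn_inv.contMDiffAt
      (h.isOpen_range.mem_nhds (h.mapsTo hz).2)).mdifferentiableAt (by simp)) ?_
  filter_upwards [h.isOpen_domain.mem_nhds hz] with t ht using h.left_inv t ht

lemma isParametrization_chart [IsManifold (𝓡 d) ∞ X] (c : X) :
    IsParametrization d univ (extChartAt (𝓡 d) c).symm (extChartAt (𝓡 d) c).target
      (extChartAt (𝓡 d) c) (extChartAt (𝓡 d) c).source where
  isOpen_domain := isOpen_extChartAt_target c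
  isOpen_range := isOpen_extChartAt_source c
  contMDiffOn := (contMDiffOn_extChartAt_symm c).of_le (by norm_cast)
  contMDiffOn_inv x hx := ((contMDiffAt_chart hx).of_le (by norm_cast)).contMDiffWithinAt
  mapsTo z hz := ⟨mem_univ _, (extChartAt (𝓡 d) c).map_target hz⟩
  mapsTo_inv x hx := (extChartAt (𝓡 d) c).map_source hx.2
  left_inv z hz := (extChartAt (𝓡 d) c).right_inv hz
  right_inv x hx := (extChartAt (𝓡 d) c).left_inv hx.2

lemma measurableSet_inter_preimage {α β : Type*} [TopologicalSpace α] [MeasurableSpace α]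
    [BorelSpace α] [TopologicalSpace β] [MeasurableSpace β] [BorelSpace β] {f : α → β} {U : Set α}
    (hU : MeasurableSet U) (hf : ContinuousOn f U) {A : Set β} (hA : MeasurableSet A) :
    MeasurableSet (U ∩ f ⁻¹' A) := by
  have h : MeasurableSet (U.domRestrict f ⁻¹' A) :=
    (continuousOn_iff_continuous_domRestrict.mp hf).measurable hA
  have := hU.subtype_image h
  convert this using 1
  ext x
  simp [Set.domRestrict, and_comm]

variable [MeasurableSpace X] [BorelSpace X]

/-- Nothing is known of `ψ` off `U`, but the measure does not charge that set. Without this,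
`Measure.map` would take its default value 0. -/
lemma aemeasurable_patch {ψ : EuclideanSpace ℝ (Fin k) → X} {U : Set (EuclideanSpace ℝ (Fin k))}
    (hU : MeasurableSet U) (hψ : ContinuousOn ψ U) (f : EuclideanSpace ℝ (Fin k) → ℝ≥0∞) :
    AEMeasurable ψ ((volume.restrict U).withDensity f) :=
  (hψ.aemeasurable hU).mono_ac (withDensity_absolutelyContinuous _ _)

lemma patchMeasure_apply (g : MetricField d X) {ψ : EuclideanSpace ℝ (Fin k) → X}
    {U : Set (EuclideanSpace ℝ (Fin k))} (hU : MeasurableSet U) (hψ : ContinuousOn ψ U) {A : Set X}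
    (hA : MeasurableSet A) :
    patchMeasure g ψ U A = ∫⁻ y in U ∩ ψ ⁻¹' A, ENNReal.ofReal √(pullbackGram g ψ y).det := by
  rw [patchMeasure, Measure.map_apply_of_aemeasurable (aemeasurable_patch hU hψ _) hA,
    withDensity_apply', Measure.restrict_restrict' hU, inter_comm]

/-- The transition map `pr ∘ ψ` is injective and `C¹` on the part of `U` lying over `W`, and the
area density changes by `|det|` of its derivative. Change of variables then gives the area of the
piece covered by `ψ`, which is part of what `Γ` covers. -/
lemma patchMeasure_le (g : MetricField d X) {S W : Set X} {Γ : EuclideanSpace ℝ (Fin k) → X}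
    {V : Set (EuclideanSpace ℝ (Fin k))} {pr : X → EuclideanSpace ℝ (Fin k)}
    (h : IsParametrization d S Γ V pr W) {ψ : EuclideanSpace ℝ (Fin k) → X}
    {U : Set (EuclideanSpace ℝ (Fin k))} (hψ : IsPatch d S ψ U) {A : Set X}
    (hA : MeasurableSet A) (hAW : A ⊆ W) : patchMeasure g ψ U A ≤ patchMeasure g Γ V A := by
  have hψc : ContinuousOn ψ U := hψ.contMDiffOn.continuousOn
  rw [patchMeasure_apply g hψ.isOpen.measurableSet hψc hA,
    patchMeasure_apply g h.isOpen_domain.measurableSet h.contMDiffOn.continuousOn hA]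
  let φ : EuclideanSpace ℝ (Fin k) → EuclideanSpace ℝ (Fin k) := pr ∘ ψ
  have hO : IsOpen (U ∩ ψ ⁻¹' W) := hψc.isOpen_inter_preimage hψ.isOpen h.isOpen_range
  have hΓφ : ∀ y ∈ U ∩ ψ ⁻¹' W, Γ (φ y) = ψ y := fun y hy =>
    h.right_inv _ ⟨hψ.mapsTo hy.1, hy.2⟩
  have hφV : ∀ y ∈ U ∩ ψ ⁻¹' W, φ y ∈ V := fun y hy =>
    h.mapsTo_inv ⟨hψ.mapsTo hy.1, hy.2⟩
  have hφ : ∀ y ∈ U ∩ ψ ⁻¹' W, DifferentiableAt ℝ φ y := fun y hy => by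
    have h1 : ContMDiffAt (𝓡 k) (𝓡 d) 1 ψ y := hψ.contMDiffOn.contMDiffAt (hψ.isOpen.mem_nhds hy.1)
    have h2 : ContMDiffAt (𝓡 d) (𝓡 k) 1 pr (ψ y) :=
      h.contMDiffOn_inv.contMDiffAt (h.isOpen_range.mem_nhds hy.2)
    exact (contMDiffAt_iff_contDiffAt.mp (h2.comp y h1)).differentiableAt (by simp)
  have hgram : ∀ y ∈ U ∩ ψ ⁻¹' W, ENNReal.ofReal √(pullbackGram g ψ y).det
      = ENNReal.ofReal |(fderiv ℝ φ y).det| * ENNReal.ofReal √(pullbackGram g Γ (φ y)).det := by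
    intro y hy
    have heq : ψ =ᶠ[𝓝 y] Γ ∘ φ := by
      filter_upwards [hO.mem_nhds hy] with z hz using (hΓφ z hz).symm
    rw [pullbackGram_congr g heq, pullbackGram_comp g ((h.contMDiffOn.contMDiffAt
      (h.isOpen_domain.mem_nhds (hφV y hy))).mdifferentiableAt (by simp)) (hφ y hy),
      Matrix.det_mul, Matrix.det_mul, Matrix.det_transpose, det_coordJacobian,
      ← ENNReal.ofReal_mul (abs_nonneg _), ← Real.sqrt_sq_eq_abs, ← Real.sqrt_mul (sq_nonneg _)]
    congr 2
    ring
  have hsub : U ∩ ψ ⁻¹' A ⊆ U ∩ ψ ⁻¹' W := inter_subset_inter_right _ (preimage_mono hAW)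
  have hm : MeasurableSet (U ∩ ψ ⁻¹' A) :=
    measurableSet_inter_preimage hψ.isOpen.measurableSet hψc hA
  rw [setLIntegral_congr_fun hm fun y hy => hgram y (hsub hy),
    ← lintegral_image_eq_lintegral_abs_det_fderiv_mul volume hm
      (fun y hy => (hφ y (hsub hy)).hasFDerivAt.hasFDerivWithinAt)
      (fun y hy z hz hyz => hψ.injOn hy.1 hz.1 (by
        rw [← hΓφ y (hsub hy), ← hΓφ z (hsub hz), hyz]))
      (fun z => ENNReal.ofReal √(pullbackGram g Γ z).det)]
  refine lintegral_mono_set ?_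
  rintro _ ⟨y, hy, rfl⟩
  exact ⟨hφV y (hsub hy), by rw [mem_preimage, hΓφ y (hsub hy)]; exact hy.2⟩

/-- In a parametrization the area measure is `√det(Γ^* g) dy`. -/
lemma areaMeasure_restrict (g : MetricField d X) {S W : Set X} {Γ : EuclideanSpace ℝ (Fin k) → X}
    {V : Set (EuclideanSpace ℝ (Fin k))} {pr : X → EuclideanSpace ℝ (Fin k)}
    (h : IsParametrization d S Γ V pr W) :
    (areaMeasure g k S).restrict W = patchMeasure g Γ V := by
  have hW := h.isOpen_range.measurableSet
  have hle' : ∀ {ψ : EuclideanSpace ℝ (Fin k) → X} {U : Set (EuclideanSpace ℝ (Fin k))},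
      IsPatch d S ψ U → patchMeasure g ψ U ≤ areaMeasure g k S := fun {ψ U} hψ =>
    le_iSup₂_of_le ψ U (le_iSup_of_le hψ le_rfl)
  have hle : patchMeasure g Γ V ≤ areaMeasure g k S := hle' h.isPatch
  apply le_antisymm
  · have hbound : areaMeasure g k S ≤ patchMeasure g Γ V + (areaMeasure g k S).restrict Wᶜ := by
      refine iSup₂_le fun ψ U => iSup_le fun hψ => Measure.le_iff.mpr fun s hs => ?_
      rw [← measure_inter_add_sdiff s hW]
      refine add_le_add ?_ ?_
      · exact (patchMeasure_le g h hψ (hs.inter hW) inter_subset_right).trans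
          (measure_mono inter_subset_left)
      · refine le_trans ?_ (Measure.restrict_apply hs).ge
        exact hle' hψ (s \ W)
    refine Measure.le_iff.mpr fun s hs => ?_
    rw [Measure.restrict_apply hs]
    refine (Measure.le_iff.mp hbound _ (hs.inter hW)).trans ?_
    rw [Measure.add_apply, Measure.restrict_apply (hs.inter hW), inter_assoc, inter_compl_self,
      inter_empty, measure_empty, add_zero]
    exact measure_mono inter_subset_left
  · refine Measure.le_iff.mpr fun s hs => ?_
    rw [Measure.restrict_apply hs]
    refine le_trans ?_ (hle (s ∩ W))
    have hc : ContinuousOn Γ V := h.contMDiffOn.continuousOn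
    rw [patchMeasure_apply g h.isOpen_domain.measurableSet hc hs,
      patchMeasure_apply g h.isOpen_domain.measurableSet hc (hs.inter hW)]
    exact lintegral_mono_set fun y hy => ⟨hy.1, hy.2, (h.mapsTo hy.1).2⟩

variable [IsManifold (𝓡 d) ∞ X]

omit [MeasurableSpace X] [BorelSpace X] in
lemma continuousOn_sqrt_det_pullbackGram {g : MetricField d X} (hg : IsContinuousField g)
    {ψ : EuclideanSpace ℝ (Fin k) → X} {U : Set (EuclideanSpace ℝ (Fin k))} (hU : IsOpen U)
    (hψ : ContMDiffOn (𝓡 k) (𝓡 d) 1 ψ U) :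
    ContinuousOn (fun y => √(pullbackGram g ψ y).det) U :=
  Real.continuous_sqrt.comp_continuousOn
    (continuous_id.matrix_det.comp_continuousOn (continuousOn_pullbackGram hg hU hψ))

lemma setLIntegral_areaMeasure {g : MetricField d X} (hg : IsContinuousField g) {S W : Set X}
    {Γ : EuclideanSpace ℝ (Fin k) → X} {V : Set (EuclideanSpace ℝ (Fin k))}
    {pr : X → EuclideanSpace ℝ (Fin k)} (h : IsParametrization d S Γ V pr W) {F : X → ℝ≥0∞}
    (hF : Measurable F) :
    ∫⁻ x in W, F x ∂(areaMeasure g k S)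
      = ∫⁻ z in V, ENNReal.ofReal √(pullbackGram g Γ z).det * F (Γ z) := by
  have hV := h.isOpen_domain.measurableSet
  have hc : ContinuousOn Γ V := h.contMDiffOn.continuousOn
  rw [areaMeasure_restrict g h, patchMeasure, lintegral_map' hF.aemeasurable
    (aemeasurable_patch hV hc _), lintegral_withDensity_eq_lintegral_mul₀]
  · rfl
  · exact ((continuousOn_sqrt_det_pullbackGram hg h.isOpen_domain h.contMDiffOn).aemeasurable
      hV).ennreal_ofReal
  · exact hF.comp_aemeasurable (hc.aemeasurable hV)

lemma setIntegral_areaMeasure {g : MetricField d X} (hg : IsContinuousField g) {S W : Set X}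
    {Γ : EuclideanSpace ℝ (Fin k) → X} {V : Set (EuclideanSpace ℝ (Fin k))}
    {pr : X → EuclideanSpace ℝ (Fin k)} (h : IsParametrization d S Γ V pr W) {F : X → ℝ}
    (hF : Measurable F) :
    ∫ x in W, F x ∂(areaMeasure g k S)
      = ∫ z in V, √(pullbackGram g Γ z).det * F (Γ z) := by
  have hV := h.isOpen_domain.measurableSet
  have hc : ContinuousOn Γ V := h.contMDiffOn.continuousOn
  rw [areaMeasure_restrict g h, patchMeasure, integral_map (aemeasurable_patch hV hc _)
    hF.aestronglyMeasurable, integral_withDensity_eq_integral_toReal_smul₀]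
  · simp [Real.sqrt_nonneg]
  · exact ((continuousOn_sqrt_det_pullbackGram hg h.isOpen_domain h.contMDiffOn).aemeasurable
      hV).ennreal_ofReal
  · simp

/-- The Riemannian volume is finite on compact sets. -/
lemma isLocallyFiniteMeasure_volumeMeasure {g : MetricField d X} (hg : IsContinuousField g) :
    IsLocallyFiniteMeasure (volumeMeasure g) where
  finiteAtNhds x := by
    have h := isParametrization_chart (d := d) x
    have hx : extChartAt (𝓡 d) x x ∈ (extChartAt (𝓡 d) x).target := mem_extChartAt_target x
    obtain ⟨r, hr, hball⟩ := Metric.nhds_basis_closedBall.mem_iff.mp (h.isOpen_domain.mem_nhds hx)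
    have hcont := continuousOn_sqrt_det_pullbackGram hg h.isOpen_domain h.contMDiffOn
    obtain ⟨M, hM⟩ := (isCompact_closedBall (extChartAt (𝓡 d) x x) r).exists_bound_of_continuousOn
      (hcont.mono hball)
    let N := (extChartAt (𝓡 d) x).source ∩ extChartAt (𝓡 d) x ⁻¹' Metric.ball (extChartAt (𝓡 d) x x) r
    have hN : IsOpen N := (continuousOn_extChartAt x).isOpen_inter_preimage h.isOpen_range
      Metric.isOpen_ball
    refine ⟨N, hN.mem_nhds ⟨mem_extChartAt_source x, Metric.mem_ball_self hr⟩, ?_⟩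
    have h1 : volumeMeasure g N = patchMeasure g (extChartAt (𝓡 d) x).symm
        (extChartAt (𝓡 d) x).target N := by
      rw [← areaMeasure_restrict g h, Measure.restrict_apply hN.measurableSet,
        inter_eq_left.mpr inter_subset_left]
      rfl
    rw [h1, patchMeasure_apply g h.isOpen_domain.measurableSet h.contMDiffOn.continuousOn
      hN.measurableSet]
    have hsub : (extChartAt (𝓡 d) x).target ∩ (extChartAt (𝓡 d) x).symm ⁻¹' N
        ⊆ Metric.closedBall (extChartAt (𝓡 d) x x) r := by
      rintro y ⟨hy, hyN⟩
      have := hyN.2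
      rw [mem_preimage, (extChartAt (𝓡 d) x).right_inv hy] at this
      exact Metric.ball_subset_closedBall this
    calc _ ≤ ∫⁻ y in Metric.closedBall (extChartAt (𝓡 d) x x) r,
          ENNReal.ofReal √(pullbackGram g (extChartAt (𝓡 d) x).symm y).det :=
        lintegral_mono_set hsub
      _ ≤ ∫⁻ _ in Metric.closedBall (extChartAt (𝓡 d) x x) r, ENNReal.ofReal M :=
        setLIntegral_mono measurable_const fun y hy =>
          ENNReal.ofReal_le_ofReal ((le_abs_self _).trans (hM y hy))
      _ < ⊤ := by
        rw [setLIntegral_const]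
        exact ENNReal.mul_lt_top ENNReal.ofReal_lt_top
          (isCompact_closedBall _ _).measure_lt_top

end Area

/-! ### Integration by parts -/

section IntegrationByParts

variable {d : ℕ}

lemma continuous_mul_of_tsupport {E : Type*} [TopologicalSpace E] {u v : E → ℝ} {T : Set E}
    (hT : IsOpen T) (hu : Continuous u) (hv : ContinuousOn v T) (hs : tsupport u ⊆ T) :
    Continuous fun y => u y * v y :=
  ContinuousOn.continuous_of_tsupport_subset (hu.continuousOn.mul hv) hT
    ((closure_mono (Function.support_mul_subset_left u v)).trans hs)

/-- Integration by parts on an open set, against a function vanishing off a compact subset. -/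
lemma setIntegral_mul_pd {T K : Set (EuclideanSpace ℝ (Fin d))} (hT : IsOpen T)
    (hK : IsCompact K) (hKT : K ⊆ T) {u v : EuclideanSpace ℝ (Fin d) → ℝ}
    (hu : ContDiffOn ℝ 1 u T) (hv : ContDiffOn ℝ 1 v T) (h0 : ∀ y ∈ T, y ∉ K → u y = 0)
    (i : Fin d) :
    IntegrableOn (fun y => pd i u y * v y) T ∧ IntegrableOn (fun y => u y * pd i v y) T ∧
      ∫ y in T, pd i u y * v y = - ∫ y in T, u y * pd i v y := by
  -- Extension by zero is `C¹` on the whole space, since `u` already vanishes on `T` off the compact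
  -- set `K`.
  set U := T.indicator u with hU
  have hUz : ∀ y ∉ K, U y = 0 := by
    intro y hy
    by_cases hyT : y ∈ T
    · rw [hU, indicator_of_mem hyT, h0 y hyT hy]
    · rw [hU, indicator_of_notMem hyT]
  have hts : tsupport U ⊆ K := closure_minimal (fun y hy => by
    by_contra h; exact hy (hUz y h)) hK.isClosed
  have hUu : ∀ y ∈ T, U =ᶠ[𝓝 y] u := fun y hy => by
    filter_upwards [hT.mem_nhds hy] with z hz using indicator_of_mem hz u
  have hUd : ContDiff ℝ 1 U := contDiff_iff_contDiffAt.mpr fun y => by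
    by_cases hy : y ∈ T
    · exact (hu.contDiffAt (hT.mem_nhds hy)).congr_of_eventuallyEq (hUu y hy)
    · have : U =ᶠ[𝓝 y] fun _ => 0 := by
        filter_upwards [hK.isClosed.isOpen_compl.mem_nhds (fun h => hy (hKT h))] with z hz
          using hUz z hz
      exact contDiffAt_const.congr_of_eventuallyEq this
  have hUc : HasCompactSupport U := hK.of_isClosed_subset (isClosed_tsupport U) hts
  have hpdU : Continuous (pd i U) :=
    (hUd.continuous_fderiv (by simp)).clm_apply continuous_const
  have hpds : tsupport (pd i U) ⊆ tsupport U := tsupport_fderiv_apply_subset ℝ _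
  have hpdc : HasCompactSupport (pd i U) :=
    hUc.of_isClosed_subset (isClosed_tsupport _) hpds
  have hvd : ∀ y ∈ T, ContDiffAt ℝ 1 v y := fun y hy => hv.contDiffAt (hT.mem_nhds hy)
  have hpdv : ContinuousOn (pd i v) T := fun y hy =>
    (contDiffAt_pd (k := 0) i (hvd y hy) (by norm_num)).continuousAt.continuousWithinAt
  have c1 : Continuous fun y => pd i U y * v y :=
    continuous_mul_of_tsupport hT hpdU hv.continuousOn (hpds.trans (hts.trans hKT))
  have c2 : Continuous fun y => U y * pd i v y :=
    continuous_mul_of_tsupport hT hUd.continuous hpdv (hts.trans hKT)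
  have c3 : Continuous fun y => U y * v y :=
    continuous_mul_of_tsupport hT hUd.continuous hv.continuousOn (hts.trans hKT)
  have i1 : Integrable (fun y => pd i U y * v y) :=
    c1.integrable_of_hasCompactSupport hpdc.mul_right
  have i2 : Integrable (fun y => U y * pd i v y) :=
    c2.integrable_of_hasCompactSupport hUc.mul_right
  have i3 : Integrable (fun y => U y * v y) :=
    c3.integrable_of_hasCompactSupport hUc.mul_right
  have key := integral_mul_fderiv_eq_neg_fderiv_mul_of_integrable (μ := volume) i1 i2 i3
    (fun y _ => hUd.differentiable (by simp) y)
    (fun y hy => (hvd y (hKT (hts hy))).differentiableAt (by simp))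
  have e1 : EqOn (fun y => pd i U y * v y) (fun y => pd i u y * v y) T := fun y hy => by
    simp only [pd_congr i (hUu y hy)]
  have e2 : EqOn (fun y => U y * pd i v y) (fun y => u y * pd i v y) T := fun y hy => by
    simp only [(hUu y hy).self_of_nhds]
  refine ⟨i1.integrableOn.congr_fun e1 hT.measurableSet,
    i2.integrableOn.congr_fun e2 hT.measurableSet, ?_⟩
  rw [← setIntegral_congr_fun hT.measurableSet e1, ← setIntegral_congr_fun hT.measurableSet e2,
    setIntegral_eq_integral_of_forall_compl_eq_zero, setIntegral_eq_integral_of_forall_compl_eq_zero]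
  · rw [← neg_eq_iff_eq_neg]; exact key.symm
  · intro y hy; rw [hUz y (fun h => hy (hKT h)), zero_mul]
  · intro y hy
    have : pd i U y = 0 := by
      by_contra h
      exact hy (hKT (hts (hpds (subset_tsupport _ h))))
    rw [this, zero_mul]

end IntegrationByParts

/-! ### Partial derivatives on the manifold -/

section PartialAt

attribute [local instance] chartedSpaceSelf

variable {d : ℕ} {X : Type*} [TopologicalSpace X] [ChartedSpace (EuclideanSpace ℝ (Fin d)) X]

/-- The tangent space at `x` is identified with `ℝᵈ` by the chart at `x`, so the two derivatives are
the same by definition. This transfers the product, chain and sum rules from coordinates. -/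
lemma partialAt_eq_pd {u : X → ℝ} {x : X} (hu : MDifferentiableAt (𝓡 d) 𝓘(ℝ, ℝ) u x)
    (i : Fin d) :
    partialAt u x i = pd i (u ∘ (extChartAt (𝓡 d) x).symm) (extChartAt (𝓡 d) x x) := by
  have h : mfderiv (𝓡 d) 𝓘(ℝ, ℝ) u x = fderivWithin ℝ (writtenInExtChartAt (𝓡 d) 𝓘(ℝ, ℝ) x u)
      (range (𝓡 d)) (extChartAt (𝓡 d) x x) := hu.mfderiv
  rw [ModelWithCorners.range_eq_univ, fderivWithin_univ] at h
  exact DFunLike.congr_fun h _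

lemma MDifferentiableAt.comp_chart {u : X → ℝ} {x : X}
    (hu : MDifferentiableAt (𝓡 d) 𝓘(ℝ, ℝ) u x) :
    DifferentiableAt ℝ (u ∘ (extChartAt (𝓡 d) x).symm) (extChartAt (𝓡 d) x x) := by
  have := (mdifferentiableAt_iff u x).mp hu |>.2
  rw [ModelWithCorners.range_eq_univ, differentiableWithinAt_univ] at this
  exact this

lemma partialAt_mul {u v : X → ℝ} {x : X} (hu : MDifferentiableAt (𝓡 d) 𝓘(ℝ, ℝ) u x)
    (hv : MDifferentiableAt (𝓡 d) 𝓘(ℝ, ℝ) v x) (i : Fin d) :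
    partialAt (fun z => u z * v z) x i = partialAt u x i * v x + u x * partialAt v x i := by
  have huv : MDifferentiableAt (𝓡 d) 𝓘(ℝ, ℝ) (fun z => u z * v z) x := hu.mul hv
  have h := pd_mul i hu.comp_chart hv.comp_chart
  simp only [Function.comp_apply, extChartAt_to_inv] at h
  rw [partialAt_eq_pd huv, partialAt_eq_pd hu, partialAt_eq_pd hv, ← h]
  rfl

lemma partialAt_comp {u : X → ℝ} {x : X} (hu : MDifferentiableAt (𝓡 d) 𝓘(ℝ, ℝ) u x) {F : ℝ → ℝ}
    {F' : ℝ} (hF : HasDerivAt F F' (u x)) (i : Fin d) :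
    partialAt (fun z => F (u z)) x i = F' * partialAt u x i := by
  have hFu : MDifferentiableAt (𝓡 d) 𝓘(ℝ, ℝ) (fun z => F (u z)) x :=
    hF.differentiableAt.mdifferentiableAt.comp x hu
  have h := pd_comp i (u := u ∘ (extChartAt (𝓡 d) x).symm) (y := extChartAt (𝓡 d) x x)
    (F := F) (F' := F') (by simpa using hF) hu.comp_chart
  rw [partialAt_eq_pd hFu, partialAt_eq_pd hu, ← h]
  rfl

lemma partialAt_sum {ι : Type*} (s : Finset ι) {u : ι → X → ℝ} {x : X}
    (hu : ∀ a ∈ s, MDifferentiableAt (𝓡 d) 𝓘(ℝ, ℝ) (u a) x) (i : Fin d) :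
    partialAt (fun z => ∑ a ∈ s, u a z) x i = ∑ a ∈ s, partialAt (u a) x i := by
  have hs : MDifferentiableAt (𝓡 d) 𝓘(ℝ, ℝ) (fun z => ∑ a ∈ s, u a z) x := by
    rw [mdifferentiableAt_iff]
    refine ⟨tendsto_finsetSum _ fun a ha => (hu a ha).continuousAt, ?_⟩
    rw [ModelWithCorners.range_eq_univ, differentiableWithinAt_univ]
    exact DifferentiableAt.fun_sum fun a ha => (hu a ha).comp_chart
  have h := pd_sum s (fun a => u a ∘ (extChartAt (𝓡 d) x).symm) i fun a ha => (hu a ha).comp_chart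
  rw [partialAt_eq_pd hs]
  refine Eq.trans ?_ (h.trans (Finset.sum_congr rfl fun a ha => (partialAt_eq_pd (hu a ha) i).symm))
  rfl

lemma partialAt_eq_zero {u : X → ℝ} {x : X} (hx : x ∉ tsupport u) (i : Fin d) :
    partialAt u x i = 0 := by
  have h : u =ᶠ[𝓝 x] fun _ => 0 := notMem_tsupport_iff_eventuallyEq.mp hx
  rw [partialAt, h.mfderiv_eq, mfderiv_const]
  rfl

lemma gradInner_eq_zero (g : MetricField d X) {u : X → ℝ} (v : X → ℝ) {x : X}
    (hx : x ∉ tsupport u) : gradInner g u v x = 0 := by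
  simp [gradInner, partialAt_eq_zero hx]

lemma gradInner_sum (g : MetricField d X) {ι : Type*} (s : Finset ι) {u : ι → X → ℝ}
    (v : X → ℝ) {x : X} (hu : ∀ a ∈ s, MDifferentiableAt (𝓡 d) 𝓘(ℝ, ℝ) (u a) x) :
    gradInner g (fun z => ∑ a ∈ s, u a z) v x = ∑ a ∈ s, gradInner g (u a) v x := by
  simp only [gradInner, partialAt_sum s hu, Finset.mul_sum, Finset.sum_mul]
  conv_rhs => rw [Finset.sum_comm]
  refine Finset.sum_congr rfl fun i _ => ?_
  conv_rhs => rw [Finset.sum_comm]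

lemma gradInner_mul (g : MetricField d X) {u v : X → ℝ} (w : X → ℝ) {x : X}
    (hu : MDifferentiableAt (𝓡 d) 𝓘(ℝ, ℝ) u x) (hv : MDifferentiableAt (𝓡 d) 𝓘(ℝ, ℝ) v x) :
    gradInner g (fun z => u z * v z) w x
      = v x * gradInner g u w x + u x * gradInner g v w x := by
  simp only [gradInner, partialAt_mul hu hv, Finset.mul_sum, ← Finset.sum_add_distrib]
  exact Finset.sum_congr rfl fun i _ => Finset.sum_congr rfl fun j _ => by ring

lemma gradInner_comp (g : MetricField d X) {u : X → ℝ} (w : X → ℝ) {x : X}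
    (hu : MDifferentiableAt (𝓡 d) 𝓘(ℝ, ℝ) u x) {F : ℝ → ℝ} {F' : ℝ}
    (hF : HasDerivAt F F' (u x)) :
    gradInner g (fun z => F (u z)) w x = F' * gradInner g u w x := by
  simp only [gradInner, partialAt_comp hu hF, Finset.mul_sum]
  exact Finset.sum_congr rfl fun i _ => Finset.sum_congr rfl fun j _ => by ring

end PartialAt

/-! ### Conformal metrics `ρ² g₀` on a manifold -/

section ConformalManifold

attribute [local instance] chartedSpaceSelf

variable {d : ℕ} {X : Type*} [TopologicalSpace X] [ChartedSpace (EuclideanSpace ℝ (Fin d)) X]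
  {ρ : X → ℝ} {c : X} {y : EuclideanSpace ℝ (Fin d)}

lemma chartMetric_conformal (u : X → ℝ) (g : MetricField d X) (c : X)
    (y : EuclideanSpace ℝ (Fin d)) : chartMetric (conformal u g) c y
      = u ((extChartAt (𝓡 d) c).symm y) ^ 2 • chartMetric g c y := rfl

lemma contMDiff_log (hρ : ContMDiff (𝓡 d) 𝓘(ℝ, ℝ) 2 ρ) (hpos : ∀ x, 0 < ρ x) :
    ContMDiff (𝓡 d) 𝓘(ℝ, ℝ) 2 (fun x => Real.log (ρ x)) := fun x =>
  (Real.contDiffAt_log.mpr (hpos x).ne').contMDiffAt.comp x (hρ x)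

variable [IsManifold (𝓡 d) ∞ X] {g₀ : C2Metric d X}

lemma chartMetric_conformal_eq_exp (hpos : ∀ x, 0 < ρ x) (c : X) :
    chartMetric (conformal ρ g₀.inner) c = fun z =>
      Real.exp (2 * ((fun x => Real.log (ρ x)) ∘ (extChartAt (𝓡 d) c).symm) z)
        • chartMetric g₀.inner c z := by
  funext z
  rw [chartMetric_conformal, Function.comp_apply, two_mul, Real.exp_add, Real.exp_log (hpos _), sq]

lemma chartMetric_conformal_inv (hpos : ∀ x, 0 < ρ x) (hy : y ∈ (extChartAt (𝓡 d) c).target) :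
    (chartMetric (conformal ρ g₀.inner) c y)⁻¹
      = (ρ ((extChartAt (𝓡 d) c).symm y) ^ 2)⁻¹ • (chartMetric g₀.inner c y)⁻¹ := by
  have h := isRegularMetricAt_chartMetric g₀ hy
  have h0 : ρ ((extChartAt (𝓡 d) c).symm y) ^ 2 ≠ 0 := (pow_pos (hpos _) 2).ne'
  have := Matrix.inv_smul' (A := chartMetric g₀.inner c y) (Units.mk0 _ h0)
      (isUnit_iff_ne_zero.mpr h.det_ne)
  simpa [Units.smul_def, chartMetric_conformal] using this

lemma sqrt_det_chartMetric_conformal (hpos : ∀ x, 0 < ρ x) :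
    √(chartMetric (conformal ρ g₀.inner) c y).det
      = ρ ((extChartAt (𝓡 d) c).symm y) ^ d * √(chartMetric g₀.inner c y).det := by
  rw [chartMetric_conformal, Matrix.det_smul, Fintype.card_fin, Real.sqrt_mul (by positivity),
    ← pow_mul, mul_comm 2 d, pow_mul, Real.sqrt_sq (pow_pos (hpos _) d).le]

lemma pd_eq_mul_pd_log (hρ : ContMDiff (𝓡 d) 𝓘(ℝ, ℝ) 2 ρ) (hpos : ∀ x, 0 < ρ x)
    (hy : y ∈ (extChartAt (𝓡 d) c).target) (i : Fin d) :
    pd i (ρ ∘ (extChartAt (𝓡 d) c).symm) y = ρ ((extChartAt (𝓡 d) c).symm y)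
      * pd i ((fun x => Real.log (ρ x)) ∘ (extChartAt (𝓡 d) c).symm) y := by
  have hd : DifferentiableAt ℝ (ρ ∘ (extChartAt (𝓡 d) c).symm) y :=
    (contDiffAt_comp_chart_symm hy (by norm_cast) hρ).differentiableAt (by simp)
  have h := pd_comp i (Real.hasDerivAt_log (hpos ((extChartAt (𝓡 d) c).symm y)).ne') hd
  have h0 := (hpos ((extChartAt (𝓡 d) c).symm y)).ne'
  change pd i ((fun x => Real.log (ρ x)) ∘ (extChartAt (𝓡 d) c).symm) y
    = (ρ ((extChartAt (𝓡 d) c).symm y))⁻¹ * _ at h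
  rw [h, mul_inv_cancel_left₀ h0]

/-- The inverse metric contributes `ρ⁻²` and `∂ρ = ρ ∂(log ρ)` one factor `ρ`. -/
lemma gradInner_conformal (hρ : ContMDiff (𝓡 d) 𝓘(ℝ, ℝ) 2 ρ) (hpos : ∀ x, 0 < ρ x)
    (hy : y ∈ (extChartAt (𝓡 d) c).target) {u : X → ℝ} (hu : ContMDiff (𝓡 d) 𝓘(ℝ, ℝ) 1 u) :
    gradInner (conformal ρ g₀.inner) u ρ ((extChartAt (𝓡 d) c).symm y)
      = (ρ ((extChartAt (𝓡 d) c).symm y))⁻¹ * ∑ i, ∑ j, (chartMetric g₀.inner c y)⁻¹ i j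
        * pd i (u ∘ (extChartAt (𝓡 d) c).symm) y
        * pd j ((fun x => Real.log (ρ x)) ∘ (extChartAt (𝓡 d) c).symm) y := by
  rw [gradInner_chart _ hy (hu.mdifferentiable (by simp) _) (hρ.mdifferentiable (by simp) _),
    chartMetric_conformal_inv hpos hy, Finset.mul_sum]
  refine Finset.sum_congr rfl fun i _ => ?_
  rw [Finset.mul_sum]
  refine Finset.sum_congr rfl fun j _ => ?_
  rw [pd_eq_mul_pd_log hρ hpos hy, Matrix.smul_apply, smul_eq_mul]
  have h0 := (hpos ((extChartAt (𝓡 d) c).symm y)).ne'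
  field_simp

lemma gradSq_conformal (hρ : ContMDiff (𝓡 d) 𝓘(ℝ, ℝ) 2 ρ) (hpos : ∀ x, 0 < ρ x)
    (hy : y ∈ (extChartAt (𝓡 d) c).target) :
    gradSq (conformal ρ g₀.inner) ρ ((extChartAt (𝓡 d) c).symm y)
      = ∑ i, ∑ j, (chartMetric g₀.inner c y)⁻¹ i j
        * pd i ((fun x => Real.log (ρ x)) ∘ (extChartAt (𝓡 d) c).symm) y
        * pd j ((fun x => Real.log (ρ x)) ∘ (extChartAt (𝓡 d) c).symm) y := by
  rw [gradSq_eq_gradInner, gradInner_conformal hρ hpos hy (hρ.of_le (by norm_num)), Finset.mul_sum]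
  refine Finset.sum_congr rfl fun i _ => ?_
  rw [Finset.mul_sum]
  refine Finset.sum_congr rfl fun j _ => ?_
  rw [pd_eq_mul_pd_log hρ hpos hy]
  have h0 := (hpos ((extChartAt (𝓡 d) c).symm y)).ne'
  field_simp

/-- The equation `Δ w + (k - s) |dw|² = -s` of an adapted defining function `ρ = e^w`, where
`|dw|²` with respect to `g₀` equals `|dρ|²` with respect to `ρ² g₀`. -/
def IsAdaptedInterior (k s : ℝ) (g₀ : C2Metric d X) (ρ : X → ℝ) : Prop :=
  ∀ c : X, ∀ y ∈ (extChartAt (𝓡 d) c).target,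
    laplacian (chartMetric g₀.inner c)
        ((fun x => Real.log (ρ x)) ∘ (extChartAt (𝓡 d) c).symm) y
      = -s - (k - s) * gradSq (conformal ρ g₀.inner) ρ ((extChartAt (𝓡 d) c).symm y)

/-- The scalar curvature of `ρ² g₀` for an adapted defining function of an Einstein metric. -/
lemma scalarCurvature_conformal (hρ : ContMDiff (𝓡 d) 𝓘(ℝ, ℝ) 2 ρ) (hpos : ∀ x, 0 < ρ x)
    {lam k s : ℝ} (hE : IsEinstein g₀.inner lam) (hA : IsAdaptedInterior k s g₀ ρ) (x : X) :
    scalarCurvature (conformal ρ g₀.inner) x = (ρ x ^ 2)⁻¹ * (lam * d + 2 * (d - 1) * s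
      + (2 * (d - 1) * (k - s) - (d - 1) * (d - 2)) * gradSq (conformal ρ g₀.inner) ρ x) := by
  have hy : extChartAt (𝓡 d) x x ∈ (extChartAt (𝓡 d) x).target := mem_extChartAt_target x
  have hreg := isRegularMetricAt_chartMetric g₀ hy
  -- The trace of the Einstein equation.
  have hsc : scalar (chartMetric g₀.inner x) (extChartAt (𝓡 d) x x) = lam * d := by
    have htr := congrArg Matrix.trace hreg.inv_mul
    simp only [Matrix.trace, Matrix.diag, Matrix.mul_apply, Matrix.one_apply_eq] at htr
    simp only [Finset.sum_const, Finset.card_univ, Fintype.card_fin, nsmul_eq_mul, mul_one] at htr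
    rw [scalar, ← htr, Finset.mul_sum]
    refine Finset.sum_congr rfl fun i _ => ?_
    rw [Finset.mul_sum]
    refine Finset.sum_congr rfl fun j _ => ?_
    rw [hE x _ hy, hreg.symm_self.apply j i]
    ring
  have hw := contDiffAt_comp_chart_symm hy (by norm_cast) (contMDiff_log hρ hpos)
  have hq := gradSq_conformal (g₀ := g₀) hρ hpos hy
  have hlap := hA x _ hy
  have hexp : Real.exp (2 * ((fun x => Real.log (ρ x)) ∘ (extChartAt (𝓡 d) x).symm)
      (extChartAt (𝓡 d) x x)) = ρ x ^ 2 := by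
    rw [Function.comp_apply, extChartAt_to_inv, two_mul, Real.exp_add, Real.exp_log (hpos _), sq]
  rw [scalarCurvature, chartMetric_conformal_eq_exp hpos, scalar_conformal hreg hw, hexp, hsc,
    ← hq, hlap, extChartAt_to_inv]
  ring

end ConformalManifold

/-! ### One equation for `log ρ` from the two cases of an adapted function -/

section AdaptedInterior

attribute [local instance] chartedSpaceSelf

variable {n : ℕ} {X : Type*} [TopologicalSpace X] [ChartedSpace (EuclideanSpace ℝ (Fin (n + 1))) X]
  [IsManifold (𝓡 (n + 1)) ∞ X] {Xbar : Type*} [TopologicalSpace Xbar]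
  [ChartedSpace (EuclideanHalfSpace (n + 1)) Xbar]

/-- The restriction to the interior of an adapted boundary defining function. -/
lemma IsAdapted.interior {ι : X → Xbar} {g₀ : C2Metric (n + 1) X} {s : ℝ} {ρbar : Xbar → ℝ}
    (h : IsAdapted ι g₀ s ρbar) :
    (∀ x, 0 < (ρbar ∘ ι) x) ∧ ContMDiff (𝓡 (n + 1)) 𝓘(ℝ, ℝ) 2 (ρbar ∘ ι) ∧
      IsAdaptedInterior n s g₀ (ρbar ∘ ι) := by
  by_cases hs : s = n
  · obtain ⟨w, hw, hρ, hΔ⟩ := h.equation_of_eq hs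
    have hρ' : ρbar ∘ ι = fun x => Real.exp (w x) := funext hρ
    have hpos : ∀ x, 0 < (ρbar ∘ ι) x := fun x => by rw [hρ']; exact Real.exp_pos _
    have hlog : (fun x => Real.log ((ρbar ∘ ι) x)) = w := by
      funext x; rw [hρ']; exact Real.log_exp _
    refine ⟨hpos, ?_, fun c y hy => ?_⟩
    · rw [hρ']
      exact fun x => Real.contDiff_exp.contDiffAt.contMDiffAt.comp x (hw x)
    · rw [hlog, hΔ c y hy, hs]; ring
  · obtain ⟨v, hv, hvpos, hρ, hΔ⟩ := h.equation_of_ne hs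
    have ha : (n : ℝ) - s ≠ 0 := sub_ne_zero.mpr (Ne.symm hs)
    have hρ' : ρbar ∘ ι = fun x => v x ^ (1 / ((n : ℝ) - s)) := funext hρ
    have hpos : ∀ x, 0 < (ρbar ∘ ι) x := fun x => by
      rw [hρ']; exact Real.rpow_pos_of_pos (hvpos x) _
    have hρ2 : ContMDiff (𝓡 (n + 1)) 𝓘(ℝ, ℝ) 2 (ρbar ∘ ι) := by
      rw [hρ']
      exact fun x => (Real.contDiffAt_rpow_const_of_ne
        (hvpos x).ne').contMDiffAt.comp x (hv x)
    refine ⟨hpos, hρ2, fun c y hy => ?_⟩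
    -- With `w = log ρ` one has `v = e^{(n-s)w}`, so `laplacian_exp` turns the linear equation for
    -- `v` into the equation for `w` times the nonzero factor `(n-s) e^{(n-s)w}`.
    have hvexp : v ∘ (extChartAt (𝓡 (n + 1)) c).symm = fun z => Real.exp (((n : ℝ) - s)
        * ((fun x => Real.log ((ρbar ∘ ι) x)) ∘ (extChartAt (𝓡 (n + 1)) c).symm) z) := by
      funext z
      simp only [Function.comp_apply]
      rw [hρ, Real.log_rpow (hvpos _), ← mul_assoc, mul_one_div_cancel ha, one_mul,
        Real.exp_log (hvpos _)]
    have hw := contDiffAt_comp_chart_symm hy (by norm_cast) (contMDiff_log hρ2 hpos)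
    have h1 := hΔ c y hy
    have h2 := laplacian_exp (isRegularMetricAt_chartMetric g₀ hy) hw ((n : ℝ) - s)
    rw [hvexp, h2, ← gradSq_conformal hρ2 hpos hy] at h1
    have h3 : v ((extChartAt (𝓡 (n + 1)) c).symm y) = Real.exp (((n : ℝ) - s)
        * ((fun x => Real.log ((ρbar ∘ ι) x)) ∘ (extChartAt (𝓡 (n + 1)) c).symm) y) :=
      congrFun hvexp y
    beta_reduce at h1
    rw [h3] at h1
    have h4 := Real.exp_ne_zero (((n : ℝ) - s)
        * ((fun x => Real.log ((ρbar ∘ ι) x)) ∘ (extChartAt (𝓡 (n + 1)) c).symm) y)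
    have h5 : ((n : ℝ) - s) * Real.exp (((n : ℝ) - s)
        * ((fun x => Real.log ((ρbar ∘ ι) x)) ∘ (extChartAt (𝓡 (n + 1)) c).symm) y) ≠ 0 :=
      mul_ne_zero ha h4
    apply mul_left_cancel₀ h5
    linear_combination h1

end AdaptedInterior

/-! ### The weak form of the equation of an adapted defining function -/

section WeakEquation

attribute [local instance] chartedSpaceSelf

variable {n : ℕ} {X : Type*} [TopologicalSpace X] [ChartedSpace (EuclideanSpace ℝ (Fin (n + 1))) X]
  [IsManifold (𝓡 (n + 1)) ∞ X] {g₀ : C2Metric (n + 1) X} {ρ : X → ℝ} {c : X} {s : ℝ}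

/-- The vector density `√det(ρ² g₀) ∇ρ` in the chart with centre `c`. -/
def gradDensity (g₀ : C2Metric (n + 1) X) (ρ : X → ℝ) (c : X) (i : Fin (n + 1))
    (z : EuclideanSpace ℝ (Fin (n + 1))) : ℝ :=
  (ρ ∘ (extChartAt (𝓡 (n + 1)) c).symm) z ^ n * (√(chartMetric g₀.inner c z).det *
    ∑ j, (chartMetric g₀.inner c z)⁻¹ i j
      * pd j ((fun x => Real.log (ρ x)) ∘ (extChartAt (𝓡 (n + 1)) c).symm) z)

lemma contDiffOn_gradDensity (hρ : ContMDiff (𝓡 (n + 1)) 𝓘(ℝ, ℝ) 2 ρ) (hpos : ∀ x, 0 < ρ x)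
    (i : Fin (n + 1)) :
    ContDiffOn ℝ 1 (gradDensity g₀ ρ c i) (extChartAt (𝓡 (n + 1)) c).target := by
  intro z hz
  have hreg := isRegularMetricAt_chartMetric g₀ hz
  have hw := contDiffAt_comp_chart_symm hz (by norm_cast) (contMDiff_log hρ hpos)
  have hr := contDiffAt_comp_chart_symm hz (by norm_cast) hρ
  exact (((hr.of_le (by norm_num)).pow n).mul ((hreg.contDiffAt_sqrt_det.of_le (by norm_num)).mul
    (hreg.contDiffAt_grad hw i))).contDiffWithinAt

/-- The product rule gives `ρⁿ √det g₀ (n|dw|² + Δw)`. By the adapted equation the bracket is `-s(1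
- |∇ρ|²)`, and `√det g = ρⁿ⁺¹ √det g₀`. This is `Δ_g ρ = -s(1 - |∇ρ|²)/ρ` as a density. -/
lemma sum_pd_gradDensity (hρ : ContMDiff (𝓡 (n + 1)) 𝓘(ℝ, ℝ) 2 ρ) (hpos : ∀ x, 0 < ρ x)
    (hA : IsAdaptedInterior n s g₀ ρ) {z : EuclideanSpace ℝ (Fin (n + 1))}
    (hz : z ∈ (extChartAt (𝓡 (n + 1)) c).target) :
    ∑ i, pd i (gradDensity g₀ ρ c i) z = -(√(chartMetric (conformal ρ g₀.inner) c z).det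
      * (s * (1 - gradSq (conformal ρ g₀.inner) ρ ((extChartAt (𝓡 (n + 1)) c).symm z))
        / ρ ((extChartAt (𝓡 (n + 1)) c).symm z))) := by
  have hreg := isRegularMetricAt_chartMetric g₀ hz
  have hw := contDiffAt_comp_chart_symm hz (by norm_cast) (contMDiff_log hρ hpos)
  have hr := contDiffAt_comp_chart_symm hz (by norm_cast) hρ
  have hS : √(chartMetric g₀.inner c z).det ≠ 0 := (Real.sqrt_pos.mpr hreg.det_pos).ne'
  have h0 : ρ ((extChartAt (𝓡 (n + 1)) c).symm z) ≠ 0 := (hpos _).ne'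
  have hlap := hA c z hz
  rw [laplacian, inv_mul_eq_iff_eq_mul₀ hS] at hlap
  have hq := gradSq_conformal (g₀ := g₀) hρ hpos hz
  have hpow : ∀ i : Fin (n + 1),
      pd i (fun z => (ρ ∘ (extChartAt (𝓡 (n + 1)) c).symm) z ^ n) z
        = n * ρ ((extChartAt (𝓡 (n + 1)) c).symm z) ^ n
          * pd i ((fun x => Real.log (ρ x)) ∘ (extChartAt (𝓡 (n + 1)) c).symm) z := fun i => by
    rw [pd_comp i (F := fun t => t ^ n) (hasDerivAt_pow n _) (hr.differentiableAt (by norm_num)),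
      pd_eq_mul_pd_log hρ hpos hz, Function.comp_apply]
    -- The derivative of `tⁿ` involves the truncated exponent `n - 1`, so `n = 0` is separate.
    rcases n with _ | m
    · simp
    · rw [Nat.add_sub_cancel, pow_succ]; ring
  have hi : ∀ i : Fin (n + 1), pd i (gradDensity g₀ ρ c i) z
      = ρ ((extChartAt (𝓡 (n + 1)) c).symm z) ^ n * (√(chartMetric g₀.inner c z).det * (n *
        (∑ j, (chartMetric g₀.inner c z)⁻¹ i j
        * pd i ((fun x => Real.log (ρ x)) ∘ (extChartAt (𝓡 (n + 1)) c).symm) z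
        * pd j ((fun x => Real.log (ρ x)) ∘ (extChartAt (𝓡 (n + 1)) c).symm) z))
        + pd i (fun z => √(chartMetric g₀.inner c z).det * ∑ j, (chartMetric g₀.inner c z)⁻¹ i j
      * pd j ((fun x => Real.log (ρ x)) ∘ (extChartAt (𝓡 (n + 1)) c).symm) z) z) := fun i => by
    have h1 : ∑ j, (chartMetric g₀.inner c z)⁻¹ i j
        * pd i ((fun x => Real.log (ρ x)) ∘ (extChartAt (𝓡 (n + 1)) c).symm) z
        * pd j ((fun x => Real.log (ρ x)) ∘ (extChartAt (𝓡 (n + 1)) c).symm) z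
        = pd i ((fun x => Real.log (ρ x)) ∘ (extChartAt (𝓡 (n + 1)) c).symm) z *
        ∑ j, (chartMetric g₀.inner c z)⁻¹ i j
        * pd j ((fun x => Real.log (ρ x)) ∘ (extChartAt (𝓡 (n + 1)) c).symm) z := by
      rw [Finset.mul_sum]
      exact Finset.sum_congr rfl fun j _ => by ring
    have h2 : DifferentiableAt ℝ (fun z => √(chartMetric g₀.inner c z).det *
        ∑ j, (chartMetric g₀.inner c z)⁻¹ i j
      * pd j ((fun x => Real.log (ρ x)) ∘ (extChartAt (𝓡 (n + 1)) c).symm) z) z :=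
      ((hreg.contDiffAt_sqrt_det.of_le (by norm_num)).mul
        (hreg.contDiffAt_grad hw i)).differentiableAt (by norm_num)
    have h3 := pd_mul i ((hr.pow n).differentiableAt (by norm_num)) h2
    rw [h1]
    refine h3.trans ?_
    rw [hpow i, Function.comp_apply]
    ring
  rw [Finset.sum_congr rfl fun i _ => hi i, ← Finset.mul_sum, Finset.sum_add_distrib, hlap,
    ← Finset.mul_sum, ← Finset.mul_sum, ← hq, sqrt_det_chartMetric_conformal hpos, pow_succ]
  field_simp
  ring

variable [MeasurableSpace X] [BorelSpace X]

/-- In one chart both sides are Lebesgue integrals, and the identity is integration by parts of `φ`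
against the vector density `gradDensity`. -/
lemma weak_equation_of_tsupport_subset (hρ : ContMDiff (𝓡 (n + 1)) 𝓘(ℝ, ℝ) 2 ρ)
    (hpos : ∀ x, 0 < ρ x) (hA : IsAdaptedInterior n s g₀ ρ) {φ : X → ℝ}
    (hφ : ContMDiff (𝓡 (n + 1)) 𝓘(ℝ, ℝ) 1 φ) (hc : HasCompactSupport φ)
    (hs : tsupport φ ⊆ (extChartAt (𝓡 (n + 1)) c).source) :
    ∫ x, gradInner (conformal ρ g₀.inner) φ ρ x ∂(volumeMeasure (conformal ρ g₀.inner))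
      = ∫ x, φ x * (s * (1 - gradSq (conformal ρ g₀.inner) ρ x) / ρ x)
        ∂(volumeMeasure (conformal ρ g₀.inner)) := by
  have hρ1 : ContMDiff (𝓡 (n + 1)) 𝓘(ℝ, ℝ) 1 ρ := hρ.of_le (by norm_num)
  have hgc := g₀.isContinuousField.conformal hρ.continuous
  have hgp := g₀.isPosDefField.conformal fun x => (hpos x).ne'
  have hgi := continuous_gradInner hgc hgp hφ hρ1
  have hq : Continuous (gradSq (conformal ρ g₀.inner) ρ) := continuous_gradInner hgc hgp hρ1 hρ1
  have hr : Continuous fun x => φ x * (s * (1 - gradSq (conformal ρ g₀.inner) ρ x) / ρ x) :=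
    hφ.continuous.mul (((continuous_const.mul (continuous_const.sub hq)).div₀ hρ.continuous
      fun x => (hpos x).ne'))
  set K := extChartAt (𝓡 (n + 1)) c '' tsupport φ with hK
  have hKc : IsCompact K := hc.isCompact.image_of_continuousOn
    ((continuousOn_extChartAt c).mono hs)
  have hKT : K ⊆ (extChartAt (𝓡 (n + 1)) c).target := by
    rintro _ ⟨x, hx, rfl⟩
    exact (extChartAt (𝓡 (n + 1)) c).map_source (hs hx)
  have hT := isOpen_extChartAt_target (I := 𝓡 (n + 1)) c
  have hu : ContDiffOn ℝ 1 (φ ∘ (extChartAt (𝓡 (n + 1)) c).symm)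
      (extChartAt (𝓡 (n + 1)) c).target := fun z hz =>
    (contDiffAt_comp_chart_symm hz (by norm_cast) hφ).contDiffWithinAt
  have hu0 : ∀ z ∈ (extChartAt (𝓡 (n + 1)) c).target, z ∉ K →
      (φ ∘ (extChartAt (𝓡 (n + 1)) c).symm) z = 0 := fun z hz hzK => by
    by_contra h
    exact hzK ⟨_, subset_tsupport _ h, (extChartAt (𝓡 (n + 1)) c).right_inv hz⟩
  have hibp := fun i => setIntegral_mul_pd hT hKc hKT hu
    (contDiffOn_gradDensity (g₀ := g₀) (c := c) hρ hpos i) hu0 i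
  have hz1 : ∀ x ∉ (extChartAt (𝓡 (n + 1)) c).source,
      gradInner (conformal ρ g₀.inner) φ ρ x = 0 := fun x hx =>
    gradInner_eq_zero _ ρ fun h => hx (hs h)
  have hz2 : ∀ x ∉ (extChartAt (𝓡 (n + 1)) c).source,
      φ x * (s * (1 - gradSq (conformal ρ g₀.inner) ρ x) / ρ x) = 0 := fun x hx => by
    rw [image_eq_zero_of_notMem_tsupport fun h => hx (hs h), zero_mul]
  rw [← setIntegral_eq_integral_of_forall_compl_eq_zero hz1,
    ← setIntegral_eq_integral_of_forall_compl_eq_zero hz2,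
    volumeMeasure, setIntegral_areaMeasure hgc (isParametrization_chart c) hgi.measurable,
    setIntegral_areaMeasure hgc (isParametrization_chart c) hr.measurable]
  have e1 : ∀ z ∈ (extChartAt (𝓡 (n + 1)) c).target,
      √(pullbackGram (conformal ρ g₀.inner) (extChartAt (𝓡 (n + 1)) c).symm z).det
        * gradInner (conformal ρ g₀.inner) φ ρ ((extChartAt (𝓡 (n + 1)) c).symm z)
      = ∑ i, pd i (φ ∘ (extChartAt (𝓡 (n + 1)) c).symm) z * gradDensity g₀ ρ c i z := by
    intro z hz
    have h0 : ρ ((extChartAt (𝓡 (n + 1)) c).symm z) ≠ 0 := (hpos _).ne'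
    have h1 := sqrt_det_chartMetric_conformal (g₀ := g₀) (c := c) (y := z) hpos
    rw [chartMetric] at h1
    rw [h1, gradInner_conformal hρ hpos hz hφ, Finset.mul_sum, Finset.mul_sum]
    refine Finset.sum_congr rfl fun i _ => ?_
    simp only [gradDensity, Finset.mul_sum, Function.comp_apply]
    refine Finset.sum_congr rfl fun j _ => ?_
    rw [pow_succ]
    field_simp
  have e2 : ∀ z ∈ (extChartAt (𝓡 (n + 1)) c).target,
      √(pullbackGram (conformal ρ g₀.inner) (extChartAt (𝓡 (n + 1)) c).symm z).det
        * (φ ((extChartAt (𝓡 (n + 1)) c).symm z) * (s * (1 - gradSq (conformal ρ g₀.inner) ρ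
          ((extChartAt (𝓡 (n + 1)) c).symm z)) / ρ ((extChartAt (𝓡 (n + 1)) c).symm z)))
      = -∑ i, (φ ∘ (extChartAt (𝓡 (n + 1)) c).symm) z * pd i (gradDensity g₀ ρ c i) z := by
    intro z hz
    rw [← Finset.mul_sum, sum_pd_gradDensity hρ hpos hA hz, chartMetric, Function.comp_apply]
    ring
  rw [setIntegral_congr_fun hT.measurableSet e1, setIntegral_congr_fun hT.measurableSet e2,
    integral_neg, integral_finsetSum _ fun i _ => (hibp i).1,
    integral_finsetSum _ fun i _ => (hibp i).2.1, ← Finset.sum_neg_distrib]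
  exact Finset.sum_congr rfl fun i _ => (hibp i).2.2

variable [T2Space X] [SecondCountableTopology X]

/-- Green's formula for an adapted defining function and compactly supported test functions. -/
theorem weak_equation (hρ : ContMDiff (𝓡 (n + 1)) 𝓘(ℝ, ℝ) 2 ρ)
    (hpos : ∀ x, 0 < ρ x) (hA : IsAdaptedInterior n s g₀ ρ) {φ : X → ℝ}
    (hφ : ContMDiff (𝓡 (n + 1)) 𝓘(ℝ, ℝ) 1 φ) (hc : HasCompactSupport φ) :
    ∫ x, gradInner (conformal ρ g₀.inner) φ ρ x ∂(volumeMeasure (conformal ρ g₀.inner))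
      = ∫ x, φ x * (s * (1 - gradSq (conformal ρ g₀.inner) ρ x) / ρ x)
        ∂(volumeMeasure (conformal ρ g₀.inner)) := by
  have : LocallyCompactSpace X := ChartedSpace.locallyCompactSpace (EuclideanSpace ℝ (Fin (n + 1))) X
  have hρ1 : ContMDiff (𝓡 (n + 1)) 𝓘(ℝ, ℝ) 1 ρ := hρ.of_le (by norm_num)
  have hgc := g₀.isContinuousField.conformal hρ.continuous
  have hgp := g₀.isPosDefField.conformal fun x => (hpos x).ne'
  have := isLocallyFiniteMeasure_volumeMeasure hgc
  have hq : Continuous (gradSq (conformal ρ g₀.inner) ρ) := continuous_gradInner hgc hgp hρ1 hρ1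
  have hr : Continuous fun x => (s * (1 - gradSq (conformal ρ g₀.inner) ρ x) / ρ x) :=
    (((continuous_const.mul (continuous_const.sub hq)).div₀ hρ.continuous
      fun x => (hpos x).ne'))
  obtain ⟨t, ht⟩ := hc.isCompact.elim_finite_subcover
    (fun c : X => (extChartAt (𝓡 (n + 1)) c).source) (fun c => isOpen_extChartAt_source c)
    fun x _ => mem_iUnion.mpr ⟨x, mem_extChartAt_source x⟩
  -- Both sides are linear in `φ`, so a finite partition of unity on its support reduces to test
  -- functions living in one chart.
  obtain ⟨f, hf⟩ := SmoothPartitionOfUnity.exists_isSubordinate (𝓡 (n + 1))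
    (isClosed_tsupport φ) (fun c : t => (extChartAt (𝓡 (n + 1)) (c : X)).source)
    (fun c => isOpen_extChartAt_source _) (fun x hx => by
      obtain ⟨c, hct, hxc⟩ := mem_iUnion₂.mp (ht hx)
      exact mem_iUnion.mpr ⟨⟨c, hct⟩, hxc⟩)
  let ψ : t → X → ℝ := fun c x => f c x * φ x
  have hψ : ∀ c, ContMDiff (𝓡 (n + 1)) 𝓘(ℝ, ℝ) 1 (ψ c) := fun c =>
    ((f c).contMDiff.of_le (by norm_cast)).mul hφ
  have hψc : ∀ c, HasCompactSupport (ψ c) := fun c => hc.mul_left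
  have hψs : ∀ c : t, tsupport (ψ c) ⊆ (extChartAt (𝓡 (n + 1)) (c : X)).source := fun c =>
    (tsupport_mul_subset_left).trans (hf c)
  have hsum : φ = fun x => ∑ c : t, ψ c x := by
    funext x
    simp only [ψ, ← Finset.sum_mul]
    by_cases hx : x ∈ tsupport φ
    · have := f.sum_eq_one hx
      rw [finsum_eq_sum_of_fintype] at this
      rw [this, one_mul]
    · rw [image_eq_zero_of_notMem_tsupport hx, mul_zero]
  have h1 : ∀ x, gradInner (conformal ρ g₀.inner) φ ρ x
      = ∑ c : t, gradInner (conformal ρ g₀.inner) (ψ c) ρ x := fun x => by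
    conv_lhs => rw [hsum]
    exact gradInner_sum _ Finset.univ ρ fun c _ => (hψ c).mdifferentiable (by simp) x
  have h2 : ∀ x, φ x * (s * (1 - gradSq (conformal ρ g₀.inner) ρ x) / ρ x)
      = ∑ c : t, ψ c x * (s * (1 - gradSq (conformal ρ g₀.inner) ρ x) / ρ x) := fun x => by
    rw [← Finset.sum_mul]
    exact congrArg (· * _) (congrFun hsum x)
  simp only [h1, h2]
  rw [integral_finsetSum, integral_finsetSum]
  · exact Finset.sum_congr rfl fun c _ =>
      weak_equation_of_tsupport_subset hρ hpos hA (hψ c) (hψc c) (hψs c)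
  · exact fun c _ => ((hψ c).continuous.mul hr).integrable_of_hasCompactSupport
      ((hψc c).mul_right)
  · exact fun c _ => (continuous_gradInner hgc hgp (hψ c) hρ1).integrable_of_hasCompactSupport
      (HasCompactSupport.intro (hψc c) fun x hx => gradInner_eq_zero _ ρ hx)

end WeakEquation

/-! ### Delta sequences and Fatou's lemma -/

section DeltaSequence

/-- Nonnegative functions of integral one whose supports shrink to `p`. -/
structure IsDeltaSequence (η : ℕ → ℝ → ℝ) (p : ℝ) : Prop where
  continuous : ∀ k, Continuous (η k)
  lintegral_eq_one : ∀ k, ∫⁻ t, ENNReal.ofReal (η k t) = 1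
  eventually_eq_zero : ∀ U ∈ 𝓝 p, ∀ᶠ k in atTop, ∀ t ∉ U, η k t = 0

/-- If `a < B p`, then `B > a` near `p`, where `η k` eventually has all its mass. Lower
semicontinuity suffices because only a lower bound is claimed. -/
lemma IsDeltaSequence.le_liminf {η : ℕ → ℝ → ℝ} {p : ℝ} (h : IsDeltaSequence η p)
    {B : ℝ → ℝ≥0∞} (hB : LowerSemicontinuousAt B p) :
    B p ≤ liminf (fun k => ∫⁻ t, ENNReal.ofReal (η k t) * B t) atTop := by
  refine le_of_forall_lt fun a ha => ?_
  obtain ⟨a', haa', ha'⟩ := exists_between ha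
  refine haa'.trans_le (le_liminf_of_le (by isBoundedDefault) ?_)
  filter_upwards [h.eventually_eq_zero _ (hB a' ha')] with k hk
  calc a' = ∫⁻ t, ENNReal.ofReal (η k t) * a' := by
        rw [lintegral_mul_const _ (h.continuous k).measurable.ennreal_ofReal, h.lintegral_eq_one,
          one_mul]
    _ ≤ _ := lintegral_mono fun t => by
        by_cases ht : a' < B t
        · gcongr
        · simp [hk t ht]

/-- Fatou's lemma for the counting measure. -/
lemma sum_liminf_le {ι : Type*} [Fintype ι] (u : ι → ℕ → ℝ≥0∞) :
    ∑ i, liminf (u i) atTop ≤ liminf (fun k => ∑ i, u i k) atTop := by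
  let _ : MeasurableSpace ι := ⊤
  have h := lintegral_liminf_le (u := atTop) (μ := Measure.count) (f := fun k (i : ι) => u i k)
    fun k => measurable_from_top
  simpa only [lintegral_count, tsum_fintype] using h

end DeltaSequence

/-! ### Inserting a coordinate -/

section InsertCoordinate

variable {n : ℕ}

/-- The point of `ℝⁿ⁺¹` with `i`-th coordinate `t` and the other coordinates given by `z`. -/
def insertCoord (i : Fin (n + 1)) (t : ℝ) (z : EuclideanSpace ℝ (Fin n)) :
    EuclideanSpace ℝ (Fin (n + 1)) :=
  WithLp.toLp 2 (i.insertNth (α := fun _ => ℝ) t z.ofLp)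

/-- Omitting the `i`-th coordinate. -/
def removeCoord (i : Fin (n + 1)) (z : EuclideanSpace ℝ (Fin (n + 1))) :
    EuclideanSpace ℝ (Fin n) :=
  WithLp.toLp 2 fun j => z (i.succAbove j)

@[simp] lemma insertCoord_same (i : Fin (n + 1)) (t : ℝ) (z : EuclideanSpace ℝ (Fin n)) :
    insertCoord i t z i = t := by simp [insertCoord]

@[simp] lemma insertCoord_succAbove (i : Fin (n + 1)) (t : ℝ) (z : EuclideanSpace ℝ (Fin n))
    (j : Fin n) : insertCoord i t z (i.succAbove j) = z j := by simp [insertCoord]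

@[simp] lemma removeCoord_insertCoord (i : Fin (n + 1)) (t : ℝ) (z : EuclideanSpace ℝ (Fin n)) :
    removeCoord i (insertCoord i t z) = z := by
  ext j; simp [removeCoord]

lemma insertCoord_removeCoord (i : Fin (n + 1)) (z : EuclideanSpace ℝ (Fin (n + 1))) :
    insertCoord i (z i) (removeCoord i z) = z := by
  ext j
  refine Fin.succAboveCases i ?_ (fun j => ?_) j <;> simp [removeCoord]

lemma contDiff_insertCoord (i : Fin (n + 1)) (t : ℝ) : ContDiff ℝ 1 (insertCoord i t) := by
  rw [contDiff_euclidean]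
  refine Fin.succAboveCases i ?_ fun j => ?_
  · simpa using contDiff_const
  · simp only [insertCoord_succAbove]; fun_prop

lemma contDiff_removeCoord (i : Fin (n + 1)) : ContDiff ℝ 1 (removeCoord i) := by
  rw [contDiff_euclidean]
  intro j
  simp only [removeCoord]
  fun_prop

lemma continuous_insertCoord (i : Fin (n + 1)) (z : EuclideanSpace ℝ (Fin n)) :
    Continuous fun t => insertCoord i t z := by
  refine (PiLp.continuous_toLp 2 _).comp (continuous_pi fun a => ?_)
  refine Fin.succAboveCases i ?_ (fun j => ?_) a
  · simpa using continuous_id'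
  · simpa using continuous_const

lemma coordJacobian_insertCoord (i : Fin (n + 1)) (t : ℝ) (z : EuclideanSpace ℝ (Fin n)) :
    coordJacobian (insertCoord i t) z
      = Matrix.of fun a j => if a = i.succAbove j then (1 : ℝ) else 0 := by
  ext a j
  have h1 : ∀ a, fderiv ℝ (insertCoord i t) z (EuclideanSpace.single j (1 : ℝ)) a
      = pd j (fun z => insertCoord i t z a) z := fun a => by
    have hd : DifferentiableAt ℝ (insertCoord i t) z :=
      (contDiff_insertCoord i t).differentiable (by norm_num) z
    have := ((EuclideanSpace.proj (𝕜 := ℝ) a).hasFDerivAt.comp z hd.hasFDerivAt).fderiv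
    rw [pd]
    exact (DFunLike.congr_fun this (EuclideanSpace.single j (1 : ℝ))).symm
  rw [coordJacobian, Matrix.of_apply, Matrix.of_apply, h1]
  refine Fin.succAboveCases i ?_ (fun b => ?_) a
  · simp [pd_const, (Fin.succAbove_ne i j).symm]
  · have : fderiv ℝ (fun z : EuclideanSpace ℝ (Fin n) => z b) z = EuclideanSpace.proj b :=
      (EuclideanSpace.proj (𝕜 := ℝ) b).hasFDerivAt.fderiv
    simp [pd, this]

lemma submatrix_eq_coordJacobian (A : Matrix (Fin (n + 1)) (Fin (n + 1)) ℝ) (i : Fin (n + 1))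
    (t : ℝ) (z : EuclideanSpace ℝ (Fin n)) :
    (coordJacobian (insertCoord i t) z).transpose * A * coordJacobian (insertCoord i t) z
      = A.submatrix i.succAbove i.succAbove := by
  ext a b
  simp [coordJacobian_insertCoord, Matrix.mul_apply]

/-- Fubini's theorem for the splitting off of one coordinate. -/
lemma lintegral_eq_lintegral_insertCoord (i : Fin (n + 1))
    {B : EuclideanSpace ℝ (Fin (n + 1)) → ℝ≥0∞} (hB : Measurable B) :
    ∫⁻ z, B z = ∫⁻ z, ∫⁻ t, B (insertCoord i t z) := by
  have h1 := PiLp.volume_preserving_toLp (Fin (n + 1))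
  have h2 := (volume_preserving_piFinSuccAbove (fun _ : Fin (n + 1) => ℝ) i).symm
  have h3 := PiLp.volume_preserving_ofLp (Fin n)
  have hm : Measurable fun q : ℝ × (Fin n → ℝ) => B (WithLp.toLp 2
      ((MeasurableEquiv.piFinSuccAbove (fun _ : Fin (n + 1) => ℝ) i).symm q)) :=
    hB.comp (h1.measurable.comp h2.measurable)
  rw [← h1.lintegral_comp hB, ← h2.lintegral_comp (f := fun w => B (WithLp.toLp 2 w)) (hB.comp h1.measurable),
    Measure.volume_eq_prod, lintegral_prod_symm' _ hm, ← h3.lintegral_comp hm.lintegral_prod_left']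
  rfl

end InsertCoordinate

/-! ### Coordinates in which a given function is a coordinate -/

section Straightening

variable {d : ℕ}

/-- Near a point where `∂ᵢ r ≠ 0`, the function `r` may be used as the `i`-th coordinate. -/
lemma exists_straightening {r : EuclideanSpace ℝ (Fin d) → ℝ} {y : EuclideanSpace ℝ (Fin d)}
    (hr : ContDiffAt ℝ 1 r y) {i : Fin d} (hi : pd i r y ≠ 0) :
    ∃ e : OpenPartialHomeomorph (EuclideanSpace ℝ (Fin d)) (EuclideanSpace ℝ (Fin d)),
      y ∈ e.source ∧ ContDiffOn ℝ 1 e e.source ∧ ContDiffOn ℝ 1 e.symm e.target ∧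
      ∀ z ∈ e.target, r (e.symm z) = z i := by
  let ei : EuclideanSpace ℝ (Fin d) := EuclideanSpace.single i (1 : ℝ)
  -- `Ψ` overwrites the `i`-th coordinate by `r`. A vector in the kernel of its derivative is a
  -- multiple of `eᵢ` annihilated by `dr`, hence zero since `∂ᵢ r ≠ 0`.
  let Ψ : EuclideanSpace ℝ (Fin d) → EuclideanSpace ℝ (Fin d) := fun z => z + (r z - z i) • ei
  have hΨi : ∀ z, Ψ z i = r z := fun z => by simp [Ψ, ei]
  let L : EuclideanSpace ℝ (Fin d) →L[ℝ] EuclideanSpace ℝ (Fin d) :=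
    ContinuousLinearMap.id ℝ _ + (fderiv ℝ r y - EuclideanSpace.proj i).smulRight ei
  have hL : HasFDerivAt Ψ L y := by
    have h1 := (hr.differentiableAt (by norm_num)).hasFDerivAt
    have h2 := (EuclideanSpace.proj (𝕜 := ℝ) i).hasFDerivAt (x := y)
    exact (hasFDerivAt_id y).add ((h1.sub h2).smul_const ei)
  have hΨ : ContDiffAt ℝ 1 Ψ y := by
    refine contDiffAt_id.add ((hr.sub ?_).smul contDiffAt_const)
    exact (EuclideanSpace.proj (𝕜 := ℝ) i).contDiff.contDiffAt
  have hinj : Function.Injective L.toLinearMap := by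
    rw [← LinearMap.ker_eq_bot, LinearMap.ker_eq_bot']
    intro v hv
    have hv' : v + (fderiv ℝ r y v - v i) • ei = 0 := hv
    have h1 : v = (v i - fderiv ℝ r y v) • ei := by
      have h0 := eq_neg_of_add_eq_zero_left hv'
      rwa [← neg_smul, neg_sub] at h0
    have h2 : fderiv ℝ r y v = 0 := by
      have := congrArg (fun w : EuclideanSpace ℝ (Fin d) => w i) hv'
      simpa [ei] using this
    rw [h1, map_smul, smul_eq_mul] at h2
    rcases mul_eq_zero.mp h2 with h3 | h3
    · rwa [h3, zero_smul] at h1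
    · exact absurd h3 hi
  let L' : EuclideanSpace ℝ (Fin d) ≃L[ℝ] EuclideanSpace ℝ (Fin d) :=
    (LinearEquiv.ofInjectiveEndo L.toLinearMap hinj).toContinuousLinearEquiv
  have hL' : HasFDerivAt Ψ (L' : EuclideanSpace ℝ (Fin d) →L[ℝ] EuclideanSpace ℝ (Fin d)) y := by
    have h1 : (L' : EuclideanSpace ℝ (Fin d) →L[ℝ] EuclideanSpace ℝ (Fin d)) = L := by
      ext1 v; rfl
    rwa [h1]
  let e := (hΨ.toOpenPartialHomeomorph Ψ hL' (by norm_num))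
  have hys : y ∈ e.source := hΨ.mem_toOpenPartialHomeomorph_source hL' (by norm_num)
  have hsymm : ContDiffAt ℝ 1 e.symm (e y) := by
    have h1 : e.symm (e y) = y := e.left_inv hys
    refine e.contDiffAt_symm (e.map_source hys) (f₀' := L') ?_ ?_
    · rw [h1]; exact hL'
    · rw [h1]; exact hΨ
  -- Regularity is known so far at `y` and its image; shrinking to the points where both `e` and its
  -- inverse are `C¹` makes it hold throughout.
  refine ⟨e.restrContDiff ℝ 1 (by simp), ⟨hys, hΨ, hsymm⟩,
    e.contDiffOn_restrContDiff_source ℝ (by simp), e.contDiffOn_restrContDiff_target ℝ (by simp),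
    fun z hz => ?_⟩
  have h1 : Ψ (e.symm z) = z := e.right_inv hz.1
  calc r (e.symm z) = Ψ (e.symm z) i := (hΨi _).symm
    _ = z i := by rw [h1]

variable {X : Type*} [TopologicalSpace X] [ChartedSpace (EuclideanSpace ℝ (Fin d)) X]

lemma IsParametrization.precomp {k : ℕ} {S W : Set X} {Γ : EuclideanSpace ℝ (Fin k) → X}
    {V : Set (EuclideanSpace ℝ (Fin k))} {pr : X → EuclideanSpace ℝ (Fin k)}
    (h : IsParametrization d S Γ V pr W)
    (e : OpenPartialHomeomorph (EuclideanSpace ℝ (Fin k)) (EuclideanSpace ℝ (Fin k)))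
    (he : ContDiffOn ℝ 1 e e.source) (he' : ContDiffOn ℝ 1 e.symm e.target) :
    IsParametrization d S (Γ ∘ e.symm) (e.target ∩ e.symm ⁻¹' V) (e ∘ pr)
      (W ∩ pr ⁻¹' e.source) where
  isOpen_domain := e.isOpen_inter_preimage_symm h.isOpen_domain
  isOpen_range := h.contMDiffOn_inv.continuousOn.isOpen_inter_preimage h.isOpen_range e.open_source
  contMDiffOn := h.contMDiffOn.comp (he'.contMDiffOn.mono inter_subset_left) inter_subset_right
  contMDiffOn_inv := he.contMDiffOn.comp (h.contMDiffOn_inv.mono inter_subset_left)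
    inter_subset_right
  mapsTo z hz := by
    have h1 := h.mapsTo hz.2
    refine ⟨h1.1, h1.2, ?_⟩
    rw [mem_preimage, Function.comp_apply, h.left_inv _ hz.2]
    exact e.map_target hz.1
  mapsTo_inv x hx := by
    refine ⟨e.map_source hx.2.2, ?_⟩
    rw [mem_preimage, Function.comp_apply, e.left_inv hx.2.2]
    exact h.mapsTo_inv ⟨hx.1, hx.2.1⟩
  left_inv z hz := by
    rw [Function.comp_apply, Function.comp_apply, h.left_inv _ hz.2, e.right_inv hz.1]
  right_inv x hx := by
    rw [Function.comp_apply, Function.comp_apply, e.left_inv hx.2.2, h.right_inv x ⟨hx.1, hx.2.1⟩]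

end Straightening

/-! ### Nonnegativity of squared gradients -/

section GradSq

variable {d : ℕ} {X : Type*} [TopologicalSpace X] [ChartedSpace (EuclideanSpace ℝ (Fin d)) X]
  {g : MetricField d X}

lemma gradSq_nonneg (hg : IsPosDefField g) (u : X → ℝ) (x : X) : 0 ≤ gradSq g u x := by
  rw [gradSq, sum_eq_dotProduct]
  simpa using (hg.gramAt_posDef x).inv.posSemidef.dotProduct_mulVec_nonneg (partialAt u x)

lemma gradNorm_nonneg (g : MetricField d X) (u : X → ℝ) (x : X) : 0 ≤ gradNorm g u x :=
  Real.sqrt_nonneg _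

end GradSq

/-! ### Level sets as coordinate slices, and their area as a limit of volumes -/

section LevelSets

variable {n : ℕ} {X : Type*} [TopologicalSpace X] [ChartedSpace (EuclideanSpace ℝ (Fin (n + 1))) X]

/-- A parametrization of an open subset `W` of `X` in which `ρ` is the `i`-th coordinate. -/
structure IsStraightening (ρ : X → ℝ) (i : Fin (n + 1))
    (Φ : EuclideanSpace ℝ (Fin (n + 1)) → X) (T : Set (EuclideanSpace ℝ (Fin (n + 1))))
    (pr : X → EuclideanSpace ℝ (Fin (n + 1))) (W : Set X) : Prop where
  isParametrization : IsParametrization (n + 1) univ Φ T pr W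
  apply_eq : ∀ z ∈ T, ρ (Φ z) = z i

/-- A nonzero gradient means that some coordinate derivative of `ρ` is nonzero, and the chart is
then composed with the straightening map. -/
lemma exists_isStraightening [IsManifold (𝓡 (n + 1)) ∞ X] (g : MetricField (n + 1) X) {ρ : X → ℝ}
    (hρ : ContMDiff (𝓡 (n + 1)) 𝓘(ℝ, ℝ) 1 ρ) {x : X} (hx : gradSq g ρ x ≠ 0) :
    ∃ (i : Fin (n + 1)) (Φ : EuclideanSpace ℝ (Fin (n + 1)) → X)
      (T : Set (EuclideanSpace ℝ (Fin (n + 1)))) (pr : X → EuclideanSpace ℝ (Fin (n + 1)))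
      (W : Set X), x ∈ W ∧ IsStraightening ρ i Φ T pr W := by
  have hy : extChartAt (𝓡 (n + 1)) x x ∈ (extChartAt (𝓡 (n + 1)) x).target :=
    mem_extChartAt_target x
  have hmd := hρ.mdifferentiable (by norm_num)
  have hq := gradInner_chart g hy (hmd _) (hmd _)
  rw [extChartAt_to_inv, ← gradSq_eq_gradInner] at hq
  obtain ⟨i, hi⟩ : ∃ i, pd i (ρ ∘ (extChartAt (𝓡 (n + 1)) x).symm)
      (extChartAt (𝓡 (n + 1)) x x) ≠ 0 := by
    by_contra! h
    exact hx (by rw [hq]; simp only [h, mul_zero, Finset.sum_const_zero])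
  obtain ⟨e, hye, he, he', her⟩ := exists_straightening
    (contDiffAt_comp_chart_symm hy (by norm_cast) hρ) hi
  have hP := (isParametrization_chart x).precomp e he he'
  exact ⟨i, _, _, _, _, (⟨mem_extChartAt_source x, hye⟩ : x ∈ (extChartAt (𝓡 (n + 1)) x).source ∩
    extChartAt (𝓡 (n + 1)) x ⁻¹' e.source), hP, fun z hz => her z hz.1⟩

variable {ρ : X → ℝ} {i : Fin (n + 1)} {Φ : EuclideanSpace ℝ (Fin (n + 1)) → X}
  {T : Set (EuclideanSpace ℝ (Fin (n + 1)))} {pr : X → EuclideanSpace ℝ (Fin (n + 1))} {W : Set X}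

/-- As `ρ` is the `i`-th coordinate, the level set inside `W` is the slice where this coordinate
equals `p`, and the other coordinates parametrize it. -/
lemma IsStraightening.levelSet (h : IsStraightening ρ i Φ T pr W) (p : ℝ) :
    IsParametrization (n + 1) {x | ρ x = p} (Φ ∘ insertCoord i p) (insertCoord i p ⁻¹' T)
      (removeCoord i ∘ pr) W where
  isOpen_domain := h.isParametrization.isOpen_domain.preimage (contDiff_insertCoord i p).continuous
  isOpen_range := h.isParametrization.isOpen_range
  contMDiffOn := h.isParametrization.contMDiffOn.comp
    (contDiff_insertCoord i p).contMDiff.contMDiffOn Subset.rfl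
  contMDiffOn_inv := (contDiff_removeCoord i).contMDiff.comp_contMDiffOn
    h.isParametrization.contMDiffOn_inv
  mapsTo z hz := ⟨(h.apply_eq _ hz).trans (insertCoord_same i p z),
    (h.isParametrization.mapsTo hz).2⟩
  mapsTo_inv x hx := by
    have h1 : pr x ∈ T := h.isParametrization.mapsTo_inv ⟨mem_univ _, hx.2⟩
    have h2 : Φ (pr x) = x := h.isParametrization.right_inv x ⟨mem_univ _, hx.2⟩
    have h3 : pr x i = p := by rw [← h.apply_eq _ h1, h2]; exact hx.1
    rw [mem_preimage, Function.comp_apply, ← h3, insertCoord_removeCoord]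
    exact h1
  left_inv z hz := by
    rw [Function.comp_apply, Function.comp_apply, h.isParametrization.left_inv _ hz,
      removeCoord_insertCoord]
  right_inv x hx := by
    have h1 : pr x ∈ T := h.isParametrization.mapsTo_inv ⟨mem_univ _, hx.2⟩
    have h2 : Φ (pr x) = x := h.isParametrization.right_inv x ⟨mem_univ _, hx.2⟩
    have h3 : pr x i = p := by rw [← h.apply_eq _ h1, h2]; exact hx.1
    rw [Function.comp_apply, Function.comp_apply, ← h3, insertCoord_removeCoord, h2]

/-- The area density of a level set is the volume density times `|∇ρ|`. -/
lemma IsStraightening.sqrt_det_levelSet (h : IsStraightening ρ i Φ T pr W)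
    {g : MetricField (n + 1) X} (hg : IsPosDefField g) (hρ : ContMDiff (𝓡 (n + 1)) 𝓘(ℝ, ℝ) 1 ρ)
    {p : ℝ} {z : EuclideanSpace ℝ (Fin n)} (hz : insertCoord i p z ∈ T) :
    √(pullbackGram g (Φ ∘ insertCoord i p) z).det
      = √(pullbackGram g Φ (insertCoord i p z)).det * gradNorm g ρ (Φ (insertCoord i p z)) := by
  have hP := h.isParametrization
  have hT := hP.isOpen_domain.mem_nhds hz
  have hΦ : MDifferentiableAt (𝓡 (n + 1)) (𝓡 (n + 1)) Φ (insertCoord i p z) :=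
    (hP.contMDiffOn.contMDiffAt hT).mdifferentiableAt (by norm_num)
  have hmd := hρ.mdifferentiable (by norm_num) (Φ (insertCoord i p z))
  have hdet := (hg.posDef_pullbackGram (hP.injective_mfderiv hz)).det_pos
  have hpd : ∀ a, pd a (ρ ∘ Φ) (insertCoord i p z) = if a = i then 1 else 0 := fun a => by
    have h1 : ρ ∘ Φ =ᶠ[𝓝 (insertCoord i p z)] EuclideanSpace.proj (𝕜 := ℝ) i := by
      filter_upwards [hT] with w hw using h.apply_eq w hw
    rw [pd_congr a h1, pd, ContinuousLinearMap.fderiv]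
    simp [eq_comm]
  have hq : gradSq g ρ (Φ (insertCoord i p z))
      = (pullbackGram g Φ (insertCoord i p z))⁻¹ i i := by
    rw [gradSq_eq_gradInner, gradInner_eq_pullback g hΦ (hP.injective_mfderiv hz) hmd hmd]
    simp [hpd]
  -- The Gram matrix of the slice is the minor with row and column `i` deleted. By Cramer's rule its
  -- determinant is `det G` times the `(i, i)` entry of the inverse, which is `|∇ρ|²`.
  rw [pullbackGram_comp g hΦ ((contDiff_insertCoord i p).differentiable (by norm_num) z),
    submatrix_eq_coordJacobian, gradNorm, hq, ← Real.sqrt_mul hdet.le, Matrix.inv_def,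
    Matrix.smul_apply, Ring.inverse_eq_inv', smul_eq_mul, mul_inv_cancel_left₀ hdet.ne',
    Matrix.adjugate_fin_succ_eq_det_submatrix, Even.neg_one_pow ⟨_, rfl⟩, one_mul]

variable [IsManifold (𝓡 (n + 1)) ∞ X] [MeasurableSpace X] [BorelSpace X]

/-- One factor `|∇ρ|` of `|∇ρ|²` is the ratio of area density to volume density. In these
coordinates the level-set integral is thus the slice `t = p` of the very function `B` whose
integrals against `η k` appear on the right. -/
lemma IsStraightening.setLIntegral_levelSet_le (h : IsStraightening ρ i Φ T pr W)
    {g : MetricField (n + 1) X} (hgc : IsContinuousField g) (hgp : IsPosDefField g)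
    (hρ : ContMDiff (𝓡 (n + 1)) 𝓘(ℝ, ℝ) 1 ρ) {η : ℕ → ℝ → ℝ} {p : ℝ} (hη : IsDeltaSequence η p)
    {F : X → ℝ} (hF : Continuous F) :
    ∫⁻ x in W, ENNReal.ofReal (F x * gradNorm g ρ x) ∂(areaMeasure g n {x | ρ x = p})
      ≤ liminf (fun k => ∫⁻ x in W, ENNReal.ofReal (η k (ρ x)) *
        ENNReal.ofReal (F x * gradSq g ρ x) ∂(volumeMeasure g)) atTop := by
  have hP := h.isParametrization
  have hq : Continuous (gradSq g ρ) := continuous_gradInner hgc hgp hρ hρ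
  have hqn : Continuous (gradNorm g ρ) := hq.sqrt
  have hq0 : ∀ x, gradNorm g ρ x * gradNorm g ρ x = gradSq g ρ x := fun x =>
    Real.mul_self_sqrt (gradSq_nonneg hgp ρ x)
  have hTm := hP.isOpen_domain.measurableSet
  let b : EuclideanSpace ℝ (Fin (n + 1)) → ℝ≥0∞ := fun z =>
    ENNReal.ofReal √(pullbackGram g Φ z).det * ENNReal.ofReal (F (Φ z) * gradSq g ρ (Φ z))
  let B : EuclideanSpace ℝ (Fin (n + 1)) → ℝ≥0∞ := T.indicator b
  have hb : ∀ z, b z = ENNReal.ofReal (√(pullbackGram g Φ z).det * (F (Φ z) * gradSq g ρ (Φ z))) :=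
    fun z => (ENNReal.ofReal_mul (Real.sqrt_nonneg _)).symm
  have hbc : ContinuousOn b T := by
    simp only [funext hb]
    exact ENNReal.continuous_ofReal.comp_continuousOn
      ((continuousOn_sqrt_det_pullbackGram hgc hP.isOpen_domain hP.contMDiffOn).mul
        ((hF.mul hq).comp_continuousOn hP.contMDiffOn.continuousOn))
  -- A nonnegative function continuous on an open set and extended by zero is lower semicontinuous,
  -- though it may jump at the edge of `T`.
  have hB : LowerSemicontinuous B := by
    intro z a ha
    by_cases hz : z ∈ T
    · have hTz := hP.isOpen_domain.mem_nhds hz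
      simp only [B, indicator_of_mem hz] at ha
      filter_upwards [hTz, (hbc.continuousAt hTz).eventually (lt_mem_nhds ha)] with w hw hw'
      simpa only [B, indicator_of_mem hw] using hw'
    · simp [B, indicator_of_notMem hz] at ha
  have hL : ∫⁻ x in W, ENNReal.ofReal (F x * gradNorm g ρ x) ∂(areaMeasure g n {x | ρ x = p})
      = ∫⁻ z, B (insertCoord i p z) := by
    rw [setLIntegral_areaMeasure hgc (h.levelSet p)
      (F := fun x => ENNReal.ofReal (F x * gradNorm g ρ x)) (hF.mul hqn).measurable.ennreal_ofReal,
      ← lintegral_indicator (h.levelSet p).isOpen_domain.measurableSet]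
    refine lintegral_congr fun z => ?_
    by_cases hz : insertCoord i p z ∈ T
    · rw [indicator_of_mem (show z ∈ insertCoord i p ⁻¹' T from hz)]
      simp only [B, indicator_of_mem hz]
      rw [hb, h.sqrt_det_levelSet hgp hρ hz, ← ENNReal.ofReal_mul
        (by rw [gradNorm]; positivity), Function.comp_apply, ← hq0]
      congr 1
      ring
    · rw [indicator_of_notMem (show z ∉ insertCoord i p ⁻¹' T from hz)]
      simp only [B, indicator_of_notMem hz]
  have hR : ∀ k, ∫⁻ x in W, ENNReal.ofReal (η k (ρ x)) *
        ENNReal.ofReal (F x * gradSq g ρ x) ∂(volumeMeasure g)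
      = ∫⁻ z, ∫⁻ t, ENNReal.ofReal (η k t) * B (insertCoord i t z) := fun k => by
    have hm : Measurable fun z : EuclideanSpace ℝ (Fin (n + 1)) =>
        ENNReal.ofReal (η k (z i)) * B z :=
      ((hη.continuous k).comp (by fun_prop)).measurable.ennreal_ofReal.mul hB.measurable
    have hm' : Measurable fun x : X => ENNReal.ofReal (η k (ρ x)) *
        ENNReal.ofReal (F x * gradSq g ρ x) :=
      ((hη.continuous k).comp hρ.continuous).measurable.ennreal_ofReal.mul
        (hF.mul hq).measurable.ennreal_ofReal
    have h1 := lintegral_eq_lintegral_insertCoord i hm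
    simp only [insertCoord_same] at h1
    rw [← h1, volumeMeasure, setLIntegral_areaMeasure hgc hP hm', ← lintegral_indicator hTm]
    refine lintegral_congr fun z => ?_
    by_cases hz : z ∈ T
    · simp only [B, indicator_of_mem hz, b, h.apply_eq z hz]
      ring
    · simp only [B, indicator_of_notMem hz, mul_zero]
  rw [hL]
  simp only [hR]
  -- For fixed `z` the delta sequence bounds the value at `t = p` by a lower limit; Fatou's lemma
  -- takes that limit out of the integral over `z`.
  refine (lintegral_mono fun z => ?_).trans (lintegral_liminf_le fun k => ?_)
  · exact hη.le_liminf (B := fun t => B (insertCoord i t z))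
      ((hB.comp (continuous_insertCoord i z)) p)
  · have : Continuous fun q : EuclideanSpace ℝ (Fin n) × ℝ => insertCoord i q.2 q.1 := by
      refine (PiLp.continuous_toLp 2 _).comp (continuous_pi fun a => ?_)
      refine Fin.succAboveCases i ?_ (fun j => ?_) a
      · simpa using continuous_snd
      · simp only [Fin.insertNth_apply_succAbove]; fun_prop
    exact Measurable.lintegral_prod_right' (f := fun q : EuclideanSpace ℝ (Fin n) × ℝ =>
      ENNReal.ofReal (η k q.2) * B (insertCoord i q.2 q.1))
      (((hη.continuous k).comp continuous_snd).measurable.ennreal_ofReal.mul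
        (hB.measurable.comp this.measurable))

variable [T2Space X] [SecondCountableTopology X]

/-- Fatou's lemma for the coarea formula: the area of a level set, weighted by `|∇ρ|`, is bounded
by the limit of weighted volumes of thin neighbourhoods. -/
theorem lintegral_levelSet_le_liminf {g : MetricField (n + 1) X} (hgc : IsContinuousField g)
    (hgp : IsPosDefField g) (hρ : ContMDiff (𝓡 (n + 1)) 𝓘(ℝ, ℝ) 1 ρ) {η : ℕ → ℝ → ℝ} {p : ℝ}
    (hη : IsDeltaSequence η p) {F : X → ℝ} (hF : Continuous F) (hF0 : ∀ x, 0 ≤ F x)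
    (hFc : HasCompactSupport F) :
    ∫⁻ x, ENNReal.ofReal (F x * gradNorm g ρ x) ∂(areaMeasure g n {x | ρ x = p})
      ≤ liminf (fun k => ∫⁻ x, ENNReal.ofReal (η k (ρ x)) *
        ENNReal.ofReal (F x * gradSq g ρ x) ∂(volumeMeasure g)) atTop := by
  have : LocallyCompactSpace X := ChartedSpace.locallyCompactSpace (EuclideanSpace ℝ (Fin (n + 1))) X
  have hq : Continuous (gradSq g ρ) := continuous_gradInner hgc hgp hρ hρ
  have hqn : Continuous (gradNorm g ρ) := hq.sqrt
  set A := areaMeasure g n {x | ρ x = p}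
  -- The compact sets `K m` exhaust the part of the support where the gradient is nonzero, and the
  -- integrand vanishes elsewhere. Each is covered by finitely many straightened domains.
  let K : ℕ → Set X := fun m => tsupport F ∩ {x | 1 / ((m : ℝ) + 1) ≤ gradSq g ρ x}
  have hKc : ∀ m, IsClosed (K m) := fun m =>
    (isClosed_tsupport F).inter (isClosed_le continuous_const hq)
  have hKmono : Monotone K := fun a b hab x hx => by
    have h1 : 1 / ((b : ℝ) + 1) ≤ 1 / ((a : ℝ) + 1) := by gcongr
    exact ⟨hx.1, h1.trans hx.2⟩
  have hsupp : ∀ x ∉ ⋃ m, K m, ENNReal.ofReal (F x * gradNorm g ρ x) = 0 := by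
    intro x hx
    by_cases hxF : x ∈ tsupport F
    · have hq0 : gradSq g ρ x ≤ 0 := by
        by_contra! h
        obtain ⟨m, hm⟩ := exists_nat_one_div_lt h
        exact hx (mem_iUnion.mpr ⟨m, hxF, hm.le⟩)
      rw [gradNorm, Real.sqrt_eq_zero_of_nonpos hq0, mul_zero, ENNReal.ofReal_zero]
    · rw [image_eq_zero_of_notMem_tsupport hxF, zero_mul, ENNReal.ofReal_zero]
  rw [← setLIntegral_eq_of_support_subset (s := ⋃ m, K m) (by
    intro x hx
    by_contra h
    exact hx (hsupp x h)), setLIntegral_iUnion_of_directed _ hKmono.directed_le]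
  refine iSup_le fun m => ?_
  have hreg : ∀ x : K m, gradSq g ρ x ≠ 0 := fun x =>
    ((by positivity : (0 : ℝ) < 1 / ((m : ℝ) + 1)).trans_le x.2.2).ne'
  choose i Φ T pr W hxW hW using fun x : K m => exists_isStraightening g hρ (hreg x)
  obtain ⟨t, ht⟩ := (hFc.isCompact.of_isClosed_subset (hKc m)
    inter_subset_left).elim_finite_subcover W (fun x => (hW x).isParametrization.isOpen_range)
    fun x hx => mem_iUnion.mpr ⟨⟨x, hx⟩, hxW _⟩
  obtain ⟨f, hf⟩ := SmoothPartitionOfUnity.exists_isSubordinate (𝓡 (n + 1)) (hKc m)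
    (fun c : t => W c) (fun c => (hW c).isParametrization.isOpen_range) fun x hx => by
      obtain ⟨c, hct, hxc⟩ := mem_iUnion₂.mp (ht hx)
      exact mem_iUnion.mpr ⟨⟨c, hct⟩, hxc⟩
  -- The sum being 1 on `K m` splits the level-set integral; its being at most 1 everywhere puts the
  -- volume integrals back together.
  have hsum1 : ∀ x ∈ K m, ∑ c : t, f c x = 1 := fun x hx => by
    rw [← finsum_eq_sum_of_fintype]; exact f.sum_eq_one hx
  have hsum2 : ∀ x, ∑ c : t, f c x ≤ 1 := fun x => by
    rw [← finsum_eq_sum_of_fintype]; exact f.sum_le_one x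
  have hfF : ∀ c, Continuous fun x => f c x * F x := fun c => (f c).contMDiff.continuous.mul hF
  have hmeas1 : ∀ c, Measurable fun x => ENNReal.ofReal (f c x * F x * gradNorm g ρ x) := fun c =>
    ((hfF c).mul hqn).measurable.ennreal_ofReal
  have hmeas2 : ∀ k c, Measurable fun x => ENNReal.ofReal (η k (ρ x)) *
      ENNReal.ofReal (f c x * F x * gradSq g ρ x) := fun k c =>
    ((hη.continuous k).comp hρ.continuous).measurable.ennreal_ofReal.mul
      ((hfF c).mul hq).measurable.ennreal_ofReal
  calc ∫⁻ x in K m, ENNReal.ofReal (F x * gradNorm g ρ x) ∂A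
      ≤ ∫⁻ x in K m, ∑ c : t, ENNReal.ofReal (f c x * F x * gradNorm g ρ x) ∂A := by
        refine setLIntegral_mono' (hKc m).measurableSet fun x hx => ?_
        rw [← ENNReal.ofReal_sum_of_nonneg fun c _ => mul_nonneg
          (mul_nonneg (f.nonneg c x) (hF0 x)) (gradNorm_nonneg g ρ x), ← Finset.sum_mul,
          ← Finset.sum_mul, hsum1 x hx, one_mul]
    _ ≤ ∑ c : t, ∫⁻ x in W c, ENNReal.ofReal (f c x * F x * gradNorm g ρ x) ∂A := by
        refine (setLIntegral_le_lintegral _ _).trans ?_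
        rw [lintegral_finsetSum _ fun c _ => hmeas1 c]
        refine Finset.sum_le_sum fun c _ => ?_
        rw [setLIntegral_eq_of_support_subset]
        intro x hx
        by_contra h
        refine hx ?_
        beta_reduce
        rw [image_eq_zero_of_notMem_tsupport fun h' => h (hf c h'), zero_mul, zero_mul,
          ENNReal.ofReal_zero]
    _ ≤ ∑ c : t, liminf (fun k => ∫⁻ x in W c, ENNReal.ofReal (η k (ρ x)) *
          ENNReal.ofReal (f c x * F x * gradSq g ρ x) ∂(volumeMeasure g)) atTop :=
        Finset.sum_le_sum fun c _ =>
          (hW c).setLIntegral_levelSet_le hgc hgp hρ hη (hfF c)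
    _ ≤ liminf (fun k => ∑ c : t, ∫⁻ x in W c, ENNReal.ofReal (η k (ρ x)) *
          ENNReal.ofReal (f c x * F x * gradSq g ρ x) ∂(volumeMeasure g)) atTop :=
        sum_liminf_le _
    _ ≤ _ := by
        refine liminf_le_liminf (Eventually.of_forall fun k => ?_)
        refine (Finset.sum_le_sum fun c _ => setLIntegral_le_lintegral _ _).trans ?_
        rw [← lintegral_finsetSum _ fun c _ => hmeas2 k c]
        refine lintegral_mono fun x => ?_
        simp only [← Finset.mul_sum]
        rw [← ENNReal.ofReal_sum_of_nonneg fun c _ => mul_nonneg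
          (mul_nonneg (f.nonneg c x) (hF0 x)) (gradSq_nonneg hgp ρ x)]
        gcongr
        simp only [mul_assoc, ← Finset.sum_mul]
        exact mul_le_of_le_one_left (mul_nonneg (hF0 x) (gradSq_nonneg hgp ρ x)) (hsum2 x)

end LevelSets

/-! ### Smooth approximations of a step function -/

section Step

/-- A smooth function which is `0` on `(-∞, p]` and `1` on `[p + 1 / (k + 1), ∞)`. -/
def smoothStep (p : ℝ) (k : ℕ) (t : ℝ) : ℝ := Real.smoothTransition ((k + 1) * (t - p))

lemma contDiff_smoothStep (p : ℝ) (k : ℕ) : ContDiff ℝ 2 (smoothStep p k) :=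
  (Real.smoothTransition.contDiff (n := 2)).comp
    (contDiff_const.mul (contDiff_id.sub contDiff_const))

lemma smoothStep_of_le {p t : ℝ} (k : ℕ) (h : t ≤ p) : smoothStep p k t = 0 :=
  Real.smoothTransition.zero_of_nonpos
    (mul_nonpos_of_nonneg_of_nonpos (by positivity) (sub_nonpos.mpr h))

lemma smoothStep_of_ge {p t : ℝ} {k : ℕ} (h : p + 1 / ((k : ℝ) + 1) ≤ t) :
    smoothStep p k t = 1 := by
  refine Real.smoothTransition.one_of_one_le ?_
  have h0 : (0 : ℝ) < k + 1 := by positivity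
  have h1 : 1 / ((k : ℝ) + 1) ≤ t - p := by linarith
  rwa [div_le_iff₀' h0] at h1

lemma monotone_smoothStep (p : ℝ) (k : ℕ) : Monotone (smoothStep p k) := fun a b hab =>
  Real.smoothTransition.monotone
    (mul_le_mul_of_nonneg_left (sub_le_sub_right hab p) (by positivity))

lemma hasDerivAt_smoothStep (p : ℝ) (k : ℕ) (t : ℝ) :
    HasDerivAt (smoothStep p k) (deriv (smoothStep p k) t) t :=
  ((contDiff_smoothStep p k).differentiable (by norm_num) t).hasDerivAt

lemma continuous_deriv_smoothStep (p : ℝ) (k : ℕ) : Continuous (deriv (smoothStep p k)) :=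
  (contDiff_smoothStep p k).continuous_deriv (by norm_num)

lemma deriv_smoothStep_nonneg (p : ℝ) (k : ℕ) (t : ℝ) : 0 ≤ deriv (smoothStep p k) t :=
  (monotone_smoothStep p k).deriv_nonneg

lemma deriv_smoothStep_eq_zero {p t : ℝ} {k : ℕ} (h : t ∉ Icc p (p + 1 / ((k : ℝ) + 1))) :
    deriv (smoothStep p k) t = 0 := by
  have h1 : t < p ∨ p + 1 / ((k : ℝ) + 1) < t := by
    by_contra! h'; exact h h'
  rcases h1 with h1 | h1
  · have : smoothStep p k =ᶠ[𝓝 t] fun _ => 0 := by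
      filter_upwards [gt_mem_nhds h1] with s hs using smoothStep_of_le k hs.le
    rw [this.deriv_eq, deriv_const]
  · have : smoothStep p k =ᶠ[𝓝 t] fun _ => 1 := by
      filter_upwards [lt_mem_nhds h1] with s hs using smoothStep_of_ge hs.le
    rw [this.deriv_eq, deriv_const]

lemma eventually_add_one_div_lt {p t : ℝ} (h : p < t) :
    ∀ᶠ k : ℕ in atTop, p + 1 / ((k : ℝ) + 1) < t := by
  have h1 := (tendsto_one_div_add_atTop_nhds_zero_nat (𝕜 := ℝ)).eventually
    (gt_mem_nhds (sub_pos.mpr h))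
  filter_upwards [h1] with k hk
  linarith

/-- The step is 0 at `p` itself, so the limit is the indicator of the closed half-line, which gives
`{ρ ≤ p}` and not `{ρ < p}`. -/
lemma tendsto_smoothStep (p t : ℝ) :
    Tendsto (fun k => 1 - smoothStep p k t) atTop (𝓝 ((Iic p).indicator 1 t)) := by
  by_cases h : t ≤ p
  · rw [indicator_of_mem (mem_Iic.mpr h)]
    simp [smoothStep_of_le _ h]
  · rw [indicator_of_notMem (by simpa using h)]
    refine tendsto_const_nhds.congr' ?_
    filter_upwards [eventually_add_one_div_lt (not_le.mp h)] with k hk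
    rw [smoothStep_of_ge hk.le, sub_self]

lemma isDeltaSequence_deriv_smoothStep (p : ℝ) :
    IsDeltaSequence (fun k => deriv (smoothStep p k)) p where
  continuous := continuous_deriv_smoothStep p
  lintegral_eq_one k := by
    have hi : Integrable (deriv (smoothStep p k)) :=
      (continuous_deriv_smoothStep p k).integrable_of_hasCompactSupport
        (HasCompactSupport.intro isCompact_Icc fun t ht => deriv_smoothStep_eq_zero ht)
    rw [← ofReal_integral_eq_lintegral_ofReal hi
      (Eventually.of_forall (deriv_smoothStep_nonneg p k)),
      integral_of_hasDerivAt_of_tendsto (hasDerivAt_smoothStep p k) hi (m := 0) (n := 1)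
        (tendsto_const_nhds.congr' ?_) (tendsto_const_nhds.congr' ?_), sub_zero, ENNReal.ofReal_one]
    · filter_upwards [eventually_le_atBot p] with t ht using (smoothStep_of_le k ht).symm
    · filter_upwards [eventually_ge_atTop _] with t ht using (smoothStep_of_ge ht).symm
  eventually_eq_zero U hU := by
    obtain ⟨ε, hε, hball⟩ := Metric.mem_nhds_iff.mp hU
    filter_upwards [eventually_add_one_div_lt (lt_add_of_pos_right p hε)] with k hk t ht
    refine deriv_smoothStep_eq_zero fun h => ht (hball ?_)
    rw [Metric.mem_ball, Real.dist_eq, abs_of_nonneg (sub_nonneg.mpr h.1)]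
    linarith [h.2]

end Step

/-! ### Green's formula on sublevel sets -/

section Sublevel

attribute [local instance] chartedSpaceSelf

variable {n : ℕ} {X : Type*} [TopologicalSpace X] [ChartedSpace (EuclideanSpace ℝ (Fin (n + 1))) X]
  [IsManifold (𝓡 (n + 1)) ∞ X] {g₀ : C2Metric (n + 1) X} {ρ : X → ℝ} {s : ℝ}
  [MeasurableSpace X] [BorelSpace X] [T2Space X] [SecondCountableTopology X]

/-- Green's inequality on the sublevel set `{ρ ≤ p}` of an adapted defining function: the
divergence of `φ ∇ρ` has nonnegative integral for `φ ≥ 0`, and this integral bounds the integral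
of `φ |∇ρ|` over the level set `{ρ = p}`. -/
theorem lintegral_levelSet_le_setIntegral (hρ : ContMDiff (𝓡 (n + 1)) 𝓘(ℝ, ℝ) 2 ρ)
    (hpos : ∀ x, 0 < ρ x) (hA : IsAdaptedInterior n s g₀ ρ) {φ : X → ℝ}
    (hφ : ContMDiff (𝓡 (n + 1)) 𝓘(ℝ, ℝ) 1 φ) (hc : HasCompactSupport φ) (hφ0 : ∀ x, 0 ≤ φ x)
    (p : ℝ) :
    0 ≤ ∫ x in {x | ρ x ≤ p}, (gradInner (conformal ρ g₀.inner) φ ρ x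
        - φ x * (s * (1 - gradSq (conformal ρ g₀.inner) ρ x) / ρ x))
        ∂(volumeMeasure (conformal ρ g₀.inner)) ∧
    ∫⁻ x, ENNReal.ofReal (φ x * gradNorm (conformal ρ g₀.inner) ρ x)
        ∂(areaMeasure (conformal ρ g₀.inner) n {x | ρ x = p})
      ≤ ENNReal.ofReal (∫ x in {x | ρ x ≤ p}, (gradInner (conformal ρ g₀.inner) φ ρ x
        - φ x * (s * (1 - gradSq (conformal ρ g₀.inner) ρ x) / ρ x))
        ∂(volumeMeasure (conformal ρ g₀.inner))) := by
  have hρ1 : ContMDiff (𝓡 (n + 1)) 𝓘(ℝ, ℝ) 1 ρ := hρ.of_le (by norm_num)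
  have hgc := g₀.isContinuousField.conformal hρ.continuous
  have hgp := g₀.isPosDefField.conformal fun x => (hpos x).ne'
  have := isLocallyFiniteMeasure_volumeMeasure hgc
  set g := conformal ρ g₀.inner with hg
  have hq : Continuous (gradSq g ρ) := continuous_gradInner hgc hgp hρ1 hρ1
  have hr : Continuous fun x => s * (1 - gradSq g ρ x) / ρ x :=
    (continuous_const.mul (continuous_const.sub hq)).div₀ hρ.continuous fun x => (hpos x).ne'
  set H : X → ℝ := fun x => gradInner g φ ρ x - φ x * (s * (1 - gradSq g ρ x) / ρ x) with hHdef
  have hH : Continuous H := (continuous_gradInner hgc hgp hφ hρ1).sub (hφ.continuous.mul hr)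
  have hHi : Integrable H (volumeMeasure g) :=
    hH.integrable_of_hasCompactSupport (HasCompactSupport.intro hc fun x hx => by
      simp only [hHdef]
      rw [gradInner_eq_zero _ ρ hx, image_eq_zero_of_notMem_tsupport hx, zero_mul, sub_zero])
  have hS : ∀ k, Continuous fun x => 1 - smoothStep p k (ρ x) := fun k =>
    continuous_const.sub ((contDiff_smoothStep p k).continuous.comp hρ.continuous)
  have hS' : ∀ k, Continuous fun x => deriv (smoothStep p k) (ρ x) := fun k =>
    (continuous_deriv_smoothStep p k).comp hρ.continuous
  -- Test the weak equation with `(1 - smoothStep(ρ)) φ`: the derivative falling on the cutoff gives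
  -- the left-hand side, and the remaining terms form `H`, the divergence of `φ ∇ρ`.
  have hkey : ∀ k, ∫ x, deriv (smoothStep p k) (ρ x) * (φ x * gradSq g ρ x) ∂(volumeMeasure g)
      = ∫ x, (1 - smoothStep p k (ρ x)) * H x ∂(volumeMeasure g) := fun k => by
    have hθ : ContMDiff (𝓡 (n + 1)) 𝓘(ℝ, ℝ) 1 fun x => 1 - smoothStep p k (ρ x) := fun x =>
      ((contDiff_const.sub ((contDiff_smoothStep p k).of_le (by norm_num))).contDiffAt (n := 1)
        (f := fun t => 1 - smoothStep p k t)).contMDiffAt.comp x (hρ1 x)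
    have hw := weak_equation hρ hpos hA (hθ.mul hφ) hc.mul_left
    rw [← hg] at hw
    have h1 : ∀ x, gradInner g (fun x => (1 - smoothStep p k (ρ x)) * φ x) ρ x
        = φ x * (-deriv (smoothStep p k) (ρ x) * gradSq g ρ x)
          + (1 - smoothStep p k (ρ x)) * gradInner g φ ρ x := fun x => by
      rw [gradInner_mul _ _ (hθ.mdifferentiable (by norm_num) x)
        (hφ.mdifferentiable (by norm_num) x),
        gradInner_comp g ρ (F := fun t => 1 - smoothStep p k t)
          (hρ1.mdifferentiable (by norm_num) x) ((hasDerivAt_smoothStep p k (ρ x)).const_sub 1)]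
      rfl
    have h2 : ∀ x, deriv (smoothStep p k) (ρ x) * (φ x * gradSq g ρ x)
        = (1 - smoothStep p k (ρ x)) * gradInner g φ ρ x
          - gradInner g (fun x => (1 - smoothStep p k (ρ x)) * φ x) ρ x := fun x => by
      rw [h1]; ring
    have i1 : Integrable (fun x => (1 - smoothStep p k (ρ x)) * gradInner g φ ρ x)
        (volumeMeasure g) :=
      ((hS k).mul (continuous_gradInner hgc hgp hφ hρ1)).integrable_of_hasCompactSupport
        (HasCompactSupport.intro hc fun x hx => by
          rw [Pi.mul_apply, gradInner_eq_zero _ ρ hx, mul_zero])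
    have i2 : Integrable (gradInner g (fun x => (1 - smoothStep p k (ρ x)) * φ x) ρ)
        (volumeMeasure g) :=
      (continuous_gradInner hgc hgp (hθ.mul hφ) hρ1).integrable_of_hasCompactSupport
        (HasCompactSupport.intro (hc.mul_left (f := fun x => 1 - smoothStep p k (ρ x)))
          fun x hx => gradInner_eq_zero _ ρ hx)
    have i3 : Integrable (fun x => (1 - smoothStep p k (ρ x)) * φ x
        * (s * (1 - gradSq g ρ x) / ρ x)) (volumeMeasure g) :=
      (((hS k).mul hφ.continuous).mul hr).integrable_of_hasCompactSupport
        ((hc.mul_left).mul_right)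
    calc _ = ∫ x, (1 - smoothStep p k (ρ x)) * gradInner g φ ρ x ∂(volumeMeasure g)
          - ∫ x, (1 - smoothStep p k (ρ x)) * φ x * (s * (1 - gradSq g ρ x) / ρ x)
            ∂(volumeMeasure g) := by
          simp only [h2]
          rw [integral_sub i1 i2]
          exact congrArg _ hw
      _ = _ := by
          rw [← integral_sub i1 i3]
          exact integral_congr_ae (Eventually.of_forall fun x => by simp only [hHdef]; ring)
  have hm : MeasurableSet {x | ρ x ≤ p} := (isClosed_le hρ.continuous continuous_const).measurableSet
  have hlim : Tendsto (fun k => ∫ x, (1 - smoothStep p k (ρ x)) * H x ∂(volumeMeasure g)) atTop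
      (𝓝 (∫ x in {x | ρ x ≤ p}, H x ∂(volumeMeasure g))) := by
    rw [← integral_indicator hm]
    refine tendsto_integral_of_dominated_convergence (fun x => ‖H x‖)
      (fun k => ((hS k).mul hH).measurable.aestronglyMeasurable) hHi.norm
      (fun k => Eventually.of_forall fun x => ?_) (Eventually.of_forall fun x => ?_)
    · have h0 : 0 ≤ smoothStep p k (ρ x) := Real.smoothTransition.nonneg _
      have h1 : smoothStep p k (ρ x) ≤ 1 := Real.smoothTransition.le_one _
      rw [norm_mul, Real.norm_of_nonneg (by linarith)]
      exact mul_le_of_le_one_left (norm_nonneg _) (by linarith)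
    · have h := (tendsto_smoothStep p (ρ x)).mul_const (H x)
      convert h using 2
      by_cases hx : ρ x ≤ p
      · rw [indicator_of_mem (show x ∈ {x | ρ x ≤ p} from hx),
          indicator_of_mem (mem_Iic.mpr hx), Pi.one_apply, one_mul]
      · rw [indicator_of_notMem (show x ∉ {x | ρ x ≤ p} from hx),
          indicator_of_notMem (by simpa using hx), zero_mul]
  have hn : ∀ k x, 0 ≤ deriv (smoothStep p k) (ρ x) * (φ x * gradSq g ρ x) := fun k x =>
    mul_nonneg (deriv_smoothStep_nonneg p k _) (mul_nonneg (hφ0 x) (gradSq_nonneg hgp ρ x))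
  -- The limit of nonnegative integrals is nonnegative, so `ENNReal.ofReal` of it discards nothing.
  refine ⟨ge_of_tendsto' hlim fun k => ?_, ?_⟩
  · rw [← hkey]
    exact integral_nonneg (hn k)
  · refine (lintegral_levelSet_le_liminf hgc hgp hρ1 (isDeltaSequence_deriv_smoothStep p)
      hφ.continuous hφ0 hc).trans_eq ?_
    have h1 : ∀ k, ∫⁻ x, ENNReal.ofReal (deriv (smoothStep p k) (ρ x))
        * ENNReal.ofReal (φ x * gradSq g ρ x) ∂(volumeMeasure g)
        = ENNReal.ofReal (∫ x, (1 - smoothStep p k (ρ x)) * H x ∂(volumeMeasure g)) := fun k => by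
      have hi : Integrable (fun x => deriv (smoothStep p k) (ρ x) * (φ x * gradSq g ρ x))
          (volumeMeasure g) :=
        ((hS' k).mul (hφ.continuous.mul hq)).integrable_of_hasCompactSupport
          ((hc.mul_right).mul_left)
      rw [← hkey, ofReal_integral_eq_lintegral_ofReal hi (Eventually.of_forall (hn k))]
      exact lintegral_congr fun x => (ENNReal.ofReal_mul (deriv_smoothStep_nonneg p k _)).symm
    simp only [h1]
    exact ((ENNReal.continuous_ofReal.tendsto _).comp hlim).liminf_eq

end Sublevel

/-! ### The weighted inequality -/

section GradSq

variable {d : ℕ} {X : Type*} [TopologicalSpace X] [ChartedSpace (EuclideanSpace ℝ (Fin d)) X]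
  {g : MetricField d X}

lemma gradInner_comm (hg : IsPosDefField g) (u v : X → ℝ) (x : X) :
    gradInner g u v x = gradInner g v u x := by
  rw [gradInner, gradInner, Finset.sum_comm]
  refine Finset.sum_congr rfl fun i _ => Finset.sum_congr rfl fun j _ => ?_
  have h : (gramAt g x)⁻¹ j i = (gramAt g x)⁻¹ i j := by
    simpa using (hg.gramAt_posDef x).inv.isHermitian.apply i j
  rw [h]
  ring

/-- This is `|a∇u + b∇v|² ≥ 0`, the source of Young's inequality. -/
lemma gradInner_quadratic_nonneg (hg : IsPosDefField g) (u v : X → ℝ) (x : X) (a b : ℝ) :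
    0 ≤ a ^ 2 * gradSq g u x + 2 * a * b * gradInner g u v x + b ^ 2 * gradSq g v x := by
  have h := (hg.gramAt_posDef x).inv.posSemidef.dotProduct_mulVec_nonneg
    (fun i => a * partialAt u x i + b * partialAt v x i)
  rw [star_trivial, ← sum_eq_dotProduct] at h
  refine h.trans_eq ?_
  have h2 : 2 * a * b * gradInner g u v x
      = a * b * gradInner g u v x + a * b * gradInner g v u x := by
    rw [gradInner_comm hg v u]; ring
  rw [h2]
  simp only [gradSq, gradInner, Finset.mul_sum, ← Finset.sum_add_distrib]
  exact Finset.sum_congr rfl fun i _ => Finset.sum_congr rfl fun j _ => by ring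

end GradSq

/-! ### The divergence estimate and its integration over sublevel sets -/

section WeightedInequality

attribute [local instance] chartedSpaceSelf

variable {n : ℕ} {X : Type*} [TopologicalSpace X] [ChartedSpace (EuclideanSpace ℝ (Fin (n + 1))) X]
  [IsManifold (𝓡 (n + 1)) ∞ X] {g₀ : C2Metric (n + 1) X} {ρ : X → ℝ} {γ b : ℝ}

/-- For `d = n + 1` and `s = n/2 + γ` the constant term is `-n(n+1) + 2ns = n(2γ-1)`, and the
coefficient of `|∇ρ|²` is `2n(n-s) - n(n-1) = -n(2γ-1)`. -/
lemma scalarCurvature_adapted (hρ : ContMDiff (𝓡 (n + 1)) 𝓘(ℝ, ℝ) 2 ρ) (hpos : ∀ x, 0 < ρ x)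
    (hE : IsEinstein g₀.inner (-(n : ℝ))) (hA : IsAdaptedInterior n ((n : ℝ) / 2 + γ) g₀ ρ)
    (x : X) :
    scalarCurvature (conformal ρ g₀.inner) x = (ρ x ^ 2)⁻¹
      * (n * (2 * γ - 1) * (1 - gradSq (conformal ρ g₀.inner) ρ x)) := by
  rw [scalarCurvature_conformal hρ hpos hE hA]
  push_cast
  ring

/-- The pointwise estimate of the divergence of `ρ^(2-2b) f² ∇ρ`. -/
lemma divergence_le (hn : 1 ≤ n) (hγ : 1 < γ) (hb : 1 < b)
    (hρ : ContMDiff (𝓡 (n + 1)) 𝓘(ℝ, ℝ) 2 ρ) (hpos : ∀ x, 0 < ρ x)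
    (hE : IsEinstein g₀.inner (-(n : ℝ))) (hA : IsAdaptedInterior n ((n : ℝ) / 2 + γ) g₀ ρ)
    {f : X → ℝ} (hf : ContMDiff (𝓡 (n + 1)) 𝓘(ℝ, ℝ) 1 f) (x : X) :
    gradInner (conformal ρ g₀.inner) (fun x => ρ x ^ (2 - 2 * b) * f x ^ 2) ρ x
        - ρ x ^ (2 - 2 * b) * f x ^ 2 * (((n : ℝ) / 2 + γ)
          * (1 - gradSq (conformal ρ g₀.inner) ρ x) / ρ x)
      ≤ (b - 1)⁻¹ * (ρ x ^ (3 - 2 * b) * gradSq (conformal ρ g₀.inner) f x)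
        - (b - 1) * (ρ x ^ (1 - 2 * b) * gradSq (conformal ρ g₀.inner) ρ x * f x ^ 2)
        - ((n : ℝ) / 2 + γ) / (n * (2 * γ - 1))
          * (ρ x ^ (3 - 2 * b) * scalarCurvature (conformal ρ g₀.inner) x * f x ^ 2) := by
  have hgp := g₀.isPosDefField.conformal fun x => (hpos x).ne'
  have hρ1 : ContMDiff (𝓡 (n + 1)) 𝓘(ℝ, ℝ) 1 ρ := hρ.of_le (by norm_num)
  have hR := scalarCurvature_adapted hρ hpos hE hA x
  set g := conformal ρ g₀.inner with hg
  have hx := hpos x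
  have hn' : (0 : ℝ) < n := by exact_mod_cast hn
  have hγ' : 0 < 2 * γ - 1 := by linarith
  have hα : 0 < b - 1 := by linarith
  have hdρ := hρ1.mdifferentiable (by norm_num) x
  have hdf := hf.mdifferentiable (by norm_num) x
  have hpw : HasDerivAt (fun t : ℝ => t ^ (2 - 2 * b)) ((2 - 2 * b) * ρ x ^ (2 - 2 * b - 1)) (ρ x) :=
    Real.hasDerivAt_rpow_const (Or.inl hx.ne')
  have hsq : HasDerivAt (fun t : ℝ => t ^ 2) (2 * f x) (f x) := by
    simpa using hasDerivAt_pow 2 (f x)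
  have d1 : MDifferentiableAt (𝓡 (n + 1)) 𝓘(ℝ, ℝ) (fun x => ρ x ^ (2 - 2 * b)) x :=
    hpw.differentiableAt.mdifferentiableAt.comp x hdρ
  have d2 : MDifferentiableAt (𝓡 (n + 1)) 𝓘(ℝ, ℝ) (fun x => f x ^ 2) x :=
    hsq.differentiableAt.mdifferentiableAt.comp x hdf
  rw [gradInner_mul g ρ d1 d2, gradInner_comp g ρ (F := fun t => t ^ (2 - 2 * b)) hdρ hpw,
    gradInner_comp g ρ (F := fun t => t ^ 2) hdf hsq, ← gradSq_eq_gradInner, hR]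
  have e2 : ρ x ^ (2 - 2 * b) = ρ x ^ (1 - 2 * b) * ρ x := by
    rw [← Real.rpow_add_one hx.ne']; congr 1; ring
  have e1 : ρ x ^ (2 - 2 * b - 1) = ρ x ^ (1 - 2 * b) := by congr 1; ring
  have e3 : ρ x ^ (3 - 2 * b) = ρ x ^ (1 - 2 * b) * ρ x ^ 2 := by
    rw [← Real.rpow_add_natCast hx.ne']; congr 1; push_cast; ring
  have hP : 0 < ρ x ^ (1 - 2 * b) := Real.rpow_pos_of_pos hx _
  rw [e1, e2, e3]
  -- Expanding `|(b-1) f ∇ρ - ρ ∇f|² ≥ 0` and multiplying by `ρ^(1-2b)/(b-1)` bounds the cross term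
  -- while using up exactly half of `2(b-1) ρ^(1-2b)|∇ρ|² f²`.
  have hquad := gradInner_quadratic_nonneg hgp ρ f x ((b - 1) * f x) (-ρ x)
  rw [gradInner_comm hgp ρ f] at hquad
  set P := ρ x ^ (1 - 2 * b)
  set q := gradSq g ρ x
  set D := gradSq g f x
  set I := gradInner g f ρ x
  have hmul := mul_nonneg (mul_nonneg hP.le (inv_nonneg.mpr hα.le)) hquad
  have h1 : P * (b - 1)⁻¹ * (((b - 1) * f x) ^ 2 * q + 2 * ((b - 1) * f x) * -ρ x * I
      + (-ρ x) ^ 2 * D) = (b - 1) * (P * q * f x ^ 2) - 2 * (P * ρ x * f x * I)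
        + (b - 1)⁻¹ * (P * ρ x ^ 2 * D) := by
    field_simp
    ring
  have h2 : ((n : ℝ) / 2 + γ) / (n * (2 * γ - 1))
      * (P * ρ x ^ 2 * ((ρ x ^ 2)⁻¹ * (n * (2 * γ - 1) * (1 - q))) * f x ^ 2)
      = ((n : ℝ) / 2 + γ) * P * (1 - q) * f x ^ 2 := by
    field_simp
  have h3 : P * ρ x * f x ^ 2 * (((n : ℝ) / 2 + γ) * (1 - q) / ρ x)
      = ((n : ℝ) / 2 + γ) * P * (1 - q) * f x ^ 2 := by
    field_simp
  rw [h1] at hmul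
  rw [h2, h3]
  linarith

variable [MeasurableSpace X] [BorelSpace X] [T2Space X] [SecondCountableTopology X]

/-- Integrate `divergence_le` over `{ρ ≤ p}` and bound the level-set term by the integral of the
divergence. The number `m` lies below the three coefficients of the terms to be controlled, so that
one constant serves for all. -/
theorem weighted_inequality (hn : 1 ≤ n) (hγ : 1 < γ) (hb : 1 < b)
    (hρ : ContMDiff (𝓡 (n + 1)) 𝓘(ℝ, ℝ) 2 ρ) (hpos : ∀ x, 0 < ρ x)
    (hE : IsEinstein g₀.inner (-(n : ℝ))) (hA : IsAdaptedInterior n ((n : ℝ) / 2 + γ) g₀ ρ)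
    (hR0 : ∀ x, 0 ≤ scalarCurvature (conformal ρ g₀.inner) x)
    {m : ℝ} (hm0 : 0 < m) (hm1 : m ≤ 1) (hmb : m ≤ b - 1)
    (hmc : m ≤ ((n : ℝ) / 2 + γ) / (n * (2 * γ - 1)))
    {f : X → ℝ} (hf : ContMDiff (𝓡 (n + 1)) 𝓘(ℝ, ℝ) 1 f) (hc : HasCompactSupport f) (p : ℝ) :
    (∫⁻ x in {x | ρ x ≤ p},
          ENNReal.ofReal (ρ x ^ (1 - 2 * b) * gradSq (conformal ρ g₀.inner) ρ x * f x ^ 2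
            + ρ x ^ (3 - 2 * b) * scalarCurvature (conformal ρ g₀.inner) x * f x ^ 2)
          ∂(volumeMeasure (conformal ρ g₀.inner)))
        + (∫⁻ x, ENNReal.ofReal (ρ x ^ (2 - 2 * b) * gradNorm (conformal ρ g₀.inner) ρ x * f x ^ 2)
            ∂(areaMeasure (conformal ρ g₀.inner) n {x | ρ x = p}))
        ≤ ENNReal.ofReal ((b - 1)⁻¹ * m⁻¹) *
          ∫⁻ x in {x | ρ x ≤ p},
            ENNReal.ofReal (ρ x ^ (3 - 2 * b) * gradSq (conformal ρ g₀.inner) f x)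
            ∂(volumeMeasure (conformal ρ g₀.inner)) ∧
      ∫⁻ x in {x | ρ x ≤ p},
            ENNReal.ofReal (ρ x ^ (3 - 2 * b) * gradSq (conformal ρ g₀.inner) f x)
            ∂(volumeMeasure (conformal ρ g₀.inner)) < ⊤ := by
  have hρ1 : ContMDiff (𝓡 (n + 1)) 𝓘(ℝ, ℝ) 1 ρ := hρ.of_le (by norm_num)
  have hgc := g₀.isContinuousField.conformal hρ.continuous
  have hgp := g₀.isPosDefField.conformal fun x => (hpos x).ne'
  have := isLocallyFiniteMeasure_volumeMeasure hgc
  have hdiv := divergence_le hn hγ hb hρ hpos hE hA hf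
  have hscal := scalarCurvature_adapted hρ hpos hE hA
  have hpw : ∀ a : ℝ, Continuous fun x => ρ x ^ a := fun a =>
    hρ.continuous.rpow_const fun x => Or.inl (hpos x).ne'
  have hpw0 : ∀ (a : ℝ) x, 0 ≤ ρ x ^ a := fun a x => (Real.rpow_pos_of_pos (hpos x) a).le
  set φ : X → ℝ := fun x => ρ x ^ (2 - 2 * b) * f x ^ 2 with hφdef
  have hφ : ContMDiff (𝓡 (n + 1)) 𝓘(ℝ, ℝ) 1 φ := by
    refine ContMDiff.mul (fun x => ?_) (hf.pow 2)
    exact (Real.contDiffAt_rpow_const_of_ne (n := 1) (hpos x).ne').contMDiffAt.comp x (hρ1 x)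
  have hφc : HasCompactSupport φ := HasCompactSupport.intro hc fun x hx => by
    simp only [hφdef, image_eq_zero_of_notMem_tsupport hx]
    ring
  have hφ0 : ∀ x, 0 ≤ φ x := fun x => mul_nonneg (hpw0 _ x) (sq_nonneg _)
  obtain ⟨hH0, hbd⟩ := lintegral_levelSet_le_setIntegral hρ hpos hA hφ hφc hφ0 p
  set g := conformal ρ g₀.inner with hg
  set μ := (volumeMeasure g).restrict {x | ρ x ≤ p} with hμ
  have hq : Continuous (gradSq g ρ) := continuous_gradInner hgc hgp hρ1 hρ1
  have hD : Continuous (gradSq g f) := continuous_gradInner hgc hgp hf hf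
  have hR : Continuous (scalarCurvature g) := by
    rw [funext hscal]
    exact ((hρ.continuous.pow 2).inv₀ fun x => (pow_pos (hpos x) 2).ne').mul
      (continuous_const.mul (continuous_const.sub hq))
  have hr : Continuous fun x => ((n : ℝ) / 2 + γ) * (1 - gradSq g ρ x) / ρ x :=
    (continuous_const.mul (continuous_const.sub hq)).div₀ hρ.continuous fun x => (hpos x).ne'
  -- All volume integrands are continuous with support in that of `f`, hence integrable. This also
  -- gives the finiteness claim and lets real integrals replace `ℝ≥0∞`-valued ones.
  have hint : ∀ {u : X → ℝ}, Continuous u → (∀ x ∉ tsupport f, u x = 0) → Integrable u μ :=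
    fun hu h0 => (hu.integrable_of_hasCompactSupport (HasCompactSupport.intro hc h0)).restrict
  set uq : X → ℝ := fun x => ρ x ^ (1 - 2 * b) * gradSq g ρ x * f x ^ 2 with huq
  set uR : X → ℝ := fun x => ρ x ^ (3 - 2 * b) * scalarCurvature g x * f x ^ 2 with huR
  set uD : X → ℝ := fun x => ρ x ^ (3 - 2 * b) * gradSq g f x with huD
  set H : X → ℝ := fun x => gradInner g φ ρ x
    - φ x * (((n : ℝ) / 2 + γ) * (1 - gradSq g ρ x) / ρ x) with hHdef
  have iq : Integrable uq μ := hint (((hpw _).mul hq).mul (hf.continuous.pow 2)) fun x hx => by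
    simp only [huq, image_eq_zero_of_notMem_tsupport hx]; ring
  have iR : Integrable uR μ := hint (((hpw _).mul hR).mul (hf.continuous.pow 2)) fun x hx => by
    simp only [huR, image_eq_zero_of_notMem_tsupport hx]; ring
  have iD : Integrable uD μ := hint ((hpw _).mul hD) fun x hx => by
    simp only [huD]
    rw [gradSq_eq_gradInner, gradInner_eq_zero g f hx, mul_zero]
  have iH : Integrable H μ := by
    refine ((((continuous_gradInner hgc hgp hφ hρ1).sub
      (hφ.continuous.mul hr))).integrable_of_hasCompactSupport
        (HasCompactSupport.intro hφc fun x hx => ?_)).restrict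
    rw [Pi.sub_apply, Pi.mul_apply, gradInner_eq_zero g ρ hx, image_eq_zero_of_notMem_tsupport hx,
      zero_mul, sub_zero]
  have nq : ∀ x, 0 ≤ uq x := fun x =>
    mul_nonneg (mul_nonneg (hpw0 _ x) (gradSq_nonneg hgp ρ x)) (sq_nonneg _)
  have nR : ∀ x, 0 ≤ uR x := fun x => mul_nonneg (mul_nonneg (hpw0 _ x) (hR0 x)) (sq_nonneg _)
  have nD : ∀ x, 0 ≤ uD x := fun x => mul_nonneg (hpw0 _ x) (gradSq_nonneg hgp f x)
  have hle : ∫ x, H x ∂μ ≤ (b - 1)⁻¹ * ∫ x, uD x ∂μ - (b - 1) * ∫ x, uq x ∂μ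
      - ((n : ℝ) / 2 + γ) / (n * (2 * γ - 1)) * ∫ x, uR x ∂μ := by
    have j1 := (iD.const_mul (b - 1)⁻¹).sub (iq.const_mul (b - 1))
    have j2 := iR.const_mul (((n : ℝ) / 2 + γ) / (n * (2 * γ - 1)))
    refine (integral_mono iH (j1.sub j2) hdiv).trans_eq ?_
    rw [integral_sub' j1 j2, integral_sub' (iD.const_mul _) (iq.const_mul _), integral_const_mul,
      integral_const_mul, integral_const_mul]
  have Nq : 0 ≤ ∫ x, uq x ∂μ := integral_nonneg nq
  have NR : 0 ≤ ∫ x, uR x ∂μ := integral_nonneg nR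
  have hfin : (∫ x, uq x ∂μ + ∫ x, uR x ∂μ) + ∫ x, H x ∂μ ≤ (b - 1)⁻¹ * m⁻¹ * ∫ x, uD x ∂μ := by
    -- Lowering the coefficients `b - 1`, `c` and 1 to `m` needs each integral to be nonnegative:
    -- for the curvature term by `R ≥ 0`, for the divergence by `lintegral_levelSet_le_setIntegral`.
    have h1 : m * ((∫ x, uq x ∂μ + ∫ x, uR x ∂μ) + ∫ x, H x ∂μ) ≤ (b - 1)⁻¹ * ∫ x, uD x ∂μ := by
      have a1 := mul_le_mul_of_nonneg_right hmb Nq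
      have a2 := mul_le_mul_of_nonneg_right hmc NR
      have a3 := mul_le_mul_of_nonneg_right hm1 hH0
      linarith
    rw [mul_right_comm, ← div_eq_mul_inv, le_div_iff₀' hm0]
    exact h1
  have hDl : ∫⁻ x, ENNReal.ofReal (uD x) ∂μ = ENNReal.ofReal (∫ x, uD x ∂μ) :=
    (ofReal_integral_eq_lintegral_ofReal iD (Eventually.of_forall nD)).symm
  have hVl : ∫⁻ x, ENNReal.ofReal (uq x + uR x) ∂μ
      = ENNReal.ofReal (∫ x, uq x ∂μ + ∫ x, uR x ∂μ) := by
    rw [← integral_add iq iR]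
    exact (ofReal_integral_eq_lintegral_ofReal (iq.add iR)
      (Eventually.of_forall fun x => add_nonneg (nq x) (nR x))).symm
  have hBl : ∫⁻ x, ENNReal.ofReal (ρ x ^ (2 - 2 * b) * gradNorm g ρ x * f x ^ 2)
      ∂(areaMeasure g n {x | ρ x = p}) ≤ ENNReal.ofReal (∫ x, H x ∂μ) := by
    refine le_of_eq_of_le (lintegral_congr fun x => congrArg _ ?_) hbd
    simp only [hφdef]
    ring
  refine ⟨?_, by rw [hDl]; exact ENNReal.ofReal_lt_top⟩
  rw [hDl, hVl, ← ENNReal.ofReal_mul (mul_nonneg (inv_nonneg.mpr (by linarith))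
    (inv_nonneg.mpr hm0.le))]
  calc _ ≤ ENNReal.ofReal (∫ x, uq x ∂μ + ∫ x, uR x ∂μ) + ENNReal.ofReal (∫ x, H x ∂μ) := by
        gcongr
    _ = ENNReal.ofReal ((∫ x, uq x ∂μ + ∫ x, uR x ∂μ) + ∫ x, H x ∂μ) :=
        (ENNReal.ofReal_add (add_nonneg Nq NR) hH0).symm
    _ ≤ _ := ENNReal.ofReal_le_ofReal hfin

end WeightedInequality

end PoincareEinstein

end

/-! ### The theorem, with an explicit constant -/

theorem mainTheorem5 (n : ℕ) (hn : 1 ≤ n) (γ b : ℝ) (hγ : 1 < γ) (hb : 1 < b) :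
    ∃ C : ℝ, 0 < C ∧
      ∀ (X : Type*) [TopologicalSpace X] [T2Space X] [SecondCountableTopology X]
        [ChartedSpace (EuclideanSpace ℝ (Fin (n + 1))) X] [IsManifold (𝓡 (n + 1)) ∞ X]
        [MeasurableSpace X] [BorelSpace X]
        (Xbar : Type*) [TopologicalSpace Xbar] [T2Space Xbar] [SecondCountableTopology Xbar]
        [ChartedSpace (EuclideanHalfSpace (n + 1)) Xbar] [IsManifold (𝓡∂ (n + 1)) ∞ Xbar]
        (ι : X → Xbar) (gPlus : C2Metric (n + 1) X) (ρbar : Xbar → ℝ)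
        (ρ : X → ℝ) (g : MetricField (n + 1) X),
        IsInteriorOf n ι →
        IsPoincareEinstein ι gPlus →
        IsAdapted ι gPlus ((n : ℝ) / 2 + γ) ρbar →
        ρ = ρbar ∘ ι →
        g = conformal ρ gPlus.inner →
        (∀ x, 0 ≤ scalarCurvature g x) →
        ∀ (p : ℝ) (f : X → ℝ), ContMDiff (𝓡 (n + 1)) 𝓘(ℝ, ℝ) ∞ f → HasCompactSupport f →
          (∫⁻ x in {x | ρ x ≤ p},
              ENNReal.ofReal (ρ x ^ (1 - 2 * b) * gradSq g ρ x * f x ^ 2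
                + ρ x ^ (3 - 2 * b) * scalarCurvature g x * f x ^ 2) ∂(volumeMeasure g))
            + (∫⁻ x, ENNReal.ofReal (ρ x ^ (2 - 2 * b) * gradNorm g ρ x * f x ^ 2)
                ∂(areaMeasure g n {x | ρ x = p}))
            ≤ ENNReal.ofReal C *
              ∫⁻ x in {x | ρ x ≤ p},
                ENNReal.ofReal (ρ x ^ (3 - 2 * b) * gradSq g f x) ∂(volumeMeasure g) ∧
          ∫⁻ x in {x | ρ x ≤ p},
                ENNReal.ofReal (ρ x ^ (3 - 2 * b) * gradSq g f x) ∂(volumeMeasure g) < ⊤ := by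
  have hn' : (0 : ℝ) < n := by exact_mod_cast hn
  have hc : 0 < ((n : ℝ) / 2 + γ) / (n * (2 * γ - 1)) :=
    div_pos (by linarith) (mul_pos hn' (by linarith))
  have hb' : 0 < b - 1 := sub_pos.mpr hb
  -- The three entries are the coefficients of the boundary, gradient and curvature terms after
  -- Young's inequality; they depend only on `n`, `γ` and `b`, so the constant can be fixed before
  -- the manifold.
  set m := min 1 (min (b - 1) (((n : ℝ) / 2 + γ) / (n * (2 * γ - 1)))) with hm
  have hm0 : 0 < m := lt_min one_pos (lt_min hb' hc)
  refine ⟨(b - 1)⁻¹ * m⁻¹, mul_pos (inv_pos.mpr hb') (inv_pos.mpr hm0), ?_⟩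
  intro X _ _ _ _ _ _ _ Xbar _ _ _ _ _ ι gPlus ρbar ρ g _ hPE hA hρ hg hR p f hf hfc
  subst hρ hg
  obtain ⟨hpos, hρ2, hAI⟩ := hA.interior
  exact weighted_inequality hn hγ hb hρ2 hpos hPE.einstein hAI hR hm0 (min_le_left _ _)
    ((min_le_right _ _).trans (min_le_left _ _)) ((min_le_right _ _).trans (min_le_right _ _))
    (hf.of_le (by norm_cast)) hfc p
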